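/- **Conventions.** Everything below is indexed by a security parameter $\lambda$. A function $\mu:\mathbb N\to\mathbb R_{\ge 0}$ is negligible if $p(\lambda)\mu(\lambda)\to 0$ for every polynomial $p$. "Efficient" means: computed by circuits (Boolean, resp. quantum with arbitrary unitary gates on at most three qubits) whose number of wires plus number of gates is polynomial in $\lambda$, one circuit for each $\lambda$; QPT procedures are such quantum circuits with auxiliary zeros and a final standard basis measurement. Families $\{D_0\},\{D_1\}$ of distributions on strings are computationally indistinguishable if for every QPT $\mathcal A$ there is a negligible $\mu$ with $|\Pr_{m\leftarrow D_0}[\mathcal A(m)=0]-\Pr_{m\leftarrow D_1}[\mathcal A(m)=0]|\le\mu(\lambda)$ for all $\lambda$. All finite sets consist of bit strings of polynomial length. **Function families.** An NTCF family $\mathcal F$ consists of densities $f_{k,b}(x)$ on $\mathcal Y$ for $k\in\mathcal K_{\mathcal F}$, $b\in\{0,1\}$, $x\in\mathcal X$, such that: (1) an efficient probabilistic GEN$_{\mathcal F}$ outputs a key $k\in\mathcal K_{\mathcal F}$ with a trapdoor $t_k$; (2) for each $k,b$ the supports of $f_{k,b}(x)$, $x\in\mathcal X$, are disjoint, an efficient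 INV$_{\mathcal F}(t_k,b,y)$ returns $x$ whenever $y\in\mathrm{Supp} f_{k,b}(x)$, and $\mathcal R_k=\{(x_0,x_1): f_{k,0}(x_0)=f_{k,1}(x_1)\}$ is a perfect matching; (3) there are densities $f'_{k,b}(x)$ with: if $(x_0,x_1)\in\mathcal R_k$ and $y\in\mathrm{Supp} f'_{k,b}(x_b)$ then INV$_{\mathcal F}(t_k,0,y)=x_0$ and INV$_{\mathcal F}(t_k,1,y)=x_1$; an efficient CHK$(k,b,x,y)$ decides $y\in\mathrm{Supp}f'_{k,b}(x)$; the mean over $x\in\mathcal X$ of $H^2(f_{k,b}(x),f'_{k,b}(x))$ is at most a negligible function; and an efficient SAMP prepares $|\mathcal X|^{-1/2}\sum_{x,y}\sqrt{f'_{k,b}(x)(y)}|x\rangle|y\rangle$ on input $k,b$; (4) there are $w$ (polynomially bounded), sets $G_{k,b,x}\subseteq\{0,1\}^w$ containing all but a negligible fraction of $\{0,1\}^w$, with membership efficiently decidable from $k,b,x,t_k$, and an injection $J:\mathcal X\to\{0,1\}^w$, efficiently computable and efficiently invertible on its range, such that for $H_k=\{(b,x_b,d,d\cdot(J(x_0)\oplus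 J(x_1))): b\in\{0,1\}, (x_0,x_1)\in\mathcal R_k, d\in G_{k,0,x_0}\cap G_{k,1,x_1}\}$ and $\overline H_k$ obtained by flipping the last bit, for every QPT $\mathcal A$ there is a negligible $\mu$ with $|\Pr[\mathcal A(k)\in H_k]-\Pr[\mathcal A(k)\in\overline H_k]|\le\mu(\lambda)$, $k$ being generated by GEN$_{\mathcal F}$. A trapdoor injective family $\mathcal G$ consists of densities $g_{k,b}(x)$, $k\in\mathcal K_{\mathcal G}$, with an efficient GEN$_{\mathcal G}$, such that for each $k$ the supports of all $g_{k,b}(x)$ are pairwise disjoint, an efficient INV$_{\mathcal G}(t_k,y)$ returns $(b,x)$ whenever $y\in\mathrm{Supp}\,g_{k,b}(x)$, and CHK, SAMP as above exist with $g$ in place of $f'$. $\mathcal F$ is an extended trapdoor claw-free family (with $\mathcal G$) if (i) CHK and SAMP of $\mathcal F$ and $\mathcal G$ are the same algorithms, and no QPT procedure distinguishes the keys of GEN$_{\mathcal F}$ from those of GEN$_{\mathcal G}$ with more than negligible advantage; (ii) for every QPT $\mathcal A$ there are a negligible $\mu$ and strings $d=d_\lambda\in\{0,1\}^w$ with $|\Pr[\mathcal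 A(k,d)\in\{d\cdot(J(x_0)\oplus J(x_1)):(x_0,x_1)\in\mathcal R_k\}]-\tfrac12|\le\mu(\lambda)$, $k$ being generated by GEN$_{\mathcal F}$. **Protocol.** Let $n$ be polynomially bounded and $h\in\{0,1\}^n$. For each $i$ the verifier samples $(k_i,t_{k_i})$ from GEN$_{\mathcal F}$ if $h_i=1$ and from GEN$_{\mathcal G}$ if $h_i=0$, and sends the keys. A prover characterized by $(U_0,\mathcal S)$, with $U_0$ a unitary and $\mathcal S$ a CPTP map, has $n$ committed qubits, $n$ preimage registers, $n$ commitment string registers, auxiliary qubits (all initially $0$) and registers with the keys; it applies $U_0$ (using the keys as control only) and measures the commitment string registers, reporting $y_1,\dots,y_n$. In a test round it measures committed qubits and preimage registers in the standard basis, giving $b'_i,x'_i$; the verifier accepts if $x_i'\in\mathcal X$ and CHK$(k_i,b'_i,x'_i,y_i)=1$ for all $i$. In a Hadamard round it appends zeros to the preimage registers, applies to each an efficient unitary $U_J$ with $U_J|x\rangle|0\rangle=|J(x)\rangle|0\rangle$ for $x\in\mathcal X$, applies $\mathcal S$ to all its registers, and measures each committed qubit and the first $w$ qubits of each preimage register in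 the Hadamard basis, reporting $b'_i,d_i$. The verifier then stores bits $m_i$: if $h_i=0$, $m_i$ is the bit returned by INV$_{\mathcal G}(t_{k_i},y_i)$; if $h_i=1$, it computes $x_{b}=$ INV$_{\mathcal F}(t_{k_i},b,y_i)$, $b=0,1$, and puts $m_i=b'_i\oplus d_i\cdot(J(x_0)\oplus J(x_1))$ if $d_i\in G_{k_i,0,x_0}\cap G_{k_i,1,x_1}$; if an inverse does not exist or $d_i$ is not in this set, $m_i$ is a uniformly random bit. $D_{\mathbb P,h}$ is the distribution of $m=(m_1,\dots,m_n)$. The prover is perfect if the verifier accepts it with probability $1$ in the test round. **Claim.** Let $\mathcal F$ be an extended trapdoor claw-free family with trapdoor injective family $\mathcal G$, let $h=h_\lambda\in\{0,1\}^{n}$ and $1\le j=j_\lambda\le n$ with $h_j=1$. Let $\mathbb P$ be a prover characterized by $(U_0,\mathcal S)$, both efficient, that is perfect for the basis choice $h$. Let $\{B_\tau\}_\tau$ be Kraus operators of $\mathcal S$ and write, with the Pauli operators $X^xZ^z$ acting on the $j$-th committed qubit, $$B_\tau=\sum_{x,z\in\{0,1\}}X^xZ^z\otimes B_{jxz\tau},\qquad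 B'_{j,x,\tau}=\sum_{z\in\{0,1\}}Z^z\otimes B_{jxz\tau}.$$ Let $\mathbb P_j$ be the prover characterized by $(U_0,\mathcal S_j)$, where $\mathcal S_j$ is the CPTP map with Kraus operators $\{B'_{j,x,\tau}\}_{x\in\{0,1\},\tau}$. Then $D_{\mathbb P,h}$ and $D_{\mathbb P_j,h}$ are computationally indistinguishable. -/

import Mathlib

open scoped Matrix

noncomputable section

namespace MeasurementProtocol

/-! ## Bit strings, growth rates -/

/-- Bit strings whose positions ("wires") are the elements of `W`; also the computational basis of
the Hilbert space of the qubits `W`. -/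
abbrev Bits (W : Type) : Type := W → Bool

/-- The all-zero string. -/
def zeros (W : Type) : Bits W := fun _ => false

/-- The one-bit string `b`. -/
def bit (b : Bool) : Bits Unit := fun _ => b

/-- Concatenation of strings. -/
def cat {V W : Type} (x : Bits V) (y : Bits W) : Bits (V ⊕ W) := Sum.elim x y

/-- A string or a failure symbol, encoded with one additional flag bit. -/
def encOpt {W : Type} : Option (Bits W) → Bits (Option W)
  | none => fun _ => false
  | some x => fun q => q.elim true x

/-- The inner product modulo 2 of `d` with `u ⊕ v`. -/
def dotXor {w : ℕ} (d u v : Bits (Fin w)) : Bool :=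
  decide (Odd (Finset.univ.filter (fun q => d q = true ∧ (u q ^^ v q) = true)).card)

/-- Zero-padding of a string. -/
def pad {a : ℕ} (p : ℕ) (x : Bits (Fin a)) : Bits (Fin p) :=
  fun q => if hq : (q : ℕ) < a then x ⟨q, hq⟩ else false

/-- Polynomially bounded functions of the security parameter. -/
def PolyBounded (f : ℕ → ℕ) : Prop :=
  ∃ p : Polynomial ℕ, ∀ κ, f κ ≤ p.eval κ

/-- Negligible functions of the security parameter. -/
def Negligible (μ : ℕ → ℝ) : Prop :=
  (∀ κ, 0 ≤ μ κ) ∧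
    Asymptotics.SuperpolynomialDecay Filter.atTop (fun κ : ℕ => (κ : ℝ)) μ

/-! ## Efficient classical algorithms: polynomial-size (reversible) Boolean circuits -/

/-- A reversible classical gate on at most three wires. -/
structure CGate (W : Type) where
  arity : ℕ
  arity_le : arity ≤ 3
  wires : Fin arity ↪ W
  perm : Equiv.Perm (Bits (Fin arity))

/-- The action of a classical gate on a string. -/
def CGate.apply {W : Type} (g : CGate W) (s : Bits W) : Bits W :=
  Function.extend g.wires (g.perm (s ∘ g.wires)) s

/-- A classical circuit with input wires `I`, further wires initialised to `0`, and output wires. -/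
structure CProc (I O : Type) where
  anc : ℕ
  circ : List (CGate (I ⊕ Fin anc))
  out : O → I ⊕ Fin anc

/-- Number of wires plus number of gates. -/
def CProc.size {I O : Type} [Fintype I] (A : CProc I O) : ℕ :=
  Fintype.card I + A.anc + A.circ.length

/-- The output of a classical circuit; the gates are applied from the head of the list on. -/
def CProc.eval {I O : Type} (A : CProc I O) (x : Bits I) : Bits O :=
  (A.circ.foldl (fun s g => g.apply s) (cat x (zeros (Fin A.anc)))) ∘ A.out

/-- The function `f`, whose argument `a` is presented as the string `enc a`, is computed by an
efficient deterministic algorithm. -/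
def EffComputes {A I O : ℕ → Type} [∀ κ, Fintype (I κ)]
    (enc : ∀ κ, A κ → Bits (I κ)) (f : ∀ κ, A κ → Bits (O κ)) : Prop :=
  ∃ p : ∀ κ, CProc (I κ) (O κ), PolyBounded (fun κ => (p κ).size) ∧
    ∀ κ a, (p κ).eval (enc κ a) = f κ a

/-! ## Efficient quantum algorithms: polynomial-size quantum circuits -/

/-- A quantum gate: a unitary on at most three wires. -/
structure Gate (W : Type) where
  arity : ℕ
  arity_le : arity ≤ 3
  wires : Fin arity ↪ W
  mat : Matrix (Bits (Fin arity)) (Bits (Fin arity)) ℂ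
  unitary : mat ∈ Matrix.unitaryGroup (Bits (Fin arity)) ℂ

open Classical in
/-- The gate as an operator on all wires (identity on the wires it does not touch). -/
def Gate.op {W : Type} (g : Gate W) : Matrix (Bits W) (Bits W) ℂ :=
  fun s s' => if ∀ q, q ∉ Set.range g.wires → s q = s' q
    then g.mat (s ∘ g.wires) (s' ∘ g.wires) else 0

/-- The operator of a quantum circuit; the head of the list is applied first. -/
def circuitOp {W : Type} [Fintype W] [DecidableEq W] :
    List (Gate W) → Matrix (Bits W) (Bits W) ℂ
  | [] => 1
  | g :: c => circuitOp c * g.op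

/-- A quantum procedure with classical input on the wires `I`, further wires initialised to `0`,
and standard basis measurement of the output wires at the end. -/
structure QProc (I O : Type) where
  anc : ℕ
  circ : List (Gate (I ⊕ Fin anc))
  out : O → I ⊕ Fin anc

/-- Number of wires plus number of gates. -/
def QProc.size {I O : Type} [Fintype I] (A : QProc I O) : ℕ :=
  Fintype.card I + A.anc + A.circ.length

open Classical in
/-- The probability that, on input `x`, the output of the procedure lies in `E`. -/
def QProc.prob {I O : Type} [Fintype I] [DecidableEq I] (A : QProc I O) (x : Bits I)
    (E : Set (Bits O)) : ℝ :=
  ∑ s : Bits (I ⊕ Fin A.anc),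
    if s ∘ A.out ∈ E then ‖circuitOp A.circ s (cat x (zeros (Fin A.anc)))‖ ^ 2 else 0

/-- A family of procedures is quantum polynomial-time. -/
def QPT {I O : ℕ → Type} [∀ κ, Fintype (I κ)] (A : ∀ κ, QProc (I κ) (O κ)) : Prop :=
  PolyBounded (fun κ => (A κ).size)

/-- Efficiently computable unitaries. -/
def EffUnitary {W : ℕ → Type} [∀ κ, Fintype (W κ)] [∀ κ, DecidableEq (W κ)]
    (U : ∀ κ, Matrix (Bits (W κ)) (Bits (W κ)) ℂ) : Prop :=
  ∃ c : ∀ κ, List (Gate (W κ)),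
    PolyBounded (fun κ => Fintype.card (W κ) + (c κ).length) ∧ ∀ κ, circuitOp (c κ) = U κ

/-- Computational indistinguishability of two families of distributions on `n`-bit strings. -/
def CompIndist {n : ℕ → ℕ} (D₀ D₁ : ∀ κ, Bits (Fin (n κ)) → ℝ) : Prop :=
  ∀ A : ∀ κ, QProc (Fin (n κ)) Unit, QPT A →
    ∃ μ, Negligible μ ∧ ∀ κ,
      |∑ m, D₀ κ m * (A κ).prob m {bit false} - ∑ m, D₁ κ m * (A κ).prob m {bit false}| ≤ μ κ

/-! ## CPTP maps, and their `X`-trivial versions -/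

/-- A CPTP map on the qubits `W`, given by finitely many Kraus operators. -/
structure Channel (W : Type) [Fintype W] [DecidableEq W] where
  ι : Type
  [fintype : Fintype ι]
  op : ι → Matrix (Bits W) (Bits W) ℂ
  trace_preserving : ∑ τ, (op τ)ᴴ * op τ = 1

attribute [instance] Channel.fintype

/-- The map `ρ ↦ ∑ τ, B τ ρ (B τ)†`. -/
def Channel.apply {W : Type} [Fintype W] [DecidableEq W] (S : Channel W)
    (ρ : Matrix (Bits W) (Bits W) ℂ) : Matrix (Bits W) (Bits W) ℂ :=
  ∑ τ, S.op τ * ρ * (S.op τ)ᴴ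

/-- Append `a` qubits in state `0`, run the circuit `c`, trace out the `a` qubits. -/
def circuitChannel {W : Type} [Fintype W] [DecidableEq W] {a : ℕ} (c : List (Gate (W ⊕ Fin a)))
    (ρ : Matrix (Bits W) (Bits W) ℂ) : Matrix (Bits W) (Bits W) ℂ :=
  fun s s' => ∑ z : Bits (Fin a), ∑ u : Bits W, ∑ u' : Bits W,
    circuitOp c (cat s z) (cat u (zeros (Fin a))) * ρ u u' *
      star (circuitOp c (cat s' z) (cat u' (zeros (Fin a))))

/-- Efficiently computable CPTP maps. -/
def EffChannel {W : ℕ → Type} [∀ κ, Fintype (W κ)] [∀ κ, DecidableEq (W κ)]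
    (S : ∀ κ, Channel (W κ)) : Prop :=
  ∃ (a : ℕ → ℕ) (c : ∀ κ, List (Gate (W κ ⊕ Fin (a κ)))),
    PolyBounded (fun κ => Fintype.card (W κ) + a κ + (c κ).length) ∧
      ∀ κ ρ, (S κ).apply ρ = circuitChannel (c κ) ρ

/-- The Pauli operator `X`. -/
def pauliX : Matrix Bool Bool ℂ := fun a b => if a = b then 0 else 1

/-- The Pauli operator `Z`. -/
def pauliZ : Matrix Bool Bool ℂ := fun a b => if a = b then (if a then -1 else 1) else 0

/-- `P ⊗ M`, with `P` acting on qubit `j` and `M` on all other qubits. -/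
def tensorAt {W : Type} (j : W) (P : Matrix Bool Bool ℂ)
    (M : Matrix (Bits {q : W // q ≠ j}) (Bits {q : W // q ≠ j}) ℂ) :
    Matrix (Bits W) (Bits W) ℂ :=
  fun s s' => P (s j) (s' j) * M (fun q => s q) (fun q => s' q)


section Pauli

variable {W : Type} [Fintype W] [DecidableEq W] (j : W)

set_option linter.unusedSectionVars false

theorem tensorAt_mul (P Q : Matrix Bool Bool ℂ)
    (M N : Matrix (Bits {q : W // q ≠ j}) (Bits {q : W // q ≠ j}) ℂ) :
    tensorAt j P M * tensorAt j Q N = tensorAt j (P * Q) (M * N) := by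
  ext s s'
  simp only [Matrix.mul_apply, tensorAt]
  rw [← (Equiv.funSplitAt j Bool).symm.sum_comp, Fintype.sum_prod_type, Finset.sum_mul_sum]
  refine Finset.sum_congr rfl fun b _ => Finset.sum_congr rfl fun u _ => ?_
  have h1 : (Equiv.funSplitAt j Bool).symm (b, u) j = b := by
    simp [Equiv.funSplitAt, Equiv.piSplitAt]
  have h2 : (fun q : {q : W // q ≠ j} => (Equiv.funSplitAt j Bool).symm (b, u) q) = u := by
    funext q
    simp [Equiv.funSplitAt, Equiv.piSplitAt, q.2]
  rw [h1, h2]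
  ring

theorem tensorAt_conjTranspose (P : Matrix Bool Bool ℂ)
    (M : Matrix (Bits {q : W // q ≠ j}) (Bits {q : W // q ≠ j}) ℂ) :
    (tensorAt j P M)ᴴ = tensorAt j Pᴴ Mᴴ := by
  ext s s'
  simp [tensorAt, Matrix.conjTranspose_apply]

theorem tensorAt_one :
    tensorAt j (1 : Matrix Bool Bool ℂ) (1 : Matrix (Bits {q : W // q ≠ j}) _ ℂ) = 1 := by
  ext s s'
  simp only [tensorAt, Matrix.one_apply]
  by_cases h : s = s'
  · subst h; simp
  · rw [if_neg h]
    by_cases h1 : s j = s' j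
    · rw [if_pos h1, if_neg, mul_zero]
      intro h2
      apply h
      funext q
      by_cases hq : q = j
      · rw [hq, h1]
      · exact congrFun h2 ⟨q, hq⟩
    · rw [if_neg h1, zero_mul]

theorem tensorAt_neg (P : Matrix Bool Bool ℂ)
    (M : Matrix (Bits {q : W // q ≠ j}) (Bits {q : W // q ≠ j}) ℂ) :
    tensorAt j (-P) M = -tensorAt j P M := by
  ext s s'
  simp [tensorAt]

theorem pauliZ_conj : pauliZᴴ = pauliZ := by
  ext a b; cases a <;> cases b <;> simp [pauliZ]

theorem pauliZ_sq : pauliZ * pauliZ = 1 := by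
  ext a b; cases a <;> cases b <;> simp [pauliZ, Matrix.mul_apply]

theorem pauliX_conj : pauliXᴴ = pauliX := by
  ext a b; cases a <;> cases b <;> simp [pauliX]

theorem pauliX_sq : pauliX * pauliX = 1 := by
  ext a b; cases a <;> cases b <;> simp [pauliX, Matrix.mul_apply]

theorem pauliZ_mul_pauliX : pauliZ * pauliX = -(pauliX * pauliZ) := by
  ext a b; cases a <;> cases b <;> simp [pauliX, pauliZ, Matrix.mul_apply]

theorem xTrivial_identity {B : Matrix (Bits W) (Bits W) ℂ}
    {C : Fin 2 → Fin 2 → Matrix (Bits {q : W // q ≠ j}) (Bits {q : W // q ≠ j}) ℂ}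
    (hC : B = ∑ x : Fin 2, ∑ z : Fin 2, tensorAt j (pauliX ^ (x : ℕ) * pauliZ ^ (z : ℕ)) (C x z)) :
    (2 : ℂ) • ∑ x : Fin 2, (∑ z : Fin 2, tensorAt j (pauliZ ^ (z : ℕ)) (C x z))ᴴ *
        (∑ z : Fin 2, tensorAt j (pauliZ ^ (z : ℕ)) (C x z)) =
      Bᴴ * B + tensorAt j pauliZ 1 * (Bᴴ * B) * tensorAt j pauliZ 1 := by
  have hZZ : tensorAt j pauliZ 1 * tensorAt j pauliZ 1 = (1 : Matrix (Bits W) (Bits W) ℂ) := by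
    rw [tensorAt_mul, pauliZ_sq, one_mul, tensorAt_one]
  have hXX : tensorAt j pauliX 1 * tensorAt j pauliX 1 = (1 : Matrix (Bits W) (Bits W) ℂ) := by
    rw [tensorAt_mul, pauliX_sq, one_mul, tensorAt_one]
  have hXh : (tensorAt j pauliX 1)ᴴ = (tensorAt j pauliX 1 : Matrix (Bits W) (Bits W) ℂ) := by
    rw [tensorAt_conjTranspose, pauliX_conj, Matrix.conjTranspose_one]
  have hZh : (tensorAt j pauliZ 1)ᴴ = (tensorAt j pauliZ 1 : Matrix (Bits W) (Bits W) ℂ) := by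
    rw [tensorAt_conjTranspose, pauliZ_conj, Matrix.conjTranspose_one]
  have hZX : tensorAt j pauliZ 1 * tensorAt j pauliX 1 =
      -(tensorAt j pauliX 1 * tensorAt j pauliZ 1 : Matrix (Bits W) (Bits W) ℂ) := by
    rw [tensorAt_mul, tensorAt_mul, pauliZ_mul_pauliX, tensorAt_neg]
  set Z : Matrix (Bits W) (Bits W) ℂ := tensorAt j pauliZ 1 with hZ
  set X : Matrix (Bits W) (Bits W) ℂ := tensorAt j pauliX 1 with hX
  set b : Fin 2 → Matrix (Bits W) (Bits W) ℂ :=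
    fun x => ∑ z : Fin 2, tensorAt j (pauliZ ^ (z : ℕ)) (C x z) with hb
  have hcomm : ∀ x, Z * b x = b x * Z := by
    intro x
    simp only [hb, hZ, Fin.sum_univ_two, mul_add, add_mul, tensorAt_mul, one_mul, mul_one]
    simp
  have hB : B = b 0 + X * b 1 := by
    rw [hC]
    simp only [hb, hX, Fin.sum_univ_two, mul_add, tensorAt_mul, one_mul]
    simp
  have hBZ : B * Z = Z * (b 0 - X * b 1) := by
    rw [hB, add_mul, mul_sub, hcomm 0, ← mul_assoc Z X, hZX, mul_assoc, ← hcomm 1]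
    simp [mul_assoc]
  have h1 : Z * (Bᴴ * B) * Z = (b 0 - X * b 1)ᴴ * (b 0 - X * b 1) := by
    have : Z * (Bᴴ * B) * Z = (B * Z)ᴴ * (B * Z) := by
      rw [Matrix.conjTranspose_mul, hZh]; simp only [mul_assoc]
    rw [this, hBZ, Matrix.conjTranspose_mul, hZh, mul_assoc, ← mul_assoc Z Z, hZZ, one_mul]
  have h2 : (X * b 1)ᴴ * (X * b 1) = (b 1)ᴴ * b 1 := by
    rw [Matrix.conjTranspose_mul, hXh, mul_assoc, ← mul_assoc X X, hXX, one_mul]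
  rw [h1, hB, Fin.sum_univ_two, ← h2]
  simp only [Matrix.conjTranspose_add, Matrix.conjTranspose_sub, two_smul]
  noncomm_ring

/-- The `X`-trivial version of a channel at qubit `j`: if the Kraus operators of `S` are
`B τ = ∑ x z, X ^ x Z ^ z ⊗ C τ x z` (Pauli decomposition with respect to qubit `j`), those of the
new channel are `∑ z, Z ^ z ⊗ C τ x z`, indexed by the pairs `(x, τ)`. -/
def Channel.xTrivial (S : Channel W)
    (C : S.ι → Fin 2 → Fin 2 → Matrix (Bits {q : W // q ≠ j}) (Bits {q : W // q ≠ j}) ℂ)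
    (hC : ∀ τ, S.op τ =
      ∑ x : Fin 2, ∑ z : Fin 2, tensorAt j (pauliX ^ (x : ℕ) * pauliZ ^ (z : ℕ)) (C τ x z)) :
    Channel W where
  ι := Fin 2 × S.ι
  op := fun xτ => ∑ z : Fin 2, tensorAt j (pauliZ ^ (z : ℕ)) (C xτ.2 xτ.1 z)
  trace_preserving := by
    rw [Fintype.sum_prod_type_right]
    have h := Finset.sum_congr rfl fun (τ : S.ι) (_ : τ ∈ Finset.univ) =>
      xTrivial_identity j (hC τ)
    rw [← Finset.smul_sum, Finset.sum_add_distrib, ← Finset.sum_mul, ← Finset.mul_sum,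
      S.trace_preserving, mul_one, tensorAt_mul, pauliZ_sq, one_mul, tensorAt_one, ← two_smul ℂ]
      at h
    exact smul_right_injective _ (two_ne_zero) h

end Pauli

/-! ## Extended trapdoor claw-free families -/

/-- A density on bit strings. -/
def IsDensity {W : Type} [Fintype W] [DecidableEq W] (φ : Bits W → ℝ) : Prop :=
  (∀ y, 0 ≤ φ y) ∧ ∑ y, φ y = 1

/-- The squared Hellinger distance. -/
def hellingerSq {W : Type} [Fintype W] [DecidableEq W] (φ ψ : Bits W → ℝ) : ℝ :=
  1 - ∑ y, √(φ y * ψ y)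

/-- The data shared by a claw-free family and a trapdoor injective family: the lengths of keys,
trapdoors, and elements of the sets `X` and `Y`, the set `X`, and the algorithms `CHK` and `SAMP`,
which do not use the trapdoor. Elements of all sets are given as bit strings; `Y` is the
set of all strings of length `lenY` (densities may vanish at some of them). -/
structure Interface where
  lenK : ℕ → ℕ
  lenT : ℕ → ℕ
  lenX : ℕ → ℕ
  lenY : ℕ → ℕ
  lenK_poly : PolyBounded lenK
  lenT_poly : PolyBounded lenT
  lenX_poly : PolyBounded lenX
  lenY_poly : PolyBounded lenY
  X : ∀ κ, Finset (Bits (Fin (lenX κ)))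
  /-- The function computed by `CHK`. -/
  chk : ∀ κ, Bits (Fin (lenK κ)) → Bool → Bits (Fin (lenX κ)) → Bits (Fin (lenY κ)) → Bool
  chk_eff : EffComputes
    (A := fun κ => Bits (Fin (lenK κ)) × Bool × Bits (Fin (lenX κ)) × Bits (Fin (lenY κ)))
    (fun _ a => cat a.1 (cat (bit a.2.1) (cat a.2.2.1 a.2.2.2)))
    (fun κ a => bit (chk κ a.1 a.2.1 a.2.2.1 a.2.2.2))
  /-- The number of auxiliary qubits of the circuit `SAMP`. -/
  sampAnc : ℕ → ℕ
  /-- The circuit `SAMP`, on registers for a key, a bit, an element of `X`, an element of `Y`. -/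
  sampCirc : ∀ κ, List (Gate
    (Fin (lenK κ) ⊕ Unit ⊕ Fin (lenX κ) ⊕ Fin (lenY κ) ⊕ Fin (sampAnc κ)))
  samp_poly : PolyBounded (fun κ => sampAnc κ + (sampCirc κ).length)

/-- On input `k` and `b`, the circuit `SAMP` prepares, on its third and fourth register, the pure
state `|X|^(-1/2) ∑ x y, √(φ x y) |x⟩|y⟩`. -/
def Interface.SampPrepares (P : Interface) (κ : ℕ) (k : Bits (Fin (P.lenK κ))) (b : Bool)
    (φ : Bits (Fin (P.lenX κ)) → Bits (Fin (P.lenY κ)) → ℝ) : Prop :=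
  ∃ g : Bits (Fin (P.lenK κ)) → Bool → Bits (Fin (P.sampAnc κ)) → ℂ, ∀ k' b' x y a,
    circuitOp (P.sampCirc κ) (cat k' (cat (bit b') (cat x (cat y a))))
        (cat k (cat (bit b) (zeros _))) =
      (if x ∈ P.X κ then ((√(φ x y) / √((P.X κ).card : ℝ) : ℝ) : ℂ) else 0) * g k' b' a

/-- A family of pairs of functions from `X` to densities on `Y`, indexed by a set `K` of keys,
with an efficient probabilistic algorithm `GEN` generating a key and a trapdoor. (The value
`f κ k b x` is relevant for `k ∈ K κ` and `x ∈ X κ` only.) -/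
structure KeyedFamily (P : Interface) where
  K : ∀ κ, Finset (Bits (Fin (P.lenK κ)))
  f : ∀ κ, Bits (Fin (P.lenK κ)) → Bool → Bits (Fin (P.lenX κ)) → Bits (Fin (P.lenY κ)) → ℝ
  density : ∀ κ, ∀ k ∈ K κ, ∀ b, ∀ x ∈ P.X κ, IsDensity (f κ k b x)
  /-- The number of random bits used by `GEN`. -/
  coins : ℕ → ℕ
  /-- The output of `GEN` (key and trapdoor) as a function of the random bits. -/
  gen : ∀ κ, Bits (Fin (coins κ)) → Bits (Fin (P.lenK κ)) × Bits (Fin (P.lenT κ))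
  gen_eff : EffComputes (A := fun κ => Bits (Fin (coins κ))) (fun _ r => r)
    (fun κ r => cat (gen κ r).1 (gen κ r).2)
  gen_mem : ∀ κ r, (gen κ r).1 ∈ K κ

/-- The probability that `GEN` outputs the key `k` and the trapdoor `t`. -/
def KeyedFamily.genProb {P : Interface} (F : KeyedFamily P) (κ : ℕ) (k : Bits (Fin (P.lenK κ)))
    (t : Bits (Fin (P.lenT κ))) : ℝ :=
  ((Finset.univ.filter (fun r => F.gen κ r = (k, t))).card : ℝ) / 2 ^ F.coins κ

/-- The average of a quantity that depends on the key, for a key generated by `GEN`. -/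
def KeyedFamily.keyAvg {P : Interface} (F : KeyedFamily P) (κ : ℕ)
    (φ : Bits (Fin (P.lenK κ)) → ℝ) : ℝ :=
  (∑ r, φ (F.gen κ r).1) / 2 ^ F.coins κ

/-- The set of pairs `(x₀, x₁) ∈ X × X` with `f k 0 x₀ = f k 1 x₁`. -/
def KeyedFamily.R {P : Interface} (F : KeyedFamily P) (κ : ℕ) (k : Bits (Fin (P.lenK κ))) :
    Set (Bits (Fin (P.lenX κ)) × Bits (Fin (P.lenX κ))) :=
  {x | x.1 ∈ P.X κ ∧ x.2 ∈ P.X κ ∧ F.f κ k false x.1 = F.f κ k true x.2}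

/-- Noisy trapdoor claw-free families. -/
structure NTCF (P : Interface) extends KeyedFamily P where
  /-- The function computed by `INV`; `none` means that no inverse is returned. -/
  inv : ∀ κ, Bits (Fin (P.lenT κ)) → Bool → Bits (Fin (P.lenY κ)) →
    Option (Bits (Fin (P.lenX κ)))
  inv_eff : EffComputes
    (A := fun κ => Bits (Fin (P.lenT κ)) × Bool × Bits (Fin (P.lenY κ)))
    (fun _ a => cat a.1 (cat (bit a.2.1) a.2.2)) (fun κ a => encOpt (inv κ a.1 a.2.1 a.2.2))
  -- trapdoor
  supp_disjoint : ∀ κ, ∀ k ∈ K κ, ∀ b, ∀ x ∈ P.X κ, ∀ x' ∈ P.X κ, x ≠ x' →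
    ∀ y, ¬ (0 < f κ k b x y ∧ 0 < f κ k b x' y)
  inv_f : ∀ κ r b, ∀ x ∈ P.X κ, ∀ y, 0 < f κ (gen κ r).1 b x y →
    inv κ (gen κ r).2 b y = some x
  -- injective pair: `R` is a perfect matching
  matching_left : ∀ κ, ∀ k ∈ K κ, ∀ x₀ ∈ P.X κ, ∃! x₁, (x₀, x₁) ∈ toKeyedFamily.R κ k
  matching_right : ∀ κ, ∀ k ∈ K κ, ∀ x₁ ∈ P.X κ, ∃! x₀, (x₀, x₁) ∈ toKeyedFamily.R κ k
  -- efficient range superposition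
  f' : ∀ κ, Bits (Fin (P.lenK κ)) → Bool → Bits (Fin (P.lenX κ)) → Bits (Fin (P.lenY κ)) → ℝ
  density' : ∀ κ, ∀ k ∈ K κ, ∀ b, ∀ x ∈ P.X κ, IsDensity (f' κ k b x)
  inv_f' : ∀ κ r x₀ x₁, (x₀, x₁) ∈ toKeyedFamily.R κ (gen κ r).1 → ∀ b y,
    0 < f' κ (gen κ r).1 b (if b then x₁ else x₀) y →
      inv κ (gen κ r).2 false y = some x₀ ∧ inv κ (gen κ r).2 true y = some x₁
  chk_f' : ∀ κ, ∀ k ∈ K κ, ∀ b, ∀ x ∈ P.X κ, ∀ y,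
    P.chk κ k b x y = true ↔ 0 < f' κ k b x y
  hellinger : ∃ μ, Negligible μ ∧ ∀ κ, ∀ k ∈ K κ, ∀ b,
    (∑ x ∈ P.X κ, hellingerSq (f κ k b x) (f' κ k b x)) / (P.X κ).card ≤ μ κ
  samp_f' : ∀ κ, ∀ k ∈ K κ, ∀ b, P.SampPrepares κ k b (f' κ k b)
  -- adaptive hardcore bit
  w : ℕ → ℕ
  w_poly : PolyBounded w
  G : ∀ κ, Bits (Fin (P.lenK κ)) → Bool → Bits (Fin (P.lenX κ)) → Set (Bits (Fin (w κ)))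
  G_large : ∃ μ, Negligible μ ∧ ∀ κ, ∀ k ∈ K κ, ∀ b, ∀ x ∈ P.X κ,
    ((G κ k b x)ᶜ.ncard : ℝ) / 2 ^ w κ ≤ μ κ
  /-- The function computed by the membership test for the sets `G`. -/
  checkG : ∀ κ, Bits (Fin (P.lenK κ)) → Bool → Bits (Fin (P.lenX κ)) → Bits (Fin (P.lenT κ)) →
    Bits (Fin (w κ)) → Bool
  checkG_eff : EffComputes
    (A := fun κ => Bits (Fin (P.lenK κ)) × Bool × Bits (Fin (P.lenX κ)) ×
      Bits (Fin (P.lenT κ)) × Bits (Fin (w κ)))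
    (fun _ a => cat a.1 (cat (bit a.2.1) (cat a.2.2.1 (cat a.2.2.2.1 a.2.2.2.2))))
    (fun κ a => bit (checkG κ a.1 a.2.1 a.2.2.1 a.2.2.2.1 a.2.2.2.2))
  checkG_spec : ∀ κ r b, ∀ x ∈ P.X κ, ∀ d,
    checkG κ (gen κ r).1 b x (gen κ r).2 d = true ↔ d ∈ G κ (gen κ r).1 b x
  J : ∀ κ, Bits (Fin (P.lenX κ)) → Bits (Fin (w κ))
  J_inj : ∀ κ, Set.InjOn (J κ) (P.X κ)
  J_eff : EffComputes (A := fun κ => Bits (Fin (P.lenX κ))) (fun _ x => x) (fun κ x => J κ x)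
  J_inv_eff : EffComputes (A := fun κ => {x // x ∈ P.X κ}) (fun κ x => J κ x.1)
    (fun _ x => x.1)
  /-- The probability that `A k` lies in `H k` differs negligibly from the probability that it lies
  in the set obtained from `H k` by flipping the last bit. -/
  adaptive_hardcore : ∀ A : ∀ κ, QProc (Fin (P.lenK κ)) (Unit ⊕ Fin (P.lenX κ) ⊕ Fin (w κ) ⊕ Unit),
    QPT A → ∃ μ, Negligible μ ∧ ∀ κ,
      |toKeyedFamily.keyAvg κ (fun k => (A κ).prob k
          {o | ∃ b x₀ x₁ d, (x₀, x₁) ∈ toKeyedFamily.R κ k ∧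
            d ∈ G κ k false x₀ ∧ d ∈ G κ k true x₁ ∧
            o = cat (bit b) (cat (if b then x₁ else x₀)
              (cat d (bit (dotXor d (J κ x₀) (J κ x₁)))))}) -
        toKeyedFamily.keyAvg κ (fun k => (A κ).prob k
          {o | ∃ b x₀ x₁ d, (x₀, x₁) ∈ toKeyedFamily.R κ k ∧
            d ∈ G κ k false x₀ ∧ d ∈ G κ k true x₁ ∧
            o = cat (bit b) (cat (if b then x₁ else x₀)
              (cat d (bit (!dotXor d (J κ x₀) (J κ x₁)))))})| ≤ μ κ

/-- Trapdoor injective families (with the algorithms `CHK` and `SAMP` of the interface). -/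
structure TrapdoorInjective (P : Interface) extends KeyedFamily P where
  supp_disjoint : ∀ κ, ∀ k ∈ K κ, ∀ b, ∀ b', ∀ x ∈ P.X κ, ∀ x' ∈ P.X κ, (b, x) ≠ (b', x') →
    ∀ y, ¬ (0 < f κ k b x y ∧ 0 < f κ k b' x' y)
  /-- The function computed by `INV`; `none` means that no inverse is returned. -/
  inv : ∀ κ, Bits (Fin (P.lenT κ)) → Bits (Fin (P.lenY κ)) →
    Option (Bool × Bits (Fin (P.lenX κ)))
  inv_eff : EffComputes
    (A := fun κ => Bits (Fin (P.lenT κ)) × Bits (Fin (P.lenY κ)))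
    (fun _ a => cat a.1 a.2)
    (fun κ a => encOpt ((inv κ a.1 a.2).map (fun z => cat (bit z.1) z.2)))
  inv_f : ∀ κ r b, ∀ x ∈ P.X κ, ∀ y, 0 < f κ (gen κ r).1 b x y →
    inv κ (gen κ r).2 y = some (b, x)
  chk_f : ∀ κ, ∀ k ∈ K κ, ∀ b, ∀ x ∈ P.X κ, ∀ y,
    P.chk κ k b x y = true ↔ 0 < f κ k b x y
  samp_f : ∀ κ, ∀ k ∈ K κ, ∀ b, P.SampPrepares κ k b (f κ k b)

/-- Extended trapdoor claw-free families, together with the trapdoor injective family with respect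
to which they are injective invariant. -/
structure ExtendedTCF (P : Interface) extends NTCF P where
  inj : TrapdoorInjective P
  injective_invariant : ∀ A : ∀ κ, QProc (Fin (P.lenK κ)) Unit, QPT A →
    ∃ μ, Negligible μ ∧ ∀ κ,
      |toKeyedFamily.keyAvg κ (fun k => (A κ).prob k {bit false}) -
        inj.toKeyedFamily.keyAvg κ (fun k => (A κ).prob k {bit false})| ≤ μ κ
  /-- For every procedure `A`, given a key and a string `d`, there are strings `d` for which `A`
  lies in `{d · (J x₀ ⊕ J x₁) | (x₀, x₁) ∈ R k}` with probability negligibly close to `1/2`. -/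
  hardcore : ∀ A : ∀ κ, QProc (Fin (P.lenK κ) ⊕ Fin (w κ)) Unit, QPT A →
    ∃ (μ : ℕ → ℝ) (d : ∀ κ, Bits (Fin (w κ))), Negligible μ ∧ ∀ κ,
      |toKeyedFamily.keyAvg κ (fun k => (A κ).prob (cat k (d κ))
          {o | ∃ x₀ x₁, (x₀, x₁) ∈ toKeyedFamily.R κ k ∧
            o = bit (dotXor (d κ) (J κ x₀) (J κ x₁))}) - 1 / 2| ≤ μ κ

/-! ## The measurement protocol -/

/-- The qubits of the prover: `n` committed qubits, `n` preimage registers of `p` qubits,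
`n` commitment string registers of `l` qubits, `e` auxiliary qubits, `n` key registers of `m`
qubits. -/
inductive Wire (n p l e m : ℕ) : Type
  | committed (i : Fin n)
  | preimage (i : Fin n) (q : Fin p)
  | commitment (i : Fin n) (q : Fin l)
  | aux (q : Fin e)
  | key (i : Fin n) (q : Fin m)
  deriving DecidableEq, Fintype

/-- The content of preimage register `i`. -/
def Wire.pre {n p l e m : ℕ} (s : Bits (Wire n p l e m)) (i : Fin n) : Bits (Fin p) :=
  fun q => s (.preimage i q)

/-- The content of commitment string register `i`. -/
def Wire.com {n p l e m : ℕ} (s : Bits (Wire n p l e m)) (i : Fin n) : Bits (Fin l) :=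
  fun q => s (.commitment i q)

/-- The basis state with keys `k` and zeros elsewhere. -/
def Wire.init {n p l e m : ℕ} (k : Fin n → Bits (Fin m)) : Bits (Wire n p l e m)
  | .key i q => k i q
  | _ => false

/-- Forget all but the first `p'` qubits of each preimage register. -/
def Wire.shrink {n p p' l e m : ℕ} (hp : p' ≤ p) (s : Bits (Wire n p l e m)) :
    Bits (Wire n p' l e m)
  | .committed i => s (.committed i)
  | .preimage i q => s (.preimage i (Fin.castLE hp q))
  | .commitment i q => s (.commitment i q)
  | .aux q => s (.aux q)
  | .key i q => s (.key i q)

/-- Append qubits in state `0` to each preimage register, enlarging it from `p'` to `p` qubits. -/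
def appendZeros {n p p' l e m : ℕ} (hp : p' ≤ p) (ψ : Bits (Wire n p' l e m) → ℂ) :
    Bits (Wire n p l e m) → ℂ :=
  fun s => if ∀ i (q : Fin p), p' ≤ (q : ℕ) → s (.preimage i q) = false
    then ψ (Wire.shrink hp s) else 0

/-- Apply `U` to each of the `n` preimage registers. -/
def onPreimages {n p l e m : ℕ} (U : Matrix (Bits (Fin p)) (Bits (Fin p)) ℂ) :
    Matrix (Bits (Wire n p l e m)) (Bits (Wire n p l e m)) ℂ :=
  fun s s' => if (∀ i, s (.committed i) = s' (.committed i)) ∧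
      (∀ i q, s (.commitment i q) = s' (.commitment i q)) ∧
      (∀ q, s (.aux q) = s' (.aux q)) ∧ (∀ i q, s (.key i q) = s' (.key i q))
    then ∏ i, U (Wire.pre s i) (Wire.pre s' i) else 0

open Classical in
/-- The Hadamard transform on the wires in `Q`. -/
def hadamardOn {W : Type} [Fintype W] (Q : Set W) : Matrix (Bits W) (Bits W) ℂ :=
  fun s s' => if ∀ q, q ∉ Q → s q = s' q
    then ∏ q : W, (if q ∈ Q then (if s q && s' q then -1 else 1) / ((√2 : ℝ) : ℂ) else 1) else 0

/-- The wires measured in the Hadamard round: the committed qubits and the first `w` qubits of each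
preimage register. -/
def measuredWires {n p l e m : ℕ} (w : ℕ) : Set (Wire n p l e m) :=
  {q | (∃ i, q = .committed i) ∨ ∃ i, ∃ q' : Fin p, (q' : ℕ) < w ∧ q = .preimage i q'}

/-- The unitary `U_J`, which acts on `block` qubits and maps `|x⟩|0⟩` to `|J x⟩|0⟩` (the numbers of
auxiliary qubits, on both sides, being determined by `block`). -/
structure InjectionUnitary {P : Interface} (F : NTCF P) where
  block : ℕ → ℕ
  lenX_le : ∀ κ, P.lenX κ ≤ block κ
  w_le : ∀ κ, F.w κ ≤ block κ
  U : ∀ κ, Matrix (Bits (Fin (block κ))) (Bits (Fin (block κ))) ℂ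
  U_eff : EffUnitary U
  U_spec : ∀ κ, ∀ x ∈ P.X κ, ∀ s,
    U κ s (pad (block κ) x) = if s = pad (block κ) (F.J κ x) then 1 else 0

/-- A prover for `n` qubits that is characterized by a unitary `U₀` and a CPTP map `S`, with `e`
auxiliary qubits. The attack `S` is applied after `U_J`, when the preimage registers have `block`
qubits. The key registers are only used as control registers by `U₀`. -/
structure Prover (P : Interface) (n block : ℕ → ℕ) where
  e : ℕ → ℕ
  U₀ : ∀ κ, Matrix (Bits (Wire (n κ) (P.lenX κ) (P.lenY κ) (e κ) (P.lenK κ)))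
    (Bits (Wire (n κ) (P.lenX κ) (P.lenY κ) (e κ) (P.lenK κ))) ℂ
  unitary : ∀ κ, U₀ κ ∈ Matrix.unitaryGroup _ ℂ
  control : ∀ κ (k : Fin (n κ) → Bits (Fin (P.lenK κ))) s,
    (∃ i q, s (.key i q) ≠ k i q) → U₀ κ s (Wire.init k) = 0
  S : ∀ κ, Channel (Wire (n κ) (block κ) (P.lenY κ) (e κ) (P.lenK κ))

/-- The prover characterized by the same unitary and another CPTP map. -/
def Prover.withAttack {P : Interface} {n block : ℕ → ℕ} (V : Prover P n block)
    (S' : ∀ κ, Channel (Wire (n κ) (block κ) (P.lenY κ) (V.e κ) (P.lenK κ))) :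
    Prover P n block :=
  { V with S := S' }

/-- The distribution of the keys and trapdoors sampled by the verifier on basis choice `h`
(`true` stands for the Hadamard basis). -/
def keyDist {P : Interface} (F : ExtendedTCF P) (κ : ℕ) {n : ℕ} (h : Fin n → Bool)
    (k : Fin n → Bits (Fin (P.lenK κ))) (t : Fin n → Bits (Fin (P.lenT κ))) : ℝ :=
  ∏ i, if h i then F.toKeyedFamily.genProb κ (k i) (t i)
    else F.inj.toKeyedFamily.genProb κ (k i) (t i)

section Protocol

variable {P : Interface} {n : ℕ → ℕ}

/-- The probability that the verifier accepts in a test round: the prover applies `U₀` and measures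
commitment strings, committed qubits and preimage registers in the standard basis. -/
def testAcceptProb (F : ExtendedTCF P) {block : ℕ → ℕ} (V : Prover P n block) (κ : ℕ)
    (h : Fin (n κ) → Bool) : ℝ :=
  ∑ k, ∑ t, keyDist F κ h k t *
    ∑ s, if ∀ i, Wire.pre s i ∈ P.X κ ∧
        P.chk κ (k i) (s (.committed i)) (Wire.pre s i) (Wire.com s i) = true
      then ‖V.U₀ κ s (Wire.init k)‖ ^ 2 else 0

/-- The (unnormalized) state of the prover after reporting the commitment strings `y`. -/
def committedState {block : ℕ → ℕ} (V : Prover P n block) (κ : ℕ)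
    (k : Fin (n κ) → Bits (Fin (P.lenK κ))) (y : Fin (n κ) → Bits (Fin (P.lenY κ))) :
    Bits (Wire (n κ) (P.lenX κ) (P.lenY κ) (V.e κ) (P.lenK κ)) → ℂ :=
  fun s => if Wire.com s = y then V.U₀ κ s (Wire.init k) else 0

/-- The (unnormalized) state before the final standard basis measurement in a Hadamard round, for
keys `k`, commitment strings `y` and Kraus operator `τ` of the attack. -/
def finalState {F : NTCF P} (u : InjectionUnitary F) (V : Prover P n u.block) (κ : ℕ)
    (k : Fin (n κ) → Bits (Fin (P.lenK κ))) (y : Fin (n κ) → Bits (Fin (P.lenY κ)))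
    (τ : (V.S κ).ι) :
    Bits (Wire (n κ) (u.block κ) (P.lenY κ) (V.e κ) (P.lenK κ)) → ℂ :=
  hadamardOn (measuredWires (F.w κ)) *ᵥ ((V.S κ).op τ *ᵥ
    (onPreimages (u.U κ) *ᵥ appendZeros (u.lenX_le κ) (committedState V κ k y)))

/-- The probability that the verifier stores `m` as the measurement result for one qubit with
basis choice `h`, when the key is `k`, the trapdoor `t`, the commitment string `y`, and the prover
reports `b` and `d`. -/
def storeProb (F : ExtendedTCF P) (κ : ℕ) (h : Bool) (k : Bits (Fin (P.lenK κ)))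
    (t : Bits (Fin (P.lenT κ))) (y : Bits (Fin (P.lenY κ))) (b : Bool) (d : Bits (Fin (F.w κ)))
    (m : Bool) : ℝ :=
  match h with
  | false =>
    match F.inj.inv κ t y with
    | some z => if m = z.1 then 1 else 0
    | none => 1 / 2
  | true =>
    match F.inv κ t false y, F.inv κ t true y with
    | some x₀, some x₁ =>
      if F.checkG κ k false x₀ t d = true ∧ F.checkG κ k true x₁ t d = true then
        (if m = (b ^^ dotXor d (F.J κ x₀) (F.J κ x₁)) then 1 else 0)
      else 1 / 2
    | _, _ => 1 / 2

/-- The distribution of the verifier's measurement results in a Hadamard round with basis choice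
`h`. -/
def resultDist (F : ExtendedTCF P) (u : InjectionUnitary F.toNTCF) (V : Prover P n u.block)
    (κ : ℕ) (h : Fin (n κ) → Bool) (m : Bits (Fin (n κ))) : ℝ :=
  ∑ k, ∑ t, keyDist F κ h k t * ∑ y, ∑ τ, ∑ s, ‖finalState u V κ k y τ s‖ ^ 2 *
    ∏ i, storeProb F κ (h i) (k i) (t i) (y i) (s (.committed i))
      (fun q => s (.preimage i (Fin.castLE (u.w_le κ) q))) (m i)

end Protocol

end MeasurementProtocol

end

open MeasurementProtocol

noncomputable section

set_option linter.unusedSectionVars false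

namespace MeasurementProtocol

/-! ## Operators on some of the wires -/

section Lift

variable {V W W' : Type}

/-! Let `φ` be the prover's state just before the attack, for fixed keys and commitment strings, and
let `Z` act on committed qubit `j`. Write a Kraus operator as `B = b₀ + X b₁` with `b₀`, `b₁`
commuting with `Z`. Then `Z B Z = b₀ - X b₁`, so the even mixture of `B` and `Z B Z` has the same
effect as the pair `b₀`, `X b₁`. The remaining `X` is invisible to a Hadamard measurement, while the
`Z` after the attack flips the reported bit. Hence the outcomes of the `X`-trivial attack are an
even mixture of those of `S` on `φ` and those of `S` on `Z φ` with reported bit `j` flipped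
(`outWeight_xTrivial`). In particular only `S` itself ever has to be run.

Let `p`, `q` be the outcome weights of `S` on `φ` and on `Z φ`, let `a_c` be the probability that
the verifier stores `c` for qubit `j`, and let `A_c` be the distinguisher's acceptance probability
when this bit is `c`. A flipped report exchanges `a_0` and `a_1`, so the advantage is one half of
the sum of `(p a_c - q a_{!c}) A_c`. Since `a_0 + a_1 = 1`, the bracket equals `(p + q)/2 * (a_c -
a_{!c}) + (p - q)/2` (`resultDist_sub`). The two parts are bounded separately.

Diagonal part. The weight `(p + q)/2` is that of a state whose committed qubit `j` was measured in
the standard basis. For a perfect prover the commitment string and this bit determine the preimage,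
so the preimage register may be measured too (`outWeight_measured`). An efficient experiment thus
obtains `b`, `x_b` and then the report `b'`, `d`. It runs the distinguisher with an arbitrary bit
`c` stored for qubit `j` and turns the answer into a guess of `d · (J x₀ ⊕ J x₁)`. The advantage of
this guess is the diagonal term, and it is negligible by the adaptive hardcore bit property
(`diagTerm_negligible`).

Cross part. Here `c` is stored regardless of the report, so the trapdoor of qubit `j` is not needed
and the question is whether `φ` and `Z φ` can be told apart. If `d · (J x₀ ⊕ J x₁) = β` for all
claws, then `Z^d` on the preimage register after `U_J` acts as `Z^β` on the committed qubit, up to a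
global sign (`outWeight_phase`). A distinguisher of `φ` and `Z φ` would therefore guess `β`. If the
value is not constant for a key, every guess lies in the set of values and counts as a success. This
suffices for an upper bound, and using the guess and its negation bounds the absolute value
(`crossPart_negligible`).

Both reductions need the other keys, their trapdoors, the verifier's coins and the bit `c`. As
circuits are nonuniform, these are fixed to a worst choice of positive probability, and only the key
of qubit `j` stays random (`exists_fixed_choice`). Much of the rest shows that the experiments are
polynomial-size circuits. -/

open Classical in
/-- The operator `M` acting on the wires in the range of `e`. -/
def lift (e : V ↪ W) (M : Matrix (Bits V) (Bits V) ℂ) : Matrix (Bits W) (Bits W) ℂ :=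
  fun s s' => if ∀ q, q ∉ Set.range e → s q = s' q then M (s ∘ e) (s' ∘ e) else 0

theorem Gate.op_eq_lift (g : Gate W) : g.op = lift g.wires g.mat := rfl

theorem extend_comp_self (e : V ↪ W) (v : Bits V) (s : Bits W) :
    Function.extend e v s ∘ e = v :=
  funext fun a => e.injective.extend_apply v s a

theorem extend_extend (e : V ↪ W) (v v' : Bits V) (s : Bits W) :
    Function.extend e v (Function.extend e v' s) = Function.extend e v s := by
  funext w
  by_cases h : ∃ a, e a = w
  · obtain ⟨a, rfl⟩ := h
    simp [e.injective.extend_apply]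
  · simp [Function.extend_apply' _ _ _ h]

theorem extend_self_eq {e : V ↪ W} {s u : Bits W} (h : ∀ q, q ∉ Set.range e → s q = u q) :
    Function.extend e (u ∘ e) s = u := by
  funext w
  by_cases hw : ∃ a, e a = w
  · obtain ⟨a, rfl⟩ := hw
    simp [e.injective.extend_apply]
  · rw [Function.extend_apply' _ _ _ hw]
    exact h w hw

theorem lift_trans (e : V ↪ W) (e' : W ↪ W') (M : Matrix (Bits V) (Bits V) ℂ) :
    lift e' (lift e M) = lift (e.trans e') M := by
  ext s s'
  simp only [lift]
  by_cases h : ∀ q, q ∉ Set.range e' → s q = s' q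
  · rw [if_pos h]
    by_cases h1 : ∀ q, q ∉ Set.range e → (s ∘ e') q = (s' ∘ e') q
    · rw [if_pos h1, if_pos]
      · rfl
      · intro q hq
        by_cases hq' : q ∈ Set.range e'
        · obtain ⟨a, rfl⟩ := hq'
          refine h1 a fun ⟨b, hb⟩ => hq ⟨b, ?_⟩
          simp [hb]
        · exact h q hq'
    · rw [if_neg h1, if_neg]
      intro h2
      refine h1 fun q hq => h2 _ fun ⟨b, hb⟩ => hq ⟨b, ?_⟩
      exact e'.injective hb
  · rw [if_neg h, if_neg]
    intro h2
    refine h fun q hq => h2 _ fun ⟨b, hb⟩ => hq ⟨e b, ?_⟩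
    exact hb

variable [Fintype V] [DecidableEq V] [Fintype W] [DecidableEq W] [Fintype W'] [DecidableEq W']

/-- Row `s` of a lifted operator is supported on the strings that agree with `s` off the range of
`e`, and these are parametrised by their restrictions to `V`. Computations with lifted gates below
use this form. -/
theorem lift_mulVec (e : V ↪ W) (M : Matrix (Bits V) (Bits V) ℂ) (ψ : Bits W → ℂ) (s : Bits W) :
    (lift e M *ᵥ ψ) s = ∑ v, M (s ∘ e) v * ψ (Function.extend e v s) := by
  simp only [Matrix.mulVec, dotProduct]
  symm
  refine Finset.sum_of_injOn (fun v => Function.extend e v s) ?_ (by simp) ?_ ?_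
  · intro v _ v' _ h
    simpa [extend_comp_self] using congrArg (· ∘ e) h
  · intro u _ hu
    rw [lift, if_neg, zero_mul]
    intro h
    exact hu ⟨u ∘ e, by simp, extend_self_eq h⟩
  · intro v _
    rw [lift, if_pos, extend_comp_self]
    intro q hq
    rw [Function.extend_apply' _ _ _ hq]

theorem lift_mul (e : V ↪ W) (M N : Matrix (Bits V) (Bits V) ℂ) :
    lift e (M * N) = lift e M * lift e N := by
  refine Matrix.ext_of_mulVec_single fun i => ?_
  funext s
  rw [← Matrix.mulVec_mulVec]
  simp only [lift_mulVec, extend_comp_self, extend_extend, Matrix.mul_apply, Finset.sum_mul,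
    Finset.mul_sum]
  rw [Finset.sum_comm]
  simp only [mul_assoc]

theorem lift_one (e : V ↪ W) : lift e (1 : Matrix (Bits V) (Bits V) ℂ) = 1 := by
  refine Matrix.ext_of_mulVec_single fun i => ?_
  funext s
  simp only [lift_mulVec, Matrix.one_apply, ite_mul, one_mul, zero_mul, Matrix.one_mulVec]
  rw [Finset.sum_ite_eq, if_pos (Finset.mem_univ _), extend_self_eq fun _ _ => rfl]

theorem lift_conjTranspose (e : V ↪ W) (M : Matrix (Bits V) (Bits V) ℂ) :
    (lift e M)ᴴ = lift e Mᴴ := by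
  ext s s'
  simp only [Matrix.conjTranspose_apply, lift]
  by_cases h : ∀ q, q ∉ Set.range e → s q = s' q
  · rw [if_pos h, if_pos fun q hq => (h q hq).symm]
  · rw [if_neg h, if_neg fun h' => h fun q hq => (h' q hq).symm, star_zero]

theorem lift_unitary (e : V ↪ W) {M : Matrix (Bits V) (Bits V) ℂ}
    (hM : M ∈ Matrix.unitaryGroup (Bits V) ℂ) : lift e M ∈ Matrix.unitaryGroup (Bits W) ℂ := by
  rw [Matrix.mem_unitaryGroup_iff, Matrix.star_eq_conjTranspose] at *
  rw [lift_conjTranspose, ← lift_mul, hM, lift_one]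

end Lift

/-! ## Circuits -/

section Cat

variable {V R : Type}

theorem cat_comp_inl (v : Bits V) (r : Bits R) : cat v r ∘ Sum.inl = v := rfl
theorem cat_comp_inr (v : Bits V) (r : Bits R) : cat v r ∘ Sum.inr = r := rfl

theorem cat_comp (s : Bits (V ⊕ R)) : cat (s ∘ Sum.inl) (s ∘ Sum.inr) = s := by
  funext q; cases q <;> rfl

theorem cat_inj {v v' : Bits V} {r r' : Bits R} : cat v r = cat v' r' ↔ v = v' ∧ r = r' :=
  ⟨fun h => ⟨congrArg (· ∘ Sum.inl) h, congrArg (· ∘ Sum.inr) h⟩, fun ⟨h, h'⟩ => by rw [h, h']⟩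

end Cat

section Circuit

variable {V W R : Type} [Fintype V] [DecidableEq V] [Fintype W] [DecidableEq W]
  [Fintype R] [DecidableEq R]

theorem circuitOp_unitary (c : List (Gate W)) :
    circuitOp c ∈ Matrix.unitaryGroup (Bits W) ℂ := by
  induction c with
  | nil => exact one_mem _
  | cons g c ih => exact mul_mem ih (lift_unitary g.wires g.unitary)

theorem circuitOp_append (c c' : List (Gate W)) :
    circuitOp (c ++ c') = circuitOp c' * circuitOp c := by
  induction c with
  | nil => simp [circuitOp]
  | cons g c ih => simp [circuitOp, ih, mul_assoc]

/-- The gate `g`, with the wires renamed along `e`. -/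
def Gate.map (e : V ↪ W) (g : Gate V) : Gate W where
  arity := g.arity
  arity_le := g.arity_le
  wires := g.wires.trans e
  mat := g.mat
  unitary := g.unitary

theorem circuitOp_map (e : V ↪ W) (c : List (Gate V)) :
    circuitOp (c.map (Gate.map e)) = lift e (circuitOp c) := by
  induction c with
  | nil => simp [circuitOp, lift_one]
  | cons g c ih =>
    rw [List.map_cons, circuitOp, ih, circuitOp, lift_mul, Gate.op_eq_lift, Gate.op_eq_lift,
      lift_trans]
    rfl

theorem unitary_sum_normSq {U : Matrix (Bits W) (Bits W) ℂ}
    (hU : U ∈ Matrix.unitaryGroup (Bits W) ℂ) (x : Bits W) : ∑ s, ‖U s x‖ ^ 2 = 1 := by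
  rw [Matrix.mem_unitaryGroup_iff', Matrix.star_eq_conjTranspose] at hU
  have h := congrFun (congrFun hU x) x
  rw [Matrix.mul_apply, Matrix.one_apply_eq] at h
  have h2 : ((∑ s, ‖U s x‖ ^ 2 : ℝ) : ℂ) = 1 := by
    rw [← h]
    push_cast
    refine Finset.sum_congr rfl fun s _ => ?_
    exact (Complex.conj_mul' (U s x)).symm
  exact_mod_cast h2

/-- Strings on `V ⊕ R` are pairs of strings. -/
def catEquiv (V R : Type) : Bits V × Bits R ≃ Bits (V ⊕ R) where
  toFun p := cat p.1 p.2
  invFun s := (s ∘ Sum.inl, s ∘ Sum.inr)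
  left_inv _ := rfl
  right_inv s := cat_comp s

theorem sum_cat {A : Type*} [AddCommMonoid A] (φ : Bits (V ⊕ R) → A) :
    ∑ s, φ s = ∑ v, ∑ r, φ (cat v r) := by
  rw [← (catEquiv V R).sum_comp, Fintype.sum_prod_type]
  rfl

theorem lift_inl_mulVec (M : Matrix (Bits V) (Bits V) ℂ) (ψ : Bits (V ⊕ R) → ℂ)
    (v : Bits V) (r : Bits R) :
    (lift Function.Embedding.inl M *ᵥ ψ) (cat v r) = (M *ᵥ fun v' => ψ (cat v' r)) v := by
  rw [lift_mulVec, Matrix.mulVec, dotProduct]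
  refine Finset.sum_congr rfl fun v' _ => ?_
  congr 2
  funext q
  cases q with
  | inl a => exact (Function.Embedding.inl (β := R)).injective.extend_apply _ _ a
  | inr a => exact Function.extend_apply' _ _ _ (by simp)

theorem lift_inr_mulVec (M : Matrix (Bits R) (Bits R) ℂ) (ψ : Bits (V ⊕ R) → ℂ)
    (v : Bits V) (r : Bits R) :
    (lift Function.Embedding.inr M *ᵥ ψ) (cat v r) = (M *ᵥ fun r' => ψ (cat v r')) r := by
  rw [lift_mulVec, Matrix.mulVec, dotProduct]
  refine Finset.sum_congr rfl fun v' _ => ?_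
  congr 2
  funext q
  cases q with
  | inr a => exact (Function.Embedding.inr (α := V)).injective.extend_apply _ _ a
  | inl a => exact Function.extend_apply' _ _ _ (by simp)

end Circuit

/-! ## Classical gates, copying and phases -/

section Layers

variable {V W R J : Type} [Fintype V] [DecidableEq V] [Fintype W] [DecidableEq W]
  [Fintype R] [DecidableEq R]

/-- The permutation matrix of `σ`. -/
def permOp (σ : Equiv.Perm (Bits V)) : Matrix (Bits V) (Bits V) ℂ :=
  fun s s' => if s = σ s' then 1 else 0

theorem permOp_mulVec (σ : Equiv.Perm (Bits V)) (ψ : Bits V → ℂ) (s : Bits V) :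
    (permOp σ *ᵥ ψ) s = ψ (σ.symm s) := by
  simp [permOp, Matrix.mulVec, dotProduct, ← Equiv.symm_apply_eq]

theorem permOp_unitary (σ : Equiv.Perm (Bits V)) :
    permOp σ ∈ Matrix.unitaryGroup (Bits V) ℂ := by
  rw [Matrix.mem_unitaryGroup_iff', Matrix.star_eq_conjTranspose]
  ext s s'
  simp only [permOp, Matrix.mul_apply, Matrix.conjTranspose_apply, Matrix.one_apply, apply_ite star,
    star_one, star_zero, ite_mul, one_mul, zero_mul]
  rw [Finset.sum_ite_eq' , if_pos (Finset.mem_univ _)]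
  simp only [EmbeddingLike.apply_eq_iff_eq]

/-- A classical gate as a quantum gate. -/
def CGate.toGate (g : CGate W) : Gate W where
  arity := g.arity
  arity_le := g.arity_le
  wires := g.wires
  mat := permOp g.perm
  unitary := permOp_unitary g.perm

theorem lift_permOp_single (e : V ↪ W) (σ : Equiv.Perm (Bits V)) (s : Bits W) :
    lift e (permOp σ) *ᵥ Pi.single s 1 =
      Pi.single (Function.extend e (σ (s ∘ e)) s) (1 : ℂ) := by
  funext u
  rw [lift_mulVec]
  have h := permOp_mulVec σ (fun v => (Pi.single s 1 : Bits W → ℂ) (Function.extend e v u)) (u ∘ e)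
  rw [Matrix.mulVec, dotProduct] at h
  refine h.trans ?_
  simp only [Pi.single_apply]
  refine if_congr ⟨fun h => ?_, fun h => ?_⟩ rfl rfl
  · rw [← h, extend_comp_self, Equiv.apply_symm_apply, extend_extend]
    exact (extend_self_eq fun _ _ => rfl).symm
  · rw [h, extend_comp_self, Equiv.symm_apply_apply, extend_extend]
    exact extend_self_eq fun _ _ => rfl

theorem CGate.toGate_single (g : CGate W) (s : Bits W) :
    g.toGate.op *ᵥ Pi.single s 1 = Pi.single (g.apply s) (1 : ℂ) :=
  lift_permOp_single g.wires g.perm s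

theorem circuitOp_toGate_single (c : List (CGate W)) (s : Bits W) :
    circuitOp (c.map CGate.toGate) *ᵥ Pi.single s 1 =
      Pi.single (c.foldl (fun s g => g.apply s) s) (1 : ℂ) := by
  induction c generalizing s with
  | nil => rw [List.map_nil, circuitOp, Matrix.one_mulVec, List.foldl_nil]
  | cons g c ih =>
    rw [List.map_cons, circuitOp, ← Matrix.mulVec_mulVec, CGate.toGate_single, ih]
    rfl

/-- The pair of wires `(a, b)`. -/
def pairEmb (a b : W) (h : a ≠ b) : Fin 2 ↪ W where
  toFun := ![a, b]
  inj' := by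
    intro i j hij
    fin_cases i <;> fin_cases j <;> simp_all [eq_comm]

/-- The controlled negation of bit `1`, with control bit `0`. -/
def cnotPerm : Equiv.Perm (Bits (Fin 2)) :=
  Function.Involutive.toPerm (fun s => ![s 0, s 0 ^^ s 1]) (fun s => by
    funext i; fin_cases i <;> simp)

/-- The controlled negation of the wire `b` with control wire `a`. -/
def cnot (a b : W) (h : a ≠ b) : Gate W where
  arity := 2
  arity_le := by norm_num
  wires := pairEmb a b h
  mat := permOp cnotPerm
  unitary := permOp_unitary _

theorem cnot_mulVec (a : V) (b : R) (ψ : Bits (V ⊕ R) → ℂ) (v : Bits V) (r : Bits R) :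
    ((cnot (Sum.inl a) (Sum.inr b) Sum.inl_ne_inr).op *ᵥ ψ) (cat v r) =
      ψ (cat v (Function.update r b (v a ^^ r b))) := by
  rw [Gate.op_eq_lift, lift_mulVec]
  change ∑ u, permOp cnotPerm _ u * _ = _
  have h := permOp_mulVec cnotPerm (fun u => ψ (Function.extend (pairEmb (Sum.inl a) (Sum.inr b)
    Sum.inl_ne_inr) u (cat v r))) (cat v r ∘ pairEmb (Sum.inl a) (Sum.inr b) Sum.inl_ne_inr)
  rw [Matrix.mulVec, dotProduct] at h
  refine h.trans (congrArg ψ ?_)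
  set e := pairEmb (Sum.inl a : V ⊕ R) (Sum.inr b) Sum.inl_ne_inr with he
  funext q
  by_cases hq : ∃ i, e i = q
  · obtain ⟨i, rfl⟩ := hq
    rw [e.injective.extend_apply]
    fin_cases i
    · change v a = v a
      rfl
    · change (v a ^^ r b) = Function.update r b (v a ^^ r b) b
      rw [Function.update_self]
  · rw [Function.extend_apply' _ _ _ hq]
    cases q with
    | inl q => rfl
    | inr q =>
      have : q ≠ b := fun h => hq ⟨1, by rw [h]; rfl⟩
      change r q = Function.update r b _ q
      rw [Function.update_of_ne this]

/-- Copy the bits `src j`, where they exist, onto the wires `tgt j`. -/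
def copyLayer (src : J → Option V) (tgt : J ↪ R) : List J → List (Gate (V ⊕ R))
  | [] => []
  | j :: l => match src j with
    | none => copyLayer src tgt l
    | some a => cnot (Sum.inl a) (Sum.inr (tgt j)) Sum.inl_ne_inr :: copyLayer src tgt l

theorem copyLayer_length (src : J → Option V) (tgt : J ↪ R) (l : List J) :
    (copyLayer src tgt l).length ≤ l.length := by
  induction l with
  | nil => simp [copyLayer]
  | cons j l ih =>
    rw [copyLayer]
    cases src j <;> simp <;> omega

/-- The bit copied from wire `a`, if there is one. -/
def bitAt (v : Bits V) : Option V → Bool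
  | none => false
  | some a => v a

-- The controls lie in `V` and the targets in `R` are distinct, so no gate disturbs another one. At
-- most one entry of the duplicate-free list has target `q`, which is why an existential statement
-- describes the bit added there.
open Classical in
theorem copyLayer_mulVec_aux (src : J → Option V) (tgt : J ↪ R) (l : List J) (hl : l.Nodup)
    (ψ : Bits (V ⊕ R) → ℂ) (v : Bits V) (r : Bits R) :
    (circuitOp (copyLayer src tgt l) *ᵥ ψ) (cat v r) =
      ψ (cat v fun q => decide (∃ j ∈ l, tgt j = q ∧ bitAt v (src j) = true) ^^ r q) := by
  induction l generalizing ψ with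
  | nil => simp [copyLayer, circuitOp]
  | cons j l ih =>
    have hj := (List.nodup_cons.1 hl).1
    have hl' := (List.nodup_cons.1 hl).2
    have key : ∀ q, (∃ j' ∈ j :: l, tgt j' = q ∧ bitAt v (src j') = true) ↔
        (tgt j = q ∧ bitAt v (src j) = true) ∨ ∃ j' ∈ l, tgt j' = q ∧ bitAt v (src j') = true := by
      intro q; simp
    simp only [key]
    rw [copyLayer]
    cases hs : src j with
    | none =>
      simp only
      rw [ih hl']
      have : bitAt v none = false := rfl
      simp [this]
    | some a =>
      simp only
      rw [circuitOp, ← Matrix.mulVec_mulVec, ih hl', cnot_mulVec]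
      congr 2
      funext q
      by_cases hq : q = tgt j
      · subst hq
        have : ¬ ∃ j' ∈ l, tgt j' = tgt j ∧ bitAt v (src j') = true := by
          rintro ⟨j', h1, h2, _⟩
          exact hj (tgt.injective h2 ▸ h1)
        have h2 : bitAt v (some a) = v a := rfl
        rw [Function.update_self]
        simp only [this, h2, true_and, or_false, decide_false, Bool.false_xor, Bool.decide_eq_true]
      · have : tgt j ≠ q := fun h => hq h.symm
        simp [Function.update_of_ne hq, this, -List.mem_cons]

theorem copyLayer_mulVec [Fintype J] (src : J → Option V) (tgt : J ↪ R)
    (ψ : Bits (V ⊕ R) → ℂ) (v : Bits V) (r : Bits R) :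
    (circuitOp (copyLayer src tgt Finset.univ.toList) *ᵥ ψ) (cat v r) =
      ψ (cat v (Function.extend tgt (fun j => bitAt v (src j) ^^ r (tgt j)) r)) := by
  classical
  rw [copyLayer_mulVec_aux _ _ _ (Finset.nodup_toList _)]
  congr 2
  funext q
  by_cases hq : ∃ j, tgt j = q
  · obtain ⟨j, rfl⟩ := hq
    rw [tgt.injective.extend_apply]
    simp
  · rw [Function.extend_apply' _ _ _ hq]
    have : ¬ ∃ j ∈ Finset.univ.toList, tgt j = q ∧ bitAt v (src j) = true := by
      rintro ⟨j, _, h, _⟩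
      exact hq ⟨j, h⟩
    simp only [this, decide_false, Bool.false_xor]

/-- The sign `(-1) ^ b`. -/
def sgn (b : Bool) : ℂ := if b then -1 else 1

theorem sgn_xor (a b : Bool) : sgn (a ^^ b) = sgn a * sgn b := by
  cases a <;> cases b <;> simp [sgn]

theorem sgn_mul_self (a : Bool) : sgn a * sgn a = 1 := by cases a <;> simp [sgn]

theorem norm_sgn (a : Bool) : ‖sgn a‖ = 1 := by cases a <;> simp [sgn]

theorem star_sgn (a : Bool) : star (sgn a) = sgn a := by cases a <;> simp [sgn]

theorem phase_unitary (φ : Bits V → Bool) :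
    (Matrix.diagonal fun s => sgn (φ s)) ∈ Matrix.unitaryGroup (Bits V) ℂ := by
  rw [Matrix.mem_unitaryGroup_iff, Matrix.star_eq_conjTranspose, Matrix.diagonal_conjTranspose,
    Matrix.diagonal_mul_diagonal, ← Matrix.diagonal_one]
  congr 1
  funext s
  simp [star_sgn, sgn_mul_self]

/-- The controlled phase gate on the wires `a` and `b`. -/
def cphase (a b : W) (h : a ≠ b) : Gate W where
  arity := 2
  arity_le := by norm_num
  wires := pairEmb a b h
  mat := Matrix.diagonal fun s => sgn (s 0 && s 1)
  unitary := phase_unitary _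

theorem lift_diagonal_mulVec (e : V ↪ W) (φ : Bits V → ℂ) (ψ : Bits W → ℂ) (s : Bits W) :
    (lift e (Matrix.diagonal φ) *ᵥ ψ) s = φ (s ∘ e) * ψ s := by
  rw [lift_mulVec, Finset.sum_eq_single (s ∘ e)]
  · rw [Matrix.diagonal_apply_eq, extend_self_eq fun _ _ => rfl]
  · intro u _ hu
    rw [Matrix.diagonal_apply_ne _ hu.symm, zero_mul]
  · simp

theorem cphase_mulVec (a b : W) (h : a ≠ b) (ψ : Bits W → ℂ) (s : Bits W) :
    ((cphase a b h).op *ᵥ ψ) s = sgn (s a && s b) * ψ s :=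
  lift_diagonal_mulVec (pairEmb a b h) (fun s => sgn (s 0 && s 1)) ψ s

/-- Controlled phase gates on the pairs `(a j, b j)`. -/
def phaseLayer (a b : J → W) (h : ∀ j, a j ≠ b j) (l : List J) : List (Gate W) :=
  l.map fun j => cphase (a j) (b j) (h j)

theorem phaseLayer_mulVec [Fintype J] (a b : J → W) (h : ∀ j, a j ≠ b j)
    (ψ : Bits W → ℂ) (s : Bits W) :
    (circuitOp (phaseLayer a b h Finset.univ.toList) *ᵥ ψ) s =
      (∏ j, sgn (s (a j) && s (b j))) * ψ s := by
  rw [← Finset.prod_map_toList]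
  generalize (Finset.univ : Finset J).toList = l
  induction l generalizing ψ with
  | nil => simp [phaseLayer, circuitOp]
  | cons j l ih =>
    rw [phaseLayer, List.map_cons, circuitOp, ← Matrix.mulVec_mulVec]
    have := ih ((cphase (a j) (b j) (h j)).op *ᵥ ψ)
    rw [phaseLayer] at this
    rw [this, cphase_mulVec, List.map_cons, List.prod_cons]
    ring

open Classical in
/-- Circuits acting in parallel on disjoint sets of wires. -/
theorem parallel_apply (e : J × V ↪ W) (M : Matrix (Bits V) (Bits V) ℂ) (c : List (Gate V))
    (hc : circuitOp c = M) (l : List J) (hl : l.Nodup) (s s' : Bits W) :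
    circuitOp (l.flatMap fun j => c.map
        (Gate.map ⟨fun v => e (j, v), fun v v' h => by simpa using e.injective h⟩)) s s' =
      if ∀ q, (∀ j ∈ l, ∀ v, e (j, v) ≠ q) → s q = s' q
        then (l.map fun j => M (fun v => s (e (j, v))) (fun v => s' (e (j, v)))).prod else 0 := by
  induction l generalizing s s' with
  | nil =>
    simp only [List.flatMap_nil, circuitOp, Matrix.one_apply, List.map_nil, List.prod_nil]
    congr 1
    simp [funext_iff]
  | cons j l ih =>
    have hj := (List.nodup_cons.1 hl).1
    set ej : V ↪ W := ⟨fun v => e (j, v), fun v v' h => by simpa using e.injective h⟩ with hej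
    have hejv : ∀ v, ej v = e (j, v) := fun _ => rfl
    rw [List.flatMap_cons, circuitOp_append, circuitOp_map, hc, Matrix.mul_apply]
    have hcomp : ∀ t : Bits W, ∀ v : Bits V, ∀ j' ∈ l,
        (fun a => Function.extend ej v t (e (j', a))) = fun a => t (e (j', a)) := by
      intro t v j' hj'
      funext a
      rw [Function.extend_apply']
      rintro ⟨b, hb⟩
      have := e.injective hb
      simp only [Prod.mk.injEq] at this
      exact hj (this.1 ▸ hj')
    -- The only intermediate string that can contribute: block `j` acts first and must already
    -- produce the final values there, while all other wires still carry `s'`.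
    set t : Bits W := Function.extend ej (s ∘ ej) s' with ht
    have htej : t ∘ ej = s ∘ ej := extend_comp_self _ _ _
    rw [Finset.sum_eq_single t]
    · have h2 : lift ej M t s' = M (s ∘ ej) (s' ∘ ej) := by
        rw [lift, if_pos, htej]
        intro q hq
        exact Function.extend_apply' _ _ _ hq
      rw [h2, ih (List.nodup_cons.1 hl).2, ite_mul, zero_mul]
      have hiff : (∀ q, (∀ j' ∈ l, ∀ v, e (j', v) ≠ q) → s q = t q) ↔
          ∀ q, (∀ j' ∈ j :: l, ∀ v, e (j', v) ≠ q) → s q = s' q := by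
        constructor
        · intro h q hq
          rw [h q fun j' hj' => hq j' (List.mem_cons_of_mem _ hj')]
          exact Function.extend_apply' _ _ _ fun ⟨a, ha⟩ => hq j List.mem_cons_self a ha
        · intro h q hq
          by_cases hqj : ∃ a, ej a = q
          · obtain ⟨a, rfl⟩ := hqj
            exact (congrFun htej a).symm
          · rw [ht, Function.extend_apply' _ _ _ hqj]
            refine h q fun j' hj' v hv => ?_
            rcases List.mem_cons.1 hj' with rfl | h'
            · exact hqj ⟨v, hv⟩
            · exact hq j' h' v hv
      simp only [hiff]
      refine if_congr Iff.rfl ?_ rfl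
      rw [List.map_cons, List.prod_cons, mul_comm]
      refine congrArg₂ _ rfl (congrArg List.prod (List.map_congr_left fun j' hj' => ?_))
      rw [ht, hcomp _ _ j' hj']
    · intro u _ hu
      by_cases h1 : ∀ q, q ∉ Set.range ej → u q = s' q
      · rw [ih (List.nodup_cons.1 hl).2, if_neg, zero_mul]
        intro h2
        apply hu
        funext q
        by_cases hq : ∃ a, ej a = q
        · obtain ⟨a, rfl⟩ := hq
          rw [show t (ej a) = s (ej a) from congrFun htej a]
          refine (h2 _ fun j' hj' v hv => ?_).symm
          have := e.injective hv
          simp only [Prod.mk.injEq] at this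
          exact hj (this.1 ▸ hj')
        · rw [ht, Function.extend_apply' _ _ _ hq]
          exact h1 q hq
      · rw [lift, if_neg h1, mul_zero]
    · simp

end Layers

/-! ## Quantum experiments with hardwired constants -/

/-- A quantum procedure on wires `W`, some of which hold the classical input, and the others of
which are initialised to the constants `base`. -/
structure Exp (I O : Type) where
  W : Type
  [fintype : Fintype W]
  [decEq : DecidableEq W]
  inp : I ↪ W
  base : Bits W
  circ : List (Gate W)
  out : O → W

attribute [instance] Exp.fintype Exp.decEq

/-- Number of wires plus number of gates. -/
def Exp.size {I O : Type} (A : Exp I O) : ℕ := Fintype.card A.W + A.circ.length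

/-- The initial basis state. -/
def Exp.start {I O : Type} (A : Exp I O) (x : Bits I) : Bits A.W :=
  Function.extend A.inp x A.base

open Classical in
/-- The probability of the output `o` on input `x`. -/
def Exp.prob {I O : Type} (A : Exp I O) (x : Bits I) (o : Bits O) : ℝ :=
  ∑ s, if s ∘ A.out = o then ‖circuitOp A.circ s (A.start x)‖ ^ 2 else 0

/-- The transition probabilities `Φ` are those of a quantum experiment of size at most `c`. -/
def Sim {I O : Type} (c : ℕ) (Φ : Bits I → Bits O → ℝ) : Prop :=
  ∃ A : Exp I O, A.size ≤ c ∧ A.prob = Φ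

theorem sum_ite_eq_self {α β : Type*} [Fintype α] [AddCommMonoid β] (a : α) (φ : α → β)
    {_ : ∀ x, Decidable (a = x)} : ∑ x, (if a = x then φ x else 0) = φ a := by
  rw [Finset.sum_eq_single a]
  · rw [if_pos rfl]
  · intro b _ hb
    rw [if_neg hb.symm]
  · simp

section Sim

variable {I O J Q : Type}

theorem Sim.mono {c c' : ℕ} {Φ : Bits I → Bits O → ℝ} (h : Sim c Φ) (hc : c ≤ c') : Sim c' Φ := by
  obtain ⟨A, hA, h⟩ := h
  exact ⟨A, hA.trans hc, h⟩

theorem Sim.sum_eq_one [Fintype O] [DecidableEq O] {c : ℕ} {Φ : Bits I → Bits O → ℝ}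
    (h : Sim c Φ) (x : Bits I) : ∑ o, Φ x o = 1 := by
  obtain ⟨A, _, rfl⟩ := h
  simp only [Exp.prob]
  rw [Finset.sum_comm, ← unitary_sum_normSq (circuitOp_unitary A.circ) (A.start x)]
  exact Finset.sum_congr rfl fun s _ => sum_ite_eq_self (s ∘ A.out) fun _ => _

theorem Sim.nonneg {c : ℕ} {Φ : Bits I → Bits O → ℝ} (h : Sim c Φ) (x : Bits I) (o : Bits O) :
    0 ≤ Φ x o := by
  obtain ⟨A, _, rfl⟩ := h
  refine Finset.sum_nonneg fun s _ => ?_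
  split_ifs <;> positivity

open Classical in
/-- Forgetting and duplicating outputs. -/
theorem Sim.mapOut [Fintype O] [DecidableEq O] {c : ℕ} {Φ : Bits I → Bits O → ℝ}
    (h : Sim c Φ) (r : Q → O) : Sim c fun x q => ∑ o, if o ∘ r = q then Φ x o else 0 := by
  obtain ⟨A, hA, rfl⟩ := h
  refine ⟨{ A with out := A.out ∘ r }, hA, ?_⟩
  funext x q
  have : ∀ o, (if o ∘ r = q then A.prob x o else 0) =
      ∑ s, if s ∘ A.out = o then
        (if (s ∘ A.out) ∘ r = q then ‖circuitOp A.circ s (A.start x)‖ ^ 2 else 0) else 0 := by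
    intro o
    split_ifs with h
    · refine Finset.sum_congr rfl fun s _ => ?_
      by_cases h2 : s ∘ A.out = o
      · rw [if_pos h2, if_pos h2, if_pos (h2 ▸ h)]
      · rw [if_neg h2, if_neg h2]
    · refine (Finset.sum_eq_zero fun s _ => ?_).symm
      by_cases h2 : s ∘ A.out = o
      · rw [if_pos h2, if_neg (h2 ▸ h)]
      · rw [if_neg h2]
  simp only [this]
  rw [Finset.sum_comm]
  exact Finset.sum_congr rfl fun s _ => (sum_ite_eq_self (s ∘ A.out) fun _ => _).symm

/-- The source of a wire: an input, an output of a previous stage, or a constant. -/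
def routed (x : Bits I) (o : Bits O) : I ⊕ (O ⊕ Bool) → Bool
  | .inl i => x i
  | .inr (.inl a) => o a
  | .inr (.inr b) => b

/-- Sequential composition: the second procedure gets its input from the input and the output of the
first one. -/
theorem Sim.bind [Fintype J] {c c' : ℕ} {Φ : Bits I → Bits O → ℝ} {Ψ : Bits J → Bits Q → ℝ}
    (hΦ : Sim c Φ) (hΨ : Sim c' Ψ) (ρ : J → I ⊕ (O ⊕ Bool)) :
    Sim (c + 3 * c') fun x (oq : Bits (O ⊕ Q)) =>
      Φ x (oq ∘ Sum.inl) * Ψ (fun j => routed x (oq ∘ Sum.inl) (ρ j)) (oq ∘ Sum.inr) := by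
  classical
  obtain ⟨A, hA, rfl⟩ := hΦ
  obtain ⟨B, hB, rfl⟩ := hΨ
  -- Inputs are copied before `A` runs, as its circuit may overwrite them; outputs of `A` are copied
  -- afterwards; constants are part of the initial state of `B`.
  let early : J → Option A.W := fun j => match ρ j with
    | .inl i => some (A.inp i)
    | _ => none
  let late : J → Option A.W := fun j => match ρ j with
    | .inr (.inl o) => some (A.out o)
    | _ => none
  let const : Bits J := fun j => match ρ j with
    | .inr (.inr b) => b
    | _ => false
  let c1 := copyLayer early B.inp Finset.univ.toList
  let c2 : List (Gate (A.W ⊕ B.W)) := A.circ.map (Gate.map Function.Embedding.inl)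
  let c3 := copyLayer late B.inp Finset.univ.toList
  let c4 : List (Gate (A.W ⊕ B.W)) := B.circ.map (Gate.map Function.Embedding.inr)
  let D : Exp I (O ⊕ Q) :=
    { W := A.W ⊕ B.W
      inp := A.inp.trans Function.Embedding.inl
      base := cat A.base (B.start const)
      circ := c1 ++ (c2 ++ (c3 ++ c4))
      out := Sum.map A.out B.out }
  refine ⟨D, ?_, ?_⟩
  · have h1 := copyLayer_length early B.inp Finset.univ.toList
    have h2 := copyLayer_length late B.inp Finset.univ.toList
    rw [Finset.length_toList, Finset.card_univ] at h1 h2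
    have h3 := Fintype.card_le_of_embedding B.inp
    simp only [Exp.size] at hA hB
    simp only [Exp.size, D, c1, c2, c3, c4, Fintype.card_sum, List.length_append, List.length_map]
    omega
  · have hstart : ∀ x, D.start x = cat (A.start x) (B.start const) := by
      intro x
      funext q
      by_cases hq : ∃ i, D.inp i = q
      · obtain ⟨i, rfl⟩ := hq
        rw [Exp.start, D.inp.injective.extend_apply]
        exact (A.inp.injective.extend_apply _ _ i).symm
      · rw [Exp.start, Function.extend_apply' _ _ _ hq]
        cases q with
        | inl a =>
          change A.base a = A.start x a
          rw [Exp.start, Function.extend_apply']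
          rintro ⟨i, rfl⟩
          exact hq ⟨i, rfl⟩
        | inr b => rfl
    have hlay : ∀ (src : J → Option A.W) (v : Bits A.W) (z z' : Bits J),
        (Function.extend B.inp (fun j => bitAt v (src j) ^^ B.start z (B.inp j)) (B.start z) =
          B.start z') ↔ ∀ j, (bitAt v (src j) ^^ z j) = z' j := by
      intro src v z z'
      have hz : ∀ (z : Bits J) j, B.start z (B.inp j) = z j := fun z j =>
        B.inp.injective.extend_apply _ _ _
      constructor
      · intro h j
        have := congrFun h (B.inp j)
        rw [B.inp.injective.extend_apply, hz, hz] at this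
        exact this
      · intro h
        funext q
        by_cases hq : ∃ i, B.inp i = q
        · obtain ⟨i, rfl⟩ := hq
          rw [B.inp.injective.extend_apply, hz, hz, h]
        · simp only [Exp.start, Function.extend_apply' _ _ _ hq]
    -- Copying adds bits modulo 2 and so is its own inverse; a string becomes a start string of `B`
    -- exactly when it was one, with the input shifted by the copied bits.
    have hinv : ∀ (src : J → Option A.W) (v : Bits A.W) (r : Bits B.W) (z : Bits J),
        (Function.extend B.inp (fun j => bitAt v (src j) ^^ r (B.inp j)) r = B.start z) ↔
          r = B.start fun j => bitAt v (src j) ^^ z j := by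
      intro src v r z
      constructor
      · intro h
        funext q
        by_cases hq : ∃ i, B.inp i = q
        · obtain ⟨i, rfl⟩ := hq
          have := congrFun h (B.inp i)
          rw [B.inp.injective.extend_apply] at this
          rw [Exp.start, B.inp.injective.extend_apply] at this ⊢
          rw [← this]
          simp
        · have := congrFun h q
          rw [Exp.start, Function.extend_apply' _ _ _ hq] at this ⊢
          rw [this, Function.extend_apply' _ _ _ hq]
      · intro h
        rw [h, hlay]
        intro j
        simp
    -- Deferred measurement: for a final string `v` of `A`, the copied output bits are determined,
    -- so the amplitude is a product and its squared norm is a product of two transition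
    -- probabilities.
    have hamp : ∀ x v u, circuitOp D.circ (cat v u) (D.start x) =
        circuitOp A.circ v (A.start x) *
          circuitOp B.circ u (B.start fun j => routed x (v ∘ A.out) (ρ j)) := by
      intro x v u
      have e1 : circuitOp D.circ (cat v u) (D.start x) =
          (circuitOp D.circ *ᵥ Pi.single (D.start x) 1) (cat v u) := by
        rw [Matrix.mulVec_single_one]; rfl
      rw [e1]
      simp only [D, circuitOp_append, ← Matrix.mulVec_mulVec]
      simp only [c4, circuitOp_map]
      rw [lift_inr_mulVec]
      simp only [c3, copyLayer_mulVec]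
      simp only [c2, circuitOp_map, lift_inl_mulVec]
      simp only [c1, copyLayer_mulVec]
      have e2 := hstart x
      simp only [D] at e2
      rw [e2]
      have e3 : ∀ v' r, (Pi.single (cat (A.start x) (B.start const)) 1 : Bits (A.W ⊕ B.W) → ℂ)
          (cat v' (Function.extend B.inp (fun j => bitAt v' (early j) ^^ r (B.inp j)) r)) =
          if v' = A.start x then (if r = B.start (fun j => bitAt (A.start x) (early j) ^^ const j)
            then 1 else 0) else 0 := by
        intro v' r
        rw [Pi.single_apply]
        simp only [cat_inj, hinv]
        by_cases h : v' = A.start x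
        · subst h; simp
        · simp [h]
      simp only [e3]
      have e4 : ∀ r, ((circuitOp A.circ *ᵥ fun v' => if v' = A.start x then
          (if r = B.start (fun j => bitAt (A.start x) (early j) ^^ const j) then (1 : ℂ) else 0)
            else 0) v) = circuitOp A.circ v (A.start x) *
            if r = B.start (fun j => bitAt (A.start x) (early j) ^^ const j) then 1 else 0 := by
        intro r
        rw [Matrix.mulVec, dotProduct]
        simp only [mul_ite, mul_zero]
        rw [Finset.sum_ite_eq', if_pos (Finset.mem_univ _)]
      simp only [e4]
      simp only [hinv]
      rw [Matrix.mulVec, dotProduct, Finset.sum_eq_single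
        (B.start fun j => routed x (v ∘ A.out) (ρ j))]
      · rw [if_pos, mul_one, mul_comm]
        congr 1
        funext j
        simp only [early, late, const]
        have hx : ∀ i, A.start x (A.inp i) = x i := fun i => A.inp.injective.extend_apply _ _ _
        rcases h : ρ j with i | o | b <;> simp [bitAt, routed, hx]
      · intro r _ hr
        rw [if_neg, mul_zero, mul_zero]
        intro h
        apply hr
        rw [h]
        congr 1
        funext j
        simp only [early, late, const]
        have hx : ∀ i, A.start x (A.inp i) = x i := fun i => A.inp.injective.extend_apply _ _ _
        rcases h : ρ j with i | o | b <;> simp [bitAt, routed, hx]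
      · simp
    funext x oq
    have hsum : D.prob x oq = ∑ v : Bits A.W, ∑ u : Bits B.W,
        if (cat v u) ∘ D.out = oq then ‖circuitOp D.circ (cat v u) (D.start x)‖ ^ 2 else 0 :=
      sum_cat _
    rw [hsum]
    simp only [Exp.prob, Finset.sum_mul_sum]
    refine Finset.sum_congr rfl fun v _ => Finset.sum_congr rfl fun u _ => ?_
    have hout : (cat v u ∘ D.out = oq) ↔ v ∘ A.out = oq ∘ Sum.inl ∧ u ∘ B.out = oq ∘ Sum.inr := by
      constructor
      · rintro rfl
        exact ⟨rfl, rfl⟩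
      · rintro ⟨h1, h2⟩
        rw [← cat_comp oq, ← h1, ← h2]
        funext q
        cases q <;> rfl
    simp only [hout]
    by_cases h1 : v ∘ A.out = oq ∘ Sum.inl
    · by_cases h2 : u ∘ B.out = oq ∘ Sum.inr
      · rw [if_pos ⟨h1, h2⟩, if_pos h1, if_pos h2, hamp, norm_mul, mul_pow, h1]
      · rw [if_neg fun h => h2 h.2, if_neg h2, mul_zero]
    · rw [if_neg fun h => h1 h.1, if_neg h1, zero_mul]

/-! ### Conversion from and to quantum procedures -/

variable [Fintype I] [DecidableEq I]

open Classical in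
theorem QProc.prob_eq_sum [Fintype O] [DecidableEq O] (A : QProc I O) (x : Bits I) (E : Set (Bits O)) :
    A.prob x E = ∑ o, if o ∈ E then A.prob x {o} else 0 := by
  have : ∀ o, (if o ∈ E then A.prob x {o} else 0) =
      ∑ s : Bits (I ⊕ Fin A.anc), if s ∘ A.out = o then
        (if s ∘ A.out ∈ E then ‖circuitOp A.circ s (cat x (zeros (Fin A.anc)))‖ ^ 2 else 0)
          else 0 := by
    intro o
    split_ifs with h
    · refine Finset.sum_congr rfl fun s _ => ?_
      by_cases h2 : s ∘ A.out = o
      · rw [if_pos (Set.mem_singleton_iff.2 h2), if_pos h2, if_pos (h2 ▸ h)]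
      · rw [if_neg (fun h => h2 (Set.mem_singleton_iff.1 h)), if_neg h2]
    · refine (Finset.sum_eq_zero fun s _ => ?_).symm
      by_cases h2 : s ∘ A.out = o
      · rw [if_pos h2, if_neg (h2 ▸ h)]
      · rw [if_neg h2]
  simp only [this]
  rw [Finset.sum_comm]
  exact Finset.sum_congr rfl fun s _ => (sum_ite_eq_self (s ∘ A.out) fun _ => _).symm

theorem start_inl_zeros {a : ℕ} (x : Bits I) :
    Function.extend (Function.Embedding.inl : I ↪ I ⊕ Fin a) x (zeros _) =
      cat x (zeros (Fin a)) := by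
  funext q
  cases q with
  | inl i => exact (Function.Embedding.inl (β := Fin a)).injective.extend_apply _ _ i
  | inr i => exact Function.extend_apply' _ _ _ (by simp)

theorem QProc.sim (A : QProc I O) : Sim A.size fun x o => A.prob x {o} := by
  refine ⟨⟨I ⊕ Fin A.anc, Function.Embedding.inl, zeros _, A.circ, A.out⟩, ?_, ?_⟩
  · simp [Exp.size, QProc.size]
  · funext x o
    simp only [Exp.prob, QProc.prob, Exp.start, Set.mem_singleton_iff, start_inl_zeros]
    rfl

/-- Negation of the wire `a`. -/
def negGate {W : Type} (a : W) : CGate W where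
  arity := 1
  arity_le := by norm_num
  wires := ⟨fun _ => a, fun _ _ _ => Subsingleton.elim _ _⟩
  perm := Function.Involutive.toPerm (fun s i => !s i) (fun s => by funext i; simp)

theorem negGate_apply {W : Type} [DecidableEq W] (a : W) (s : Bits W) :
    (negGate a).apply s = Function.update s a (!s a) := by
  funext q
  let e : Fin 1 ↪ W := ⟨fun _ => a, fun _ _ _ => Subsingleton.elim _ _⟩
  change Function.extend e (fun i => !s (e i)) s q = _
  by_cases hq : q = a
  · subst hq
    rw [Function.update_self]
    exact e.injective.extend_apply _ _ (0 : Fin 1)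
  · rw [Function.update_of_ne hq, Function.extend_apply']
    rintro ⟨i, hi⟩
    exact hq hi.symm

theorem negGates_foldl {W : Type} [DecidableEq W] (l : List W) (hl : l.Nodup) (s : Bits W) :
    (l.map negGate).foldl (fun s g => g.apply s) s = fun q => s q ^^ decide (q ∈ l) := by
  induction l generalizing s with
  | nil => simp
  | cons a l ih =>
    rw [List.map_cons, List.foldl_cons, ih (List.nodup_cons.1 hl).2, negGate_apply]
    funext q
    by_cases hq : q = a
    · subst hq
      simp [(List.nodup_cons.1 hl).1]
    · simp [hq]

/-- In a `QProc` every wire that is not an input starts at zero, so hardwired constants have to be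
written by negations. At most one negation per wire is used, whence the factor `2`. -/
theorem Sim.exists_qproc {c : ℕ} {Φ : Bits I → Bits O → ℝ} (h : Sim c Φ) :
    ∃ A : QProc I O, A.size ≤ 2 * c ∧ ∀ x o, A.prob x {o} = Φ x o := by
  classical
  obtain ⟨A, hA, rfl⟩ := h
  let Anc := {q : A.W // q ∉ Set.range A.inp}
  let m := Fintype.card Anc
  let e : A.W ≃ I ⊕ Fin m :=
    ((Equiv.sumCongr (Equiv.ofInjective A.inp A.inp.injective) (Fintype.equivFin Anc).symm).trans
      (Equiv.Set.sumCompl (Set.range A.inp))).symm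
  have he : ∀ i, e (A.inp i) = Sum.inl i := by
    intro i
    rw [Equiv.symm_apply_eq]
    rfl
  have he' : ∀ q, q ∉ Set.range A.inp → ∃ a, e q = Sum.inr a := by
    intro q hq
    rcases h : e q with i | a
    · rw [← he i] at h
      exact absurd ⟨i, (e.injective h).symm⟩ hq
    · exact ⟨a, rfl⟩
  let l : List (I ⊕ Fin m) := (Finset.univ.filter fun q => (∃ a, q = Sum.inr a) ∧
    A.base (e.symm q) = true).toList
  let P : QProc I O :=
    { anc := m
      circ := (l.map negGate).map CGate.toGate ++ A.circ.map (Gate.map e.toEmbedding)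
      out := e ∘ A.out }
  have hcard : Fintype.card A.W = Fintype.card I + m := by
    rw [Fintype.card_congr e, Fintype.card_sum, Fintype.card_fin]
  refine ⟨P, ?_, ?_⟩
  · have h1 : l.length ≤ Fintype.card I + m := by
      rw [Finset.length_toList]
      refine (Finset.card_le_univ _).trans ?_
      rw [Fintype.card_sum, Fintype.card_fin]
    simp only [Exp.size] at hA
    simp only [QProc.size, P, List.length_append, List.length_map]
    omega
  · intro x o
    have hstart : (l.map negGate).foldl (fun s g => g.apply s) (cat x (zeros (Fin m))) =
        A.start x ∘ e.symm := by
      rw [negGates_foldl _ (Finset.nodup_toList _)]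
      funext q
      simp only [Finset.mem_toList, Finset.mem_filter, Finset.mem_univ, true_and,
        Function.comp_apply]
      rcases q with i | a
      · have : e.symm (Sum.inl i) = A.inp i := by rw [Equiv.symm_apply_eq, he]
        rw [this, Exp.start, A.inp.injective.extend_apply]
        simp [cat]
      · have : ¬ ∃ i, A.inp i = e.symm (Sum.inr a) := by
          rintro ⟨i, hi⟩
          rw [Equiv.eq_symm_apply, he] at hi
          exact Sum.inl_ne_inr hi
        rw [Exp.start, Function.extend_apply' _ _ _ this]
        simp [cat, zeros]
    have hamp : ∀ s, circuitOp P.circ s (cat x (zeros (Fin m))) =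
        circuitOp A.circ (s ∘ e) (A.start x) := by
      intro s
      have e1 : circuitOp P.circ s (cat x (zeros (Fin m))) =
          (circuitOp P.circ *ᵥ Pi.single (cat x (zeros (Fin m))) 1) s := by
        rw [Matrix.mulVec_single_one]; rfl
      rw [e1]
      simp only [P, circuitOp_append, ← Matrix.mulVec_mulVec, circuitOp_toGate_single]
      rw [hstart, circuitOp_map, Matrix.mulVec_single_one, Matrix.col_apply, lift, if_pos]
      · congr 1
        funext q
        simp
      · intro q hq
        exact absurd ⟨e.symm q, by simp⟩ hq
    simp only [QProc.prob, Exp.prob, Set.mem_singleton_iff]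
    refine Fintype.sum_equiv (e.arrowCongr (Equiv.refl Bool)).symm _ _ fun s => ?_
    have hs : (e.arrowCongr (Equiv.refl Bool)).symm s = s ∘ e := rfl
    rw [hs]
    refine if_congr Iff.rfl ?_ rfl
    have := hamp s
    rw [← this]

end Sim

/-! ## Deterministic functions -/

open Classical in
/-- The function `f` is computed by an experiment of size at most `c`. -/
def Det {I O : Type} (c : ℕ) (f : Bits I → Bits O) : Prop :=
  Sim c fun x o => if o = f x then 1 else 0

section Det

variable {I O J Q : Type} {c c' : ℕ}

theorem Det.mono {f : Bits I → Bits O} (h : Det c f) (hc : c ≤ c') : Det c' f := Sim.mono h hc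

open Classical in
theorem det_of_single (A : Exp I O) (f : Bits I → Bits O) (σ : Bits I → Bits A.W)
    (hA : ∀ x, circuitOp A.circ *ᵥ Pi.single (A.start x) 1 = Pi.single (σ x) (1 : ℂ))
    (hf : ∀ x, σ x ∘ A.out = f x) : Det A.size f := by
  refine ⟨A, le_rfl, ?_⟩
  funext x o
  have : ∀ s, (if s ∘ A.out = o then ‖circuitOp A.circ s (A.start x)‖ ^ 2 else 0) =
      if σ x = s then (if s ∘ A.out = o then 1 else 0) else (0 : ℝ) := by
    intro s
    have e1 : circuitOp A.circ s (A.start x) =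
        (circuitOp A.circ *ᵥ Pi.single (A.start x) 1) s := by
      rw [Matrix.mulVec_single_one]; rfl
    rw [e1, hA, Pi.single_apply]
    by_cases h : s = σ x
    · simp [h]
    · have : ¬ σ x = s := fun h' => h h'.symm
      simp [h, this]
  rw [Exp.prob, Finset.sum_congr rfl fun s _ => this s, sum_ite_eq_self (σ x), hf]
  simp only [eq_comm]

theorem Det.route [Fintype I] [DecidableEq I] (ρ : O → I ⊕ Bool) :
    Det (Fintype.card I + 2) fun (x : Bits I) o => (ρ o).elim x id := by
  let A : Exp I O := ⟨I ⊕ Bool, Function.Embedding.inl, cat (zeros I) id, [], ρ⟩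
  have h := det_of_single A (fun x o => (ρ o).elim x id) (fun x => cat x id) (fun x => ?_)
    (fun x => ?_)
  · simpa [Exp.size, A] using h
  · rw [show A.circ = [] from rfl, circuitOp, Matrix.one_mulVec]
    congr 1
    funext q
    cases q with
    | inl i => exact A.inp.injective.extend_apply _ _ i
    | inr b => exact Function.extend_apply' _ _ _ (by simp [A])
  · rfl

theorem Det.proj [Fintype I] [DecidableEq I] (r : O → I) :
    Det (Fintype.card I + 2) fun x : Bits I => x ∘ r :=
  Det.route fun o => Sum.inl (r o)

theorem Det.const [Fintype I] [DecidableEq I] (v : Bits O) :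
    Det (Fintype.card I + 2) fun _ : Bits I => v :=
  Det.route fun o => Sum.inr (v o)

open Classical in
theorem Sim.post [Fintype O] [DecidableEq O] [Fintype Q] [DecidableEq Q]
    {Φ : Bits I → Bits O → ℝ} {f : Bits O → Bits Q}
    (h : Sim c Φ) (hf : Det c' f) :
    Sim (c + 3 * c') fun x q => ∑ o, if f o = q then Φ x o else 0 := by
  have h1 := (h.bind hf fun j => Sum.inr (Sum.inl j)).mapOut (Sum.inr : Q → O ⊕ Q)
  refine (congrArg (Sim (c + 3 * c')) ?_).mp h1
  funext x q
  rw [sum_cat]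
  refine Finset.sum_congr rfl fun o _ => ?_
  refine (Fintype.sum_eq_single q fun r hr => if_neg hr).trans ?_
  refine (if_pos (cat_comp_inr o q)).trans ?_
  by_cases h2 : f o = q
  · rw [if_pos h2]
    exact (congrArg _ (if_pos h2.symm)).trans (mul_one _)
  · rw [if_neg h2]
    exact (congrArg _ (if_neg fun h => h2 h.symm)).trans (mul_zero _)

theorem Det.comp [Fintype O] [DecidableEq O] [Fintype Q] [DecidableEq Q]
    {f : Bits I → Bits O} {g : Bits O → Bits Q} (hf : Det c f) (hg : Det c' g) :
    Det (c + 3 * c') fun x => g (f x) := by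
  classical
  refine (congrArg (Sim (c + 3 * c')) ?_).mp (Sim.post hf hg)
  funext x q
  refine (Fintype.sum_eq_single (f x) fun o ho => by simp [ho]).trans ?_
  simp [eq_comm]

theorem Det.map [Fintype O] [DecidableEq O] {f : Bits I → Bits O} (hf : Det c f) (r : Q → O) :
    Det c fun x => f x ∘ r := by
  classical
  refine (congrArg (Sim c) ?_).mp (Sim.mapOut hf r)
  funext x q
  refine (Fintype.sum_eq_single (f x) fun o ho => by simp [ho]).trans ?_
  simp [eq_comm]

theorem Det.cat [Fintype I] {f : Bits I → Bits O} {g : Bits I → Bits Q} (hf : Det c f)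
    (hg : Det c' g) : Det (c + 3 * c') fun x => cat (f x) (g x) := by
  classical
  refine (congrArg (Sim (c + 3 * c')) ?_).mp (Sim.bind hf hg fun j => Sum.inl j)
  funext x oq
  rw [← cat_comp oq]
  simp only [cat_comp_inl, cat_comp_inr, cat_inj, routed]
  by_cases h1 : oq ∘ Sum.inl = f x <;> by_cases h2 : oq ∘ Sum.inr = g x <;> simp [h1, h2]

/-- The gate that adds `op (s 0) (s 1)` to bit `2`. -/
def binGate (op : Bool → Bool → Bool) : CGate (Fin 3) where
  arity := 3
  arity_le := le_rfl
  wires := Function.Embedding.refl _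
  perm := Function.Involutive.toPerm (fun s => ![s 0, s 1, op (s 0) (s 1) ^^ s 2]) (fun s => by
    funext i; fin_cases i <;> simp)

theorem Det.op (op : Bool → Bool → Bool) :
    Det 4 fun s : Bits (Fin 2) => bit (op (s 0) (s 1)) := by
  let A : Exp (Fin 2) Unit :=
    ⟨Fin 3, Fin.castSuccEmb, zeros _, [(binGate op).toGate], fun _ => 2⟩
  have hs : ∀ x, A.start x = ![x 0, x 1, false] := by
    intro x
    funext i
    have h : ∀ j : Fin 2, A.start x (Fin.castSucc j) = x j := fun j =>
      A.inp.injective.extend_apply x A.base j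
    fin_cases i
    · exact h 0
    · exact h 1
    · refine (Function.extend_apply' _ _ _ ?_).trans rfl
      rintro ⟨j, hj⟩
      exact (Fin.castSucc_lt_last j).ne (hj : j.castSucc = Fin.last 2)
  have h := det_of_single A (fun s => bit (op (s 0) (s 1))) (fun x => (binGate op).apply (A.start x))
    (fun x => ?_) (fun x => ?_)
  · simpa [Exp.size, A] using h
  · rw [show A.circ = [(binGate op)].map CGate.toGate from rfl, circuitOp_toGate_single]
    rfl
  · funext _
    have : (binGate op).apply (A.start x) 2 = (op (x 0) (x 1) ^^ false) := by
      rw [hs]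
      exact (Function.Embedding.refl (Fin 3)).injective.extend_apply _ _ 2
    simpa [bit, A] using this

theorem Det.bin [Fintype I] (op : Bool → Bool → Bool) {f g : Bits I → Bool}
    (hf : Det c fun x => bit (f x)) (hg : Det c' fun x => bit (g x)) :
    Det (c + 3 * c' + 12) fun x => bit (op (f x) (g x)) :=
  ((hf.cat hg).map ![Sum.inl (), Sum.inr ()]).comp (Det.op op)

/-- Computing many bits of equal complexity. -/
theorem Det.tuple [Fintype I] [DecidableEq I] {m : ℕ} {f : Bits I → Fin m → Bool}
    (hf : ∀ i, Det c fun x => bit (f x i)) : Det (Fintype.card I + 2 + m * (3 * c)) f := by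
  induction m with
  | zero =>
    refine (congrArg (Det _) ?_).mp ((Det.const (I := I) (zeros (Fin 0))).mono (c' := _) (by simp))
    funext x i
    exact i.elim0
  | succ m ih =>
    have h := ((ih fun i => hf i.castSucc).cat (hf (Fin.last m))).map
      (Fin.lastCases (Sum.inr ()) Sum.inl : Fin (m + 1) → Fin m ⊕ Unit)
    refine (congrArg (Det _) ?_).mp (h.mono (by rw [add_mul]; omega))
    funext x i
    induction i using Fin.lastCases with
    | last => simp [MeasurementProtocol.cat, bit]
    | cast i => simp [MeasurementProtocol.cat]

theorem Det.parity [Fintype I] [DecidableEq I] {m : ℕ} {f : Bits I → Fin m → Bool}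
    (hf : ∀ i, Det c fun x => bit (f x i)) :
    Det (Fintype.card I + 2 + m * (3 * c + 12))
      fun x => bit (decide (Odd (Finset.univ.filter fun q => f x q = true).card)) := by
  induction m with
  | zero => simpa using Det.const (I := I) (bit false)
  | succ m ih =>
    have h := (ih fun i => hf i.succ).bin xor (hf 0)
    refine (congrArg (Det _) ?_).mp (h.mono (by rw [add_mul]; omega))
    funext x
    congr 1
    have : (Finset.univ.filter fun q => f x q = true).card =
        (if f x 0 = true then 1 else 0) + (Finset.univ.filter fun q : Fin m => f x q.succ = true).card := by
      rw [Finset.card_filter, Finset.card_filter, Fin.sum_univ_succ]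
    rw [this]
    cases f x 0
    · simp
    · simp only [if_true, Nat.odd_add, Nat.not_odd_iff_even.symm]
      by_cases h : Odd (Finset.univ.filter fun q : Fin m => f x q.succ = true).card <;> simp [h]

theorem CProc.det [Fintype I] [DecidableEq I] (A : CProc I O) : Det A.size A.eval := by
  let B : Exp I O :=
    ⟨I ⊕ Fin A.anc, Function.Embedding.inl, zeros _, A.circ.map CGate.toGate, A.out⟩
  have h := det_of_single B A.eval
    (fun x => A.circ.foldl (fun s g => g.apply s) (MeasurementProtocol.cat x (zeros (Fin A.anc))))
    (fun x => ?_) (fun x => rfl)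
  · simpa [Exp.size, CProc.size, B] using h
  · rw [show B.circ = A.circ.map CGate.toGate from rfl, circuitOp_toGate_single]
    congr 2
    exact start_inl_zeros x

end Det

/-! ## Polynomial bounds -/

theorem PolyBounded.mono {f g : ℕ → ℕ} (hg : PolyBounded g) (h : ∀ κ, f κ ≤ g κ) :
    PolyBounded f := by
  obtain ⟨p, hp⟩ := hg
  exact ⟨p, fun κ => (h κ).trans (hp κ)⟩

theorem PolyBounded.const (c : ℕ) : PolyBounded fun _ => c :=
  ⟨Polynomial.C c, fun κ => by simp⟩

theorem PolyBounded.add {f g : ℕ → ℕ} (hf : PolyBounded f) (hg : PolyBounded g) :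
    PolyBounded fun κ => f κ + g κ := by
  obtain ⟨p, hp⟩ := hf
  obtain ⟨q, hq⟩ := hg
  exact ⟨p + q, fun κ => by simpa using add_le_add (hp κ) (hq κ)⟩

theorem PolyBounded.mul {f g : ℕ → ℕ} (hf : PolyBounded f) (hg : PolyBounded g) :
    PolyBounded fun κ => f κ * g κ := by
  obtain ⟨p, hp⟩ := hf
  obtain ⟨q, hq⟩ := hg
  exact ⟨p * q, fun κ => by simpa using Nat.mul_le_mul (hp κ) (hq κ)⟩

/-! ## Uniformly polynomial families of deterministic functions -/

/-- The functions `f κ a`, where `a` stands for hardwired constants, are computed by experiments of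
polynomial size. -/
def PolyDet {ι I O : ℕ → Type} (f : ∀ κ, ι κ → Bits (I κ) → Bits (O κ)) : Prop :=
  ∃ p, PolyBounded p ∧ ∀ κ a, Det (p κ) (f κ a)

section PolyDet

variable {ι ι' I O J Q : ℕ → Type}

theorem PolyDet.reindex {f : ∀ κ, ι κ → Bits (I κ) → Bits (O κ)} (hf : PolyDet f)
    (r : ∀ κ, ι' κ → ι κ) : PolyDet fun κ a => f κ (r κ a) := by
  obtain ⟨p, hp, h⟩ := hf
  exact ⟨p, hp, fun κ a => h κ _⟩

theorem PolyDet.ite {f g : ∀ κ, ι κ → Bits (I κ) → Bits (O κ)} (hf : PolyDet f) (hg : PolyDet g)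
    (P : ∀ κ, ι κ → Prop) [∀ κ a, Decidable (P κ a)] :
    PolyDet fun κ a x => if P κ a then f κ a x else g κ a x := by
  obtain ⟨p, hp, h⟩ := hf
  obtain ⟨q, hq, h'⟩ := hg
  refine ⟨_, hp.add hq, fun κ a => ?_⟩
  by_cases hP : P κ a
  · simpa only [if_pos hP] using (h κ a).mono (Nat.le_add_right _ _)
  · simpa only [if_neg hP] using (h' κ a).mono (Nat.le_add_left _ _)

section

variable [∀ κ, Fintype (I κ)] [∀ κ, DecidableEq (I κ)] [∀ κ, Fintype (O κ)]
  [∀ κ, DecidableEq (O κ)] [∀ κ, Fintype (Q κ)] [∀ κ, DecidableEq (Q κ)]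

theorem PolyDet.proj (hI : PolyBounded fun κ => Fintype.card (I κ)) (r : ∀ κ, ι κ → O κ → I κ) :
    PolyDet fun κ a (x : Bits (I κ)) => x ∘ r κ a :=
  ⟨_, hI.add (.const 2), fun _ _ => Det.proj _⟩

theorem PolyDet.const (hI : PolyBounded fun κ => Fintype.card (I κ))
    (v : ∀ κ, ι κ → Bits (O κ)) : PolyDet fun κ a (_ : Bits (I κ)) => v κ a :=
  ⟨_, hI.add (.const 2), fun _ _ => Det.const _⟩

theorem PolyDet.map {f : ∀ κ, ι κ → Bits (I κ) → Bits (O κ)} (hf : PolyDet f)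
    (r : ∀ κ, ι κ → Q κ → O κ) : PolyDet fun κ a x => f κ a x ∘ r κ a := by
  obtain ⟨p, hp, h⟩ := hf
  exact ⟨p, hp, fun κ a => (h κ a).map _⟩

theorem PolyDet.comp {f : ∀ κ, ι κ → Bits (I κ) → Bits (O κ)}
    {g : ∀ κ, ι κ → Bits (O κ) → Bits (Q κ)} (hf : PolyDet f) (hg : PolyDet g) :
    PolyDet fun κ a x => g κ a (f κ a x) := by
  obtain ⟨p, hp, h⟩ := hf
  obtain ⟨q, hq, h'⟩ := hg
  exact ⟨_, hp.add ((PolyBounded.const 3).mul hq), fun κ a => (h κ a).comp (h' κ a)⟩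

theorem PolyDet.cat {f : ∀ κ, ι κ → Bits (I κ) → Bits (O κ)}
    {g : ∀ κ, ι κ → Bits (I κ) → Bits (Q κ)} (hf : PolyDet f) (hg : PolyDet g) :
    PolyDet fun κ a x => cat (f κ a x) (g κ a x) := by
  obtain ⟨p, hp, h⟩ := hf
  obtain ⟨q, hq, h'⟩ := hg
  exact ⟨_, hp.add ((PolyBounded.const 3).mul hq), fun κ a => (h κ a).cat (h' κ a)⟩

theorem PolyDet.bin {f g : ∀ κ, ι κ → Bits (I κ) → Bool} (op : ∀ κ, ι κ → Bool → Bool → Bool)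
    (hf : PolyDet fun κ a x => bit (f κ a x)) (hg : PolyDet fun κ a x => bit (g κ a x)) :
    PolyDet fun κ a x => bit (op κ a (f κ a x) (g κ a x)) := by
  obtain ⟨p, hp, h⟩ := hf
  obtain ⟨q, hq, h'⟩ := hg
  exact ⟨_, (hp.add ((PolyBounded.const 3).mul hq)).add (.const 12),
    fun κ a => (h κ a).bin _ (h' κ a)⟩

theorem PolyDet.tuple (hI : PolyBounded fun κ => Fintype.card (I κ)) {m : ℕ → ℕ}
    (hm : PolyBounded m) {f : ∀ κ, ι κ → Bits (I κ) → Fin (m κ) → Bool}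
    (hf : PolyDet (ι := fun κ => ι κ × Fin (m κ)) fun κ a x => bit (f κ a.1 x a.2)) :
    PolyDet f := by
  obtain ⟨p, hp, h⟩ := hf
  exact ⟨_, (hI.add (.const 2)).add (hm.mul ((PolyBounded.const 3).mul hp)),
    fun κ a => Det.tuple fun i => h κ (a, i)⟩

theorem PolyDet.parity (hI : PolyBounded fun κ => Fintype.card (I κ)) {m : ℕ → ℕ}
    (hm : PolyBounded m) {f : ∀ κ, ι κ → Bits (I κ) → Fin (m κ) → Bool}
    (hf : PolyDet (ι := fun κ => ι κ × Fin (m κ)) fun κ a x => bit (f κ a.1 x a.2)) :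
    PolyDet fun κ a x => bit (decide (Odd (Finset.univ.filter fun q => f κ a x q = true).card)) := by
  obtain ⟨p, hp, h⟩ := hf
  exact ⟨_, (hI.add (.const 2)).add (hm.mul (((PolyBounded.const 3).mul hp).add (.const 12))),
    fun κ a => Det.parity fun i => h κ (a, i)⟩

/-- The arguments of an efficiently computable function are structured data; `g` is the function on
raw strings that the circuit computes, in a form that can be composed with other circuits. -/
theorem EffComputes.polyDet {A : ℕ → Type} {enc : ∀ κ, A κ → Bits (I κ)}
    {f : ∀ κ, A κ → Bits (O κ)} (h : EffComputes enc f) (ι : ℕ → Type) :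
    ∃ g : ∀ κ, Bits (I κ) → Bits (O κ), (PolyDet fun κ (_ : ι κ) => g κ) ∧
      ∀ κ a, g κ (enc κ a) = f κ a := by
  obtain ⟨p, hp, h⟩ := h
  exact ⟨fun κ => (p κ).eval, ⟨_, hp, fun κ _ => (p κ).det⟩, h⟩

theorem PolyDet.dotXor {w : ℕ → ℕ} (hw : PolyBounded w)
    {d u v : ∀ κ, ι κ → Bits (I κ) → Bits (Fin (w κ))}
    (hd : PolyDet d) (hu : PolyDet u) (hv : PolyDet v) :
    PolyDet fun κ a x => bit (dotXor (d κ a x) (u κ a x) (v κ a x)) := by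
  have hI : PolyBounded fun κ => Fintype.card (Fin (w κ) ⊕ Fin (w κ) ⊕ Fin (w κ)) := by
    simpa using hw.add (hw.add hw)
  have hp : ∀ r : ∀ κ, Fin (w κ) → Fin (w κ) ⊕ Fin (w κ) ⊕ Fin (w κ),
      PolyDet (ι := fun κ => ι κ × Fin (w κ)) fun κ a x => bit (x (r κ a.2)) := fun r =>
    PolyDet.proj (ι := fun κ => ι κ × Fin (w κ)) (O := fun _ => Unit) hI fun κ a _ => r κ a.2
  have h1 := PolyDet.bin (fun _ _ => and) (hp fun _ => Sum.inl)
    (PolyDet.bin (fun _ _ => xor) (hp fun _ q => Sum.inr (Sum.inl q))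
      (hp fun _ q => Sum.inr (Sum.inr q)))
  have h2 := (hd.cat (hu.cat hv)).comp (PolyDet.parity hI hw (f := fun κ _ x q =>
    x (Sum.inl q) && (x (Sum.inr (Sum.inl q)) ^^ x (Sum.inr (Sum.inr q)))) h1)
  simp only [Bool.and_eq_true] at h2
  exact h2

end

end PolyDet

/-! ## The verifier's computations -/

section Store

variable {P : Interface}

/-- The bit stored by the verifier, as a function of a random bit `r`. -/
def storeDet (F : ExtendedTCF P) (κ : ℕ) (h : Bool) (k : Bits (Fin (P.lenK κ)))
    (t : Bits (Fin (P.lenT κ))) (r : Bool) (y : Bits (Fin (P.lenY κ))) (b : Bool)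
    (d : Bits (Fin (F.w κ))) : Bool :=
  match h with
  | false =>
    match F.inj.inv κ t y with
    | some z => z.1
    | none => r
  | true =>
    match F.inv κ t false y, F.inv κ t true y with
    | some x₀, some x₁ =>
      if F.checkG κ k false x₀ t d = true ∧ F.checkG κ k true x₁ t d = true then
        b ^^ dotXor d (F.J κ x₀) (F.J κ x₁)
      else r
    | _, _ => r

/-- With the verifier's coin made an explicit bit, storing is a deterministic function and the coins
can be fixed to their worst values in a reduction. -/
theorem storeProb_eq (F : ExtendedTCF P) (κ : ℕ) (h : Bool) (k : Bits (Fin (P.lenK κ)))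
    (t : Bits (Fin (P.lenT κ))) (y : Bits (Fin (P.lenY κ))) (b : Bool)
    (d : Bits (Fin (F.w κ))) (m : Bool) :
    storeProb F κ h k t y b d m =
      (1 / 2) * ∑ r, if m = storeDet F κ h k t r y b d then 1 else 0 := by
  cases h
  · rcases h1 : F.inj.inv κ t y with _ | z
    · cases m <;> simp [storeProb, storeDet, h1]
    · simp [storeProb, storeDet, h1]
  · rcases h1 : F.inv κ t false y with _ | x₀
    · cases m <;> simp [storeProb, storeDet, h1]
    · rcases h2 : F.inv κ t true y with _ | x₁
      · cases m <;> simp [storeProb, storeDet, h1, h2]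
      · simp only [storeProb, storeDet, h1, h2]
        split_ifs <;> cases m <;> simp

/-- The wires holding a commitment string, a reported bit and a reported string. -/
abbrev ReportWire (P : Interface) (w : ℕ → ℕ) (κ : ℕ) : Type :=
  Fin (P.lenY κ) ⊕ (Unit ⊕ Fin (w κ))

theorem reportWire_poly (F : NTCF P) :
    PolyBounded fun κ => Fintype.card (ReportWire P F.w κ) := by
  simpa using P.lenY_poly.add ((PolyBounded.const 1).add F.w_poly)

/-- Key, trapdoor and coin are hardwired; only the commitment string and the prover's report are
inputs. The flag bit of `encOpt` selects between the inverse and the coin. -/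
theorem storeDet_polyDet_false (F : ExtendedTCF P) :
    PolyDet (ι := fun κ => Bits (Fin (P.lenK κ)) × Bits (Fin (P.lenT κ)) × Bool)
      (I := ReportWire P F.w) (O := fun _ => Unit) fun κ a x =>
        bit (storeDet F κ false a.1 a.2.1 a.2.2 (x ∘ Sum.inl) (x (Sum.inr (Sum.inl ())))
          (x ∘ Sum.inr ∘ Sum.inr)) := by
  have hI := reportWire_poly F.toNTCF
  obtain ⟨g, hg, hg'⟩ := F.inj.inv_eff.polyDet
    (fun κ => Bits (Fin (P.lenK κ)) × Bits (Fin (P.lenT κ)) × Bool)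
  have h0 := ((PolyDet.const (ι := fun κ => Bits (Fin (P.lenK κ)) × Bits (Fin (P.lenT κ)) × Bool) hI
    (fun κ a => a.2.1)).cat (PolyDet.proj hI fun κ a => Sum.inl)).comp hg
  have h1 := h0.map (Q := fun _ => Unit) fun κ _ _ => none
  have h2 := h0.map (Q := fun _ => Unit) fun κ _ _ => some (Sum.inl ())
  have h3 := PolyDet.bin (fun κ a b c => if b then c else a.2.2) h1 h2
  refine (congrArg PolyDet ?_).mp h3
  funext κ a x
  have := hg' κ (a.2.1, x ∘ Sum.inl)
  simp only at this
  simp only [this, storeDet]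
  cases F.inj.inv κ a.2.1 (x ∘ Sum.inl)
  · simp [encOpt]
  · simp [encOpt, cat, bit]

/-- There is no branching in a circuit: all subcomputations are carried out, also on the zero string
that encodes a failed inversion, and the flags and membership bits select the result at the end. -/
theorem storeDet_polyDet_true (F : ExtendedTCF P) :
    PolyDet (ι := fun κ => Bits (Fin (P.lenK κ)) × Bits (Fin (P.lenT κ)) × Bool)
      (I := ReportWire P F.w) (O := fun _ => Unit) fun κ a x =>
        bit (storeDet F κ true a.1 a.2.1 a.2.2 (x ∘ Sum.inl) (x (Sum.inr (Sum.inl ())))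
          (x ∘ Sum.inr ∘ Sum.inr)) := by
  have hI := reportWire_poly F.toNTCF
  let ι := fun κ => Bits (Fin (P.lenK κ)) × Bits (Fin (P.lenT κ)) × Bool
  obtain ⟨gi, hgi, hgi'⟩ := F.inv_eff.polyDet ι
  obtain ⟨gc, hgc, hgc'⟩ := F.checkG_eff.polyDet ι
  obtain ⟨gJ, hgJ, hgJ'⟩ := F.J_eff.polyDet ι
  have hinv := fun b : Bool => ((PolyDet.const (ι := ι) hI (fun κ a => a.2.1)).cat
    ((PolyDet.const (ι := ι) (O := fun _ => Unit) hI (fun κ a => bit b)).cat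
      (PolyDet.proj hI fun κ a => Sum.inl))).comp hgi
  have hd := PolyDet.proj (ι := ι) hI fun κ _ => Sum.inr ∘ Sum.inr
  have hflag := fun b : Bool => (hinv b).map (Q := fun _ => Unit) fun κ _ _ => none
  have hx := fun b : Bool => (hinv b).map fun κ _ => some
  have hchk := fun b : Bool => ((PolyDet.const (ι := ι) hI (fun κ a => a.1)).cat
    ((PolyDet.const (ι := ι) (O := fun _ => Unit) hI (fun κ a => bit b)).cat
      ((hx b).cat ((PolyDet.const (ι := ι) hI (fun κ a => a.2.1)).cat hd)))).comp hgc
  have hip := PolyDet.dotXor F.w_poly hd ((hx false).comp hgJ) ((hx true).comp hgJ)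
  have hb := PolyDet.proj (ι := ι) (O := fun _ => Unit) hI fun κ _ _ => Sum.inr (Sum.inl ())
  have hchk' := fun b : Bool => (hchk b).map (Q := fun _ => Unit) fun κ _ _ => ()
  have hgood := PolyDet.bin (fun _ _ => and)
    (PolyDet.bin (fun _ _ => and) (hflag false) (hflag true))
    (PolyDet.bin (fun _ _ => and) (hchk' false) (hchk' true))
  have hres := PolyDet.bin (fun κ a b c => if b then c else a.2.2) hgood
    (PolyDet.bin (fun _ _ => xor) hb hip)
  refine (congrArg PolyDet ?_).mp hres
  funext κ a x
  have e0 := hgi' κ (a.2.1, false, x ∘ Sum.inl)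
  have e1 := hgi' κ (a.2.1, true, x ∘ Sum.inl)
  simp only at e0 e1
  have ec := fun b x₀ => hgc' κ (a.1, b, x₀, a.2.1, x ∘ Sum.inr ∘ Sum.inr)
  simp only at ec
  have hsome : ∀ x₀ : Bits (Fin (P.lenX κ)), encOpt (some x₀) ∘ some = x₀ := fun _ => rfl
  have hnone : ∀ x₀ : Bits (Fin (P.lenX κ)), encOpt (some x₀) none = true := fun _ => rfl
  have hnone' : encOpt (none : Option (Bits (Fin (P.lenX κ)))) none = false := rfl
  simp only [e0, e1, storeDet]
  cases F.inv κ a.2.1 false (x ∘ Sum.inl) <;> cases F.inv κ a.2.1 true (x ∘ Sum.inl)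
  · simp [hnone']
  · simp [hnone']
  · simp [hnone']
  · simp [hnone, hsome, ec, hgJ', bit]

end Store

/-! ## Circuits for the Hadamard transform -/

theorem ite_congr_prop {α : Type*} {p q : Prop} {_ : Decidable p} {_ : Decidable q} (h : p ↔ q)
    (a b : α) : (if p then a else b) = if q then a else b :=
  if_congr h rfl rfl

theorem ite_congr_prop_of {α : Type*} {p q : Prop} {_ : Decidable p} {_ : Decidable q} (h : p ↔ q)
    {a b a' b' : α} (ha : a = a') (hb : b = b') : (if p then a else b) = if q then a' else b' := by
  subst ha hb
  exact ite_congr_prop h _ _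

section Hadamard

variable {W : Type} [Fintype W] [DecidableEq W]

/-- The Hadamard transform of one qubit. -/
def hadamardMat (V : Type) [Unique V] : Matrix (Bits V) (Bits V) ℂ :=
  fun s s' => (if s default && s' default then -1 else 1) / ((√2 : ℝ) : ℂ)

theorem sqrt_two_mul_self : ((√2 : ℝ) : ℂ) * ((√2 : ℝ) : ℂ) = 2 := by
  rw [← Complex.ofReal_mul, Real.mul_self_sqrt (by norm_num)]
  norm_num

theorem hadamardMat_unitary :
    hadamardMat (Fin 1) ∈ Matrix.unitaryGroup (Bits (Fin 1)) ℂ := by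
  rw [Matrix.mem_unitaryGroup_iff, Matrix.star_eq_conjTranspose]
  have h2 : ((√2 : ℝ) : ℂ) ≠ 0 := by
    intro h
    have := sqrt_two_mul_self
    rw [h] at this
    norm_num at this
  ext s s'
  rw [Matrix.mul_apply, ← (Equiv.funUnique (Fin 1) Bool).symm.sum_comp, Fintype.sum_bool]
  have hs : s = s' ↔ s 0 = s' 0 := by
    constructor
    · rintro rfl; rfl
    · intro h
      funext i
      rw [Subsingleton.elim i 0, h]
  simp only [Matrix.conjTranspose_apply, hadamardMat, Matrix.one_apply, hs]
  have hst : star ((√2 : ℝ) : ℂ) = ((√2 : ℝ) : ℂ) := Complex.conj_ofReal _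
  have e1 : ((Equiv.funUnique (Fin 1) Bool).symm true) default = true := rfl
  have e0 : ((Equiv.funUnique (Fin 1) Bool).symm false) default = false := rfl
  have ed : (default : Fin 1) = 0 := rfl
  rw [ed] at e0 e1 ⊢
  rw [e1, e0]
  cases s 0 <;> cases s' 0 <;> simp [hst] <;> field_simp <;>
    first | ring1 | linear_combination -sqrt_two_mul_self

/-- The Hadamard gate. -/
def hadamardGate : Gate Unit where
  arity := 1
  arity_le := by norm_num
  wires := ⟨fun _ => (), fun _ _ _ => Subsingleton.elim _ _⟩
  mat := hadamardMat (Fin 1)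
  unitary := hadamardMat_unitary

theorem hadamardGate_circuitOp : circuitOp [hadamardGate] = hadamardMat Unit := by
  rw [circuitOp, circuitOp, one_mul, Gate.op_eq_lift]
  ext s s'
  rw [lift, if_pos]
  · rfl
  · exact fun q hq => absurd ⟨(0 : Fin 1), rfl⟩ hq

theorem exists_hadamardOn_circuit (Q : Set W) :
    ∃ c : List (Gate W), c.length ≤ Fintype.card W ∧ circuitOp c = hadamardOn Q := by
  classical
  let e : {q // q ∈ Q} × Unit ↪ W := ⟨fun q => q.1.1, fun q q' h => by
    ext
    exact h⟩
  refine ⟨(Finset.univ : Finset {q // q ∈ Q}).toList.flatMap fun j => [hadamardGate].map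
    (Gate.map ⟨fun v => e (j, v), fun v v' h => (Prod.ext_iff.1 (e.injective h)).2⟩), ?_, ?_⟩
  · simp only [List.map_cons, List.map_nil, List.length_flatMap, List.length_cons, List.length_nil]
    simpa [Fintype.card_subtype] using Fintype.card_subtype_le (· ∈ Q)
  · ext s s'
    rw [parallel_apply e (hadamardMat Unit) _ hadamardGate_circuitOp _ (Finset.nodup_toList _)]
    have hc : (∀ q, (∀ j ∈ (Finset.univ : Finset {q // q ∈ Q}).toList, ∀ v, e (j, v) ≠ q) →
        s q = s' q) ↔ ∀ q, q ∉ Q → s q = s' q := by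
      refine forall_congr' fun q => imp_congr_left ?_
      constructor
      · exact fun h hq => h ⟨q, hq⟩ (by simp) () rfl
      · rintro h j _ v rfl
        exact h j.2
    simp only [hc, hadamardOn]
    refine if_congr Iff.rfl ?_ rfl
    rw [Finset.prod_map_toList, Finset.prod_ite, Finset.prod_const_one, mul_one,
      ← Finset.prod_subtype_eq_prod_filter]
    refine Finset.prod_congr ?_ fun _ _ => rfl
    ext
    simp

/-- A fair coin. -/
theorem Sim.coin : Sim 2 fun (_ : Bits Empty) (_ : Bits Unit) => 1 / 2 := by
  let A : Exp Empty Unit :=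
    ⟨Unit, ⟨Empty.elim, fun a => a.elim⟩, zeros _, [hadamardGate], id⟩
  refine ⟨A, by simp [Exp.size, A], ?_⟩
  funext x o
  refine (Fintype.sum_eq_single o fun s hs => if_neg hs).trans ((if_pos rfl).trans ?_)
  change ‖circuitOp [hadamardGate] o (A.start x)‖ ^ 2 = _
  have h : A.start x = zeros Unit := by
    funext q
    exact Function.extend_apply' _ _ _ (by simp)
  rw [h, hadamardGate_circuitOp, hadamardMat]
  simp [zeros]

end Hadamard

/-! ## The prover's circuit -/

section Master

variable {n p p' l e m : ℕ}

/-- The inclusion of the smaller preimage registers. -/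
def Wire.grow (hp : p' ≤ p) : Wire n p' l e m ↪ Wire n p l e m where
  toFun
    | .committed i => .committed i
    | .preimage i q => .preimage i (Fin.castLE hp q)
    | .commitment i q => .commitment i q
    | .aux q => .aux q
    | .key i q => .key i q
  inj' := by
    rintro (_ | _ | _ | _ | _) (_ | _ | _ | _ | _) <;> simp

theorem Wire.shrink_eq (hp : p' ≤ p) (s : Bits (Wire n p l e m)) :
    Wire.shrink hp s = s ∘ Wire.grow hp := by
  funext q
  cases q <;> rfl

/-- Zeros appended after `U₀` might as well have been idle from the start, so a single layout of the
wires serves the entire circuit. -/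
theorem lift_grow_init (hp : p' ≤ p) (U : Matrix (Bits (Wire n p' l e m)) (Bits _) ℂ)
    (k : Fin n → Bits (Fin m)) (s : Bits (Wire n p l e m)) :
    lift (Wire.grow hp) U s (Wire.init k) = appendZeros hp (fun s => U s (Wire.init k)) s := by
  rw [lift, appendZeros]
  have h : Wire.init k ∘ Wire.grow (n := n) (l := l) (e := e) hp = Wire.init k := by
    funext q; cases q <;> rfl
  rw [h, Wire.shrink_eq]
  refine ite_congr_prop ⟨fun h i q hq => ?_, fun h q hq => ?_⟩ _ _
  · refine h _ ?_
    rintro ⟨q', hq'⟩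
    cases q' <;> simp [Wire.grow] at hq'
    rename_i i' q'
    replace hq' : Wire.preimage i' (Fin.castLE hp q') = Wire.preimage i q := hq'
    simp only [Wire.preimage.injEq] at hq'
    have := q'.2
    rw [← hq'.2] at hq
    simp at hq
    omega
  · cases q with
    | committed i => exact absurd ⟨.committed i, rfl⟩ hq
    | commitment i q => exact absurd ⟨.commitment i q, rfl⟩ hq
    | aux q => exact absurd ⟨.aux q, rfl⟩ hq
    | key i q => exact absurd ⟨.key i q, rfl⟩ hq
    | preimage i q =>
      refine h i q ?_
      by_contra hlt
      exact hq ⟨.preimage i ⟨q, by omega⟩, rfl⟩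

theorem exists_onPreimages_circuit (c : List (Gate (Fin p))) :
    ∃ c' : List (Gate (Wire n p l e m)), c'.length = n * c.length ∧
      circuitOp c' = onPreimages (circuitOp c) := by
  let f : Fin n × Fin p ↪ Wire n p l e m := ⟨fun q => .preimage q.1 q.2, fun q q' h => by
    simpa [Prod.ext_iff] using h⟩
  refine ⟨(Finset.univ : Finset (Fin n)).toList.flatMap fun j => c.map
    (Gate.map ⟨fun v => f (j, v), fun v v' h => by simpa using f.injective h⟩), ?_, ?_⟩
  · simp [List.length_flatMap]
  · ext s s'
    rw [parallel_apply f _ c rfl _ (Finset.nodup_toList _), onPreimages, Finset.prod_map_toList]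
    refine ite_congr_prop ⟨fun h => ?_, fun h q hq => ?_⟩ _ _
    · refine ⟨fun i => h _ ?_, fun i q => h _ ?_, fun q => h _ ?_, fun i q => h _ ?_⟩ <;>
        simp [f]
    · cases q with
      | committed i => exact h.1 i
      | commitment i q => exact h.2.1 i q
      | aux q => exact h.2.2.1 q
      | key i q => exact h.2.2.2 i q
      | preimage i q => exact absurd rfl (hq i (by simp) q)

/-- The probability (for a subnormalized state `φ`) of the result `s`, when the measured wires are
measured in the Hadamard basis after the attack. -/
def outWeight (S : Channel (Wire n p l e m)) (w : ℕ) (φ : Bits (Wire n p l e m) → ℂ)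
    (s : Bits (Wire n p l e m)) : ℝ :=
  ∑ τ, ‖(hadamardOn (measuredWires w) *ᵥ (S.op τ *ᵥ φ)) s‖ ^ 2

/-- The right-hand side involves the vectors `v i` only through the operator `∑ v v†`. Outcome
weights therefore depend on a channel and not on the chosen Kraus operators. -/
theorem sum_normSq_mulVec {W ι : Type} [Fintype W] [DecidableEq W] [Fintype ι]
    (H : Matrix (Bits W) (Bits W) ℂ) (v : ι → Bits W → ℂ) (s : Bits W) :
    ((∑ i, ‖(H *ᵥ v i) s‖ ^ 2 : ℝ) : ℂ) =
      ∑ t, ∑ t', H s t * star (H s t') * ∑ i, v i t * star (v i t') := by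
  push_cast
  have : ∀ i, ((‖(H *ᵥ v i) s‖ : ℝ) : ℂ) ^ 2 =
      ∑ t, ∑ t', H s t * star (H s t') * (v i t * star (v i t')) := by
    intro i
    rw [← Complex.mul_conj', Matrix.mulVec, dotProduct, map_sum, Finset.sum_mul_sum]
    refine Finset.sum_congr rfl fun t _ => Finset.sum_congr rfl fun t' _ => ?_
    rw [map_mul]
    simp only [← starRingEnd_apply]
    ring
  simp only [this, Finset.mul_sum]
  rw [Finset.sum_comm]
  refine Finset.sum_congr rfl fun t _ => ?_
  rw [Finset.sum_comm]

theorem Channel.apply_pure {W : Type} [Fintype W] [DecidableEq W] (S : Channel W)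
    (φ : Bits W → ℂ) (t t' : Bits W) :
    S.apply (Matrix.vecMulVec φ (star φ)) t t' =
      ∑ τ, (S.op τ *ᵥ φ) t * star ((S.op τ *ᵥ φ) t') := by
  rw [Channel.apply, Matrix.sum_apply]
  refine Finset.sum_congr rfl fun τ _ => ?_
  rw [Matrix.mul_vecMulVec, Matrix.vecMulVec_mul, ← Matrix.star_mulVec]
  rfl

theorem circuitChannel_pure {W : Type} [Fintype W] [DecidableEq W] {a : ℕ}
    (c : List (Gate (W ⊕ Fin a))) (φ : Bits W → ℂ) (t t' : Bits W) :
    circuitChannel c (Matrix.vecMulVec φ (star φ)) t t' =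
      ∑ z, (∑ u, circuitOp c (cat t z) (cat u (zeros _)) * φ u) *
        star (∑ u, circuitOp c (cat t' z) (cat u (zeros _)) * φ u) := by
  rw [circuitChannel]
  refine Finset.sum_congr rfl fun z _ => ?_
  rw [star_sum, Finset.sum_mul_sum]
  refine Finset.sum_congr rfl fun u _ => Finset.sum_congr rfl fun u' _ => ?_
  rw [Matrix.vecMulVec_apply, star_mul', Pi.star_apply]
  ring

/-- Both sides are functions of the state after the attack, on which the channel and the circuit
agree, although their Kraus decompositions have unrelated index sets. -/
theorem outWeight_eq_circuit (S : Channel (Wire n p l e m)) (w : ℕ) {a : ℕ}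
    (c : List (Gate (Wire n p l e m ⊕ Fin a))) (hc : ∀ ρ, S.apply ρ = circuitChannel c ρ)
    (φ : Bits (Wire n p l e m) → ℂ) (s : Bits (Wire n p l e m)) :
    outWeight S w φ s = ∑ z, ‖(hadamardOn (measuredWires w) *ᵥ
      fun t => ∑ u, circuitOp c (cat t z) (cat u (zeros _)) * φ u) s‖ ^ 2 := by
  have h := sum_normSq_mulVec (hadamardOn (measuredWires w)) (fun τ => S.op τ *ᵥ φ) s
  have h' := sum_normSq_mulVec (hadamardOn (measuredWires w))
    (fun z t => ∑ u, circuitOp c (cat t z) (cat u (zeros _)) * φ u) s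
  have h2 : ((outWeight S w φ s : ℝ) : ℂ) = ((∑ z, ‖(hadamardOn (measuredWires w) *ᵥ
      fun t => ∑ u, circuitOp c (cat t z) (cat u (zeros _)) * φ u) s‖ ^ 2 : ℝ) : ℂ) := by
    rw [outWeight, h, h']
    refine Finset.sum_congr rfl fun t _ => Finset.sum_congr rfl fun t' _ => ?_
    rw [← Channel.apply_pure, ← circuitChannel_pure, hc]
  exact_mod_cast h2

open Classical in
/-- The restriction of the vector `ψ` to the basis states in `Pr`. -/
def restrictTo {W : Type} (Pr : Bits W → Prop) (ψ : Bits W → ℂ) : Bits W → ℂ :=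
  fun s => if Pr s then ψ s else 0

/-- The state before the attack, restricted to the basis states in `Pr` before `U_J` is applied. -/
def prepState (hp : p' ≤ p) (U₀ : Matrix (Bits (Wire n p' l e m)) (Bits (Wire n p' l e m)) ℂ)
    (UJ : Matrix (Bits (Fin p)) (Bits (Fin p)) ℂ) (k : Fin n → Bits (Fin m))
    (Pr : Bits (Wire n p' l e m) → Prop) : Bits (Wire n p l e m) → ℂ :=
  onPreimages UJ *ᵥ appendZeros hp (restrictTo Pr fun s => U₀ s (Wire.init k))

/-- The eigenvalue of `Z ^ σ` on committed qubit `j` and `Z ^ d` on preimage register `j`. -/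
def phaseAt {w : ℕ} (hw : w ≤ p) (j : Fin n) (d : Bits (Fin w)) (σ : Bool)
    (s : Bits (Wire n p l e m)) : ℂ :=
  sgn (σ && s (.committed j)) * ∏ q, sgn (d q && s (.preimage j (Fin.castLE hw q)))

end Master

section Master

variable {n p p' l e m : ℕ}

theorem mulVec_const_mul {W : Type} [Fintype W] [DecidableEq W] (M : Matrix (Bits W) (Bits W) ℂ)
    (a : ℂ) (φ : Bits W → ℂ) (s : Bits W) : (M *ᵥ fun t => a * φ t) s = a * (M *ᵥ φ) s := by
  exact congrFun (Matrix.mulVec_smul M a φ) s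

open Classical in
theorem appendZeros_restrict {O : Type} (hp : p' ≤ p) (ψ : Bits (Wire n p' l e m) → ℂ)
    (src : O → Wire n p' l e m) (c : Bits O) (s : Bits (Wire n p l e m)) :
    appendZeros hp (restrictTo (fun s' => s' ∘ src = c) ψ) s =
      if ∀ o, s (Wire.grow hp (src o)) = c o then appendZeros hp ψ s else 0 := by
  have h : (Wire.shrink hp s) ∘ src = c ↔ ∀ o, s (Wire.grow hp (src o)) = c o := by
    rw [Wire.shrink_eq, funext_iff]
    rfl
  simp only [appendZeros, restrictTo, h]
  split_ifs <;> rfl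

/-- The prover's part of a Hadamard round, with key `i = j` as an input, where the wires `src` are
measured before `U_J` is applied, and additional phases are introduced after that. -/
theorem sim_attack {w a : ℕ} {O : Type} [Fintype O] [DecidableEq O] (hp : p' ≤ p) (hw : w ≤ p)
    (S : Channel (Wire n p l e m)) (cU : List (Gate (Wire n p' l e m))) (cJ : List (Gate (Fin p)))
    (cS : List (Gate (Wire n p l e m ⊕ Fin a))) (hcS : ∀ ρ, S.apply ρ = circuitChannel cS ρ)
    (src : O → Wire n p' l e m) (k : Fin n → Bits (Fin m)) (j : Fin n) :
    Sim (2 * Fintype.card (Wire n p l e m) + a + 2 * Fintype.card O + 2 * w + 2 + cU.length +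
        n * cJ.length + cS.length)
      fun (x : Bits (Fin m ⊕ (Fin w ⊕ Unit))) (o : Bits (O ⊕ Wire n p l e m)) =>
        outWeight S w (fun s => phaseAt hw j (x ∘ Sum.inr ∘ Sum.inl) (x (Sum.inr (Sum.inr ()))) s *
          prepState hp (circuitOp cU) (circuitOp cJ) (Function.update k j (x ∘ Sum.inl))
            (fun s' => s' ∘ src = o ∘ Sum.inl) s) (o ∘ Sum.inr) := by
  classical
  obtain ⟨cP, hcP, hcP'⟩ := exists_onPreimages_circuit (n := n) (l := l) (e := e) (m := m) cJ
  obtain ⟨cH, hcH, hcH'⟩ :=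
    exists_hadamardOn_circuit (measuredWires w : Set (Wire n p l e m))
  -- The measurement before `U_J` is deferred: the wires are copied to `O`, which no later gate
  -- touches.
  let srcV : O → Option (Wire n p l e m ⊕ Fin a) := fun o => some (Sum.inl (Wire.grow hp (src o)))
  -- The index `none` pairs `σ` with the committed qubit, and `some q` pairs bit `q` of `d` with
  -- wire `q` of preimage register `j`; their controlled phases multiply to `phaseAt`.
  let pa : Option (Fin w) → (Wire n p l e m ⊕ Fin a) ⊕ (O ⊕ (Fin w ⊕ Unit)) := fun q => q.elim (.inr (.inr (.inr ()))) fun q =>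
    .inr (.inr (.inl q))
  let pb : Option (Fin w) → (Wire n p l e m ⊕ Fin a) ⊕ (O ⊕ (Fin w ⊕ Unit)) := fun q => q.elim (.inl (.inl (.committed j))) fun q =>
    .inl (.inl (.preimage j (Fin.castLE hw q)))
  have hpab : ∀ q, pa q ≠ pb q := by rintro (_ | _) <;> exact Sum.inr_ne_inl
  let c1 : List (Gate ((Wire n p l e m ⊕ Fin a) ⊕ (O ⊕ (Fin w ⊕ Unit)))) :=
     cU.map (Gate.map (((Wire.grow hp).trans Function.Embedding.inl).trans Function.Embedding.inl))
  let c2 : List (Gate ((Wire n p l e m ⊕ Fin a) ⊕ (O ⊕ (Fin w ⊕ Unit)))) :=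
    copyLayer srcV (Function.Embedding.inl : O ↪ (O ⊕ (Fin w ⊕ Unit))) Finset.univ.toList
  let c3 : List (Gate ((Wire n p l e m ⊕ Fin a) ⊕ (O ⊕ (Fin w ⊕ Unit)))) :=
     cP.map (Gate.map (Function.Embedding.inl.trans Function.Embedding.inl))
  let c4 : List (Gate ((Wire n p l e m ⊕ Fin a) ⊕ (O ⊕ (Fin w ⊕ Unit)))) :=
     phaseLayer pa pb hpab Finset.univ.toList
  let c5 : List (Gate ((Wire n p l e m ⊕ Fin a) ⊕ (O ⊕ (Fin w ⊕ Unit)))) :=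
     cS.map (Gate.map Function.Embedding.inl)
  let c6 : List (Gate ((Wire n p l e m ⊕ Fin a) ⊕ (O ⊕ (Fin w ⊕ Unit)))) :=
     cH.map (Gate.map (Function.Embedding.inl.trans Function.Embedding.inl))
  let A : Exp (Fin m ⊕ (Fin w ⊕ Unit)) (O ⊕ Wire n p l e m) :=
    { W := (Wire n p l e m ⊕ Fin a) ⊕ (O ⊕ (Fin w ⊕ Unit))
      inp := ⟨Sum.elim (fun q => .inl (.inl (.key j q))) fun r => .inr (.inr r), by
        rintro (_ | _) (_ | _) h <;> cases h <;> rfl⟩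
      base := cat (cat (Wire.init k) (zeros _)) (zeros _)
      circ := c1 ++ (c2 ++ (c3 ++ (c4 ++ (c5 ++ c6))))
      out := Sum.elim (fun o => .inr (.inl o)) fun q => .inl (.inl q) }
  refine ⟨A, ?_, ?_⟩
  · have h2 := copyLayer_length srcV (Function.Embedding.inl : O ↪ (O ⊕ (Fin w ⊕ Unit))) Finset.univ.toList
    rw [Finset.length_toList, Finset.card_univ] at h2
    simp only [Exp.size, A, c1, c3, c4, c5, c6, phaseLayer, List.length_append,
      List.length_map, Finset.length_toList, Finset.card_univ, Fintype.card_sum, Fintype.card_fin,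
      Fintype.card_unit, Fintype.card_option]
    simp only [c2]
    rw [hcP]
    omega
  funext x o
  set d : Bits (Fin w) := x ∘ Sum.inr ∘ Sum.inl with hd
  set σ : Bool := x (Sum.inr (Sum.inr ())) with hσ
  set k' := Function.update k j (x ∘ Sum.inl) with hk'
  have hstart : A.start x = cat (cat (Wire.init k') (zeros _)) (cat (zeros O) (x ∘ Sum.inr)) := by
    funext q
    rcases q with (b | z) | (c | r)
    · by_cases h : ∃ q, b = .key j q
      · obtain ⟨q, rfl⟩ := h
        refine (A.inp.injective.extend_apply _ _ (Sum.inl q)).trans ?_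
        simp [cat, Wire.init, hk']
      · refine (Function.extend_apply' _ _ _ ?_).trans ?_
        · rintro ⟨i | i, hi⟩
          · exact h ⟨i, (Sum.inl_injective (Sum.inl_injective hi)).symm⟩
          · exact Sum.inr_ne_inl hi
        · change Wire.init k b = Wire.init k' b
          cases b with
          | key i q =>
            have : i ≠ j := fun hij => h ⟨q, by rw [hij]⟩
            simp [Wire.init, hk', this]
          | _ => rfl
    · refine (Function.extend_apply' _ _ _ ?_).trans rfl
      rintro ⟨i | i, hi⟩
      · exact Sum.inl_ne_inr (Sum.inl_injective hi)
      · exact Sum.inr_ne_inl hi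
    · refine (Function.extend_apply' _ _ _ ?_).trans rfl
      rintro ⟨i | i, hi⟩
      · exact Sum.inl_ne_inr hi
      · exact Sum.inr_ne_inl (Sum.inr_injective hi)
    · exact A.inp.injective.extend_apply _ _ (Sum.inr r)
  -- The vectors `χ0` to `χ6` are the states between the layers. The control wires `r` keep their
  -- classical value throughout, the attack's auxiliary wires are zero until `c5`, and from `c2` on
  -- the register `O` labels the branch of the deferred measurement.
  let ind : Bits (Fin w ⊕ Unit) → ℂ := fun r => if r = x ∘ Sum.inr then 1 else 0
  let indz : Bits (Fin a) → ℂ := fun z => if z = zeros _ then 1 else 0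
  let χ0 : Bits ((Wire n p l e m ⊕ Fin a) ⊕ (O ⊕ (Fin w ⊕ Unit))) → ℂ := Pi.single (A.start x) 1
  let χ1 := circuitOp c1 *ᵥ χ0
  let χ2 := circuitOp c2 *ᵥ χ1
  let χ3 := circuitOp c3 *ᵥ χ2
  let χ4 := circuitOp c4 *ᵥ χ3
  let χ5 := circuitOp c5 *ᵥ χ4
  let χ6 := circuitOp c6 *ᵥ χ5
  let α : Bits (Wire n p l e m) → ℂ := appendZeros hp fun s => circuitOp cU s (Wire.init k')
  let pre : Bits O → Bits (Wire n p l e m) → ℂ := fun c =>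
    prepState hp (circuitOp cU) (circuitOp cJ) k' (fun s' => s' ∘ src = c)
  have h1 : ∀ s z c r, χ1 (cat (cat s z) (cat c r)) =
      (ind r * indz z * if c = zeros _ then 1 else 0) * α s := by
    intro s z c r
    simp only [χ1, c1, circuitOp_map, ← lift_trans, lift_inl_mulVec]
    have : (fun s' => χ0 (cat (cat s' z) (cat c r))) = fun s' =>
        (ind r * indz z * if c = zeros _ then 1 else 0) *
          (Pi.single (Wire.init k') 1 : Bits (Wire n p l e m) → ℂ) s' := by
      funext s'
      simp only [χ0, hstart, Pi.single_apply, cat_inj, ind, indz]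
      by_cases e1 : s' = Wire.init k' <;> by_cases e2 : z = zeros _ <;>
        by_cases e3 : c = zeros _ <;> by_cases e4 : r = x ∘ Sum.inr <;> simp [e1, e2, e3, e4]
    rw [this, mulVec_const_mul, Matrix.mulVec_single_one, Matrix.col_apply, lift_grow_init]
  have h2 : ∀ s z c r, χ2 (cat (cat s z) (cat c r)) = (ind r * indz z) *
      appendZeros hp (restrictTo (fun s' => s' ∘ src = c)
        fun s' => circuitOp cU s' (Wire.init k')) s := by
    intro s z c r
    simp only [χ2, c2, copyLayer_mulVec]
    have : (Function.extend (Function.Embedding.inl : O ↪ (O ⊕ (Fin w ⊕ Unit)))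
        (fun o => bitAt (cat s z) (srcV o) ^^ cat c r (Function.Embedding.inl o)) (cat c r)) =
        cat (fun o => s (Wire.grow hp (src o)) ^^ c o) r := by
      funext q
      cases q with
      | inl o => exact (Function.Embedding.inl : O ↪ (O ⊕ (Fin w ⊕ Unit))).injective.extend_apply _ _ o
      | inr r => exact Function.extend_apply' _ _ _ (by simp)
    rw [this, h1, appendZeros_restrict]
    have e0 : ((fun o => s (Wire.grow hp (src o)) ^^ c o) = zeros O) ↔
        ∀ o, s (Wire.grow hp (src o)) = c o := by
      rw [funext_iff]
      simp [zeros]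
    simp only [e0]
    split_ifs <;> simp [α]
  have h3 : ∀ s z c r, χ3 (cat (cat s z) (cat c r)) = (ind r * indz z) * pre c s := by
    intro s z c r
    simp only [χ3, c3, circuitOp_map, ← lift_trans, lift_inl_mulVec]
    simp only [h2]
    rw [mulVec_const_mul, hcP']
    rfl
  have h4 : ∀ s z c r, χ4 (cat (cat s z) (cat c r)) =
      (ind r * indz z) * (phaseAt hw j d σ s * pre c s) := by
    intro s z c r
    simp only [χ4, c4, phaseLayer_mulVec, h3]
    rw [Fintype.prod_option]
    by_cases hr : r = x ∘ Sum.inr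
    · subst hr
      have : sgn (cat (cat s z) (cat c (x ∘ Sum.inr)) (pa none) &&
          cat (cat s z) (cat c (x ∘ Sum.inr)) (pb none)) * ∏ i : Fin w,
          sgn (cat (cat s z) (cat c (x ∘ Sum.inr)) (pa (some i)) &&
            cat (cat s z) (cat c (x ∘ Sum.inr)) (pb (some i))) = phaseAt hw j d σ s := rfl
      rw [this]
      ring
    · simp [ind, hr]
  have h5 : ∀ s z c r, χ5 (cat (cat s z) (cat c r)) =
      ind r * ∑ t, circuitOp cS (cat s z) (cat t (zeros _)) * (phaseAt hw j d σ t * pre c t) := by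
    intro s z c r
    simp only [χ5, c5, circuitOp_map, lift_inl_mulVec]
    rw [Matrix.mulVec, dotProduct]
    rw [sum_cat]
    simp only [h4, Finset.mul_sum]
    refine Finset.sum_congr rfl fun t _ => ?_
    rw [Fintype.sum_eq_single (zeros (Fin a)) fun z hz => by simp [indz, hz]]
    simp [indz]
    ring
  have h6 : ∀ s z c r, χ6 (cat (cat s z) (cat c r)) =
      ind r * (hadamardOn (measuredWires w) *ᵥ fun s => ∑ t, circuitOp cS (cat s z)
        (cat t (zeros _)) * (phaseAt hw j d σ t * pre c t)) s := by
    intro s z c r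
    simp only [χ6, c6, circuitOp_map, ← lift_trans, lift_inl_mulVec]
    simp only [h5]
    rw [mulVec_const_mul, hcH']
  have hamp : ∀ s, circuitOp A.circ s (A.start x) = χ6 s := by
    intro s
    have e1 : circuitOp A.circ s (A.start x) =
        (circuitOp A.circ *ᵥ Pi.single (A.start x) 1) s := by
      rw [Matrix.mulVec_single_one]; rfl
    rw [e1]
    simp only [A, circuitOp_append, ← Matrix.mulVec_mulVec]
    rfl
  rw [outWeight_eq_circuit S w cS hcS, Exp.prob]
  simp only [hamp]
  have hs : ∀ φ : Bits ((Wire n p l e m ⊕ Fin a) ⊕ (O ⊕ (Fin w ⊕ Unit))) → ℝ,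
      ∑ s, φ s = ∑ s, ∑ z, ∑ c, ∑ r, φ (cat (cat s z) (cat c r)) := by
    intro φ
    rw [sum_cat, sum_cat]
    refine Finset.sum_congr rfl fun s _ => Finset.sum_congr rfl fun z _ => ?_
    exact sum_cat _
  refine (hs _).trans ?_
  have hout : ∀ s z c r, ((cat (cat s z) (cat c r) : Bits ((Wire n p l e m ⊕ Fin a) ⊕ (O ⊕ (Fin w ⊕ Unit)))) ∘ A.out = o) ↔
      s = o ∘ Sum.inr ∧ c = o ∘ Sum.inl := by
    intro s z c r
    constructor
    · rintro rfl
      exact ⟨rfl, rfl⟩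
    · rintro ⟨rfl, rfl⟩
      funext q
      cases q <;> rfl
  rw [Fintype.sum_eq_single (o ∘ Sum.inr) fun s hs => Finset.sum_eq_zero fun z _ =>
    Finset.sum_eq_zero fun c _ => Finset.sum_eq_zero fun r _ =>
      if_neg fun h => hs ((hout s z c r).1 h).1]
  refine Finset.sum_congr rfl fun z _ => ?_
  rw [Fintype.sum_eq_single (o ∘ Sum.inl) fun c hc => Finset.sum_eq_zero fun r _ =>
      if_neg fun h => hc ((hout _ z c r).1 h).2]
  rw [Fintype.sum_eq_single (x ∘ Sum.inr) fun r hr => by simp [h6, ind, hr]]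
  refine (if_pos ((hout _ _ _ _).2 ⟨rfl, rfl⟩)).trans ?_
  rw [h6]
  simp [ind]
  rfl

end Master

/-! ## Pauli operators and the Hadamard transform -/

section Flip

variable {W : Type} [Fintype W] [DecidableEq W]

/-- Negation of the bit `a`. -/
def flipAt (a : W) : Equiv.Perm (Bits W) :=
  Function.Involutive.toPerm (fun s => Function.update s a (!s a)) (fun s => by simp)

theorem flipAt_apply (a : W) (s : Bits W) : flipAt a s = Function.update s a (!s a) := rfl

theorem flipAt_self (a : W) (s : Bits W) : flipAt a s a = !s a := by simp [flipAt_apply]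

theorem flipAt_of_ne {a q : W} (h : q ≠ a) (s : Bits W) : flipAt a s q = s q := by
  simp [flipAt_apply, h]

theorem flipAt_flipAt (a : W) (s : Bits W) : flipAt a (flipAt a s) = s := by
  simp [flipAt_apply]

/-- The vector `Z φ`, with `Z` acting on qubit `a`. -/
def zAt (a : W) (φ : Bits W → ℂ) : Bits W → ℂ := fun s => sgn (s a) * φ s

theorem hadamardOn_symm (Q : Set W) (s s' : Bits W) : hadamardOn Q s s' = hadamardOn Q s' s := by
  classical
  rw [hadamardOn, hadamardOn]
  refine ite_congr_prop_of ⟨fun h q hq => (h q hq).symm, fun h q hq => (h q hq).symm⟩ ?_ rfl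
  refine Finset.prod_congr rfl fun q _ => ?_
  rw [Bool.and_comm]

theorem hadamardOn_flip {Q : Set W} {a : W} (ha : a ∈ Q) (s s' : Bits W) :
    hadamardOn Q (flipAt a s) s' = sgn (s' a) * hadamardOn Q s s' := by
  classical
  rw [hadamardOn, hadamardOn, mul_ite, mul_zero]
  refine ite_congr_prop_of (forall_congr' fun q => ?_) ?_ rfl
  · refine imp_congr_right fun hq => ?_
    rw [flipAt_of_ne fun h : q = a => hq (h ▸ ha)]
  · rw [← Finset.mul_prod_erase _ _ (Finset.mem_univ a),
      ← Finset.mul_prod_erase Finset.univ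
        (fun q => if q ∈ Q then (if s q && s' q then (-1 : ℂ) else 1) / ((√2 : ℝ) : ℂ) else 1)
        (Finset.mem_univ a), if_pos ha, if_pos ha, flipAt_self, ← mul_assoc]
    congr 1
    · cases s a <;> cases s' a <;> simp [sgn, neg_div]
    · refine Finset.prod_congr rfl fun q hq => ?_
      rw [flipAt_of_ne (Finset.ne_of_mem_erase hq)]

/-- The relation `H Z = X H`: a phase before the measurement is a flip of its outcome. -/
theorem hadamardOn_zAt {Q : Set W} {a : W} (ha : a ∈ Q) (φ : Bits W → ℂ) (s : Bits W) :
    (hadamardOn Q *ᵥ zAt a φ) (flipAt a s) = (hadamardOn Q *ᵥ φ) s := by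
  rw [Matrix.mulVec, Matrix.mulVec, dotProduct, dotProduct]
  refine Finset.sum_congr rfl fun s' _ => ?_
  rw [hadamardOn_flip ha, zAt]
  linear_combination (hadamardOn Q s s' * φ s') * sgn_mul_self (s' a)

/-- The relation `H X = Z H`: a flip before the measurement contributes only a sign, which outcome
probabilities do not see. -/
theorem hadamardOn_comp_flip {Q : Set W} {a : W} (ha : a ∈ Q) (φ : Bits W → ℂ) (s : Bits W) :
    (hadamardOn Q *ᵥ fun s' => φ (flipAt a s')) s = sgn (s a) * (hadamardOn Q *ᵥ φ) s := by
  rw [Matrix.mulVec, Matrix.mulVec, dotProduct, dotProduct, Finset.mul_sum,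
    ← Equiv.sum_comp (flipAt a)]
  refine Finset.sum_congr rfl fun s' _ => ?_
  rw [flipAt_flipAt, hadamardOn_symm, hadamardOn_flip ha, hadamardOn_symm, mul_assoc]

theorem tensorAt_pauliZ_mulVec (a : W) (φ : Bits W → ℂ) : tensorAt a pauliZ 1 *ᵥ φ = zAt a φ := by
  have h : tensorAt a pauliZ 1 = Matrix.diagonal fun s : Bits W => sgn (s a) := by
    ext s s'
    rw [tensorAt, Matrix.diagonal_apply, Matrix.one_apply]
    by_cases h : s = s'
    · subst h; simp [pauliZ, sgn]
    · rw [if_neg h]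
      by_cases h1 : s a = s' a
      · rw [if_neg, mul_zero]
        intro h2
        apply h
        funext q
        by_cases hq : q = a
        · rw [hq, h1]
        · exact congrFun h2 ⟨q, hq⟩
      · rw [pauliZ, if_neg h1, zero_mul]
  rw [h]
  funext s
  rw [Matrix.mulVec_diagonal]
  rfl

theorem tensorAt_pauliX_mulVec (a : W) (φ : Bits W → ℂ) :
    tensorAt a pauliX 1 *ᵥ φ = fun s => φ (flipAt a s) := by
  funext s
  rw [Matrix.mulVec, dotProduct, Fintype.sum_eq_single (flipAt a s)]
  · rw [tensorAt, pauliX, flipAt_self, if_neg (by cases s a <;> simp), one_mul, Matrix.one_apply,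
      if_pos, one_mul]
    funext q
    exact (flipAt_of_ne q.2 s).symm
  · intro s' hs'
    rw [tensorAt, Matrix.one_apply]
    by_cases h1 : s a = s' a
    · rw [pauliX, if_pos h1, zero_mul, zero_mul]
    · rw [if_neg, mul_zero, zero_mul]
      intro h2
      apply hs'
      funext q
      by_cases hq : q = a
      · rw [hq, flipAt_self]
        cases h3 : s a <;> cases h4 : s' a <;> simp_all
      · rw [flipAt_of_ne hq]
        exact (congrFun h2 ⟨q, hq⟩).symm

/-- Split `B = b₀ + X b₁` with `b₀`, `b₁` commuting with `Z`. After the Hadamard transform, `B φ`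
has the amplitude `α₀ ± α₁` at `s`, where `αₓ` comes from `bₓ φ`; moving `Z` through `B` reverses
the relative sign, and `H Z = X H` accounts for the flipped outcome. The parallelogram law then
removes the interference of `α₀` and `α₁`. -/
theorem xTrivial_hadamard {Q : Set W} {a : W} (ha : a ∈ Q) {B : Matrix (Bits W) (Bits W) ℂ}
    {C : Fin 2 → Fin 2 → Matrix (Bits {q : W // q ≠ a}) (Bits {q : W // q ≠ a}) ℂ}
    (hC : B = ∑ x : Fin 2, ∑ z : Fin 2, tensorAt a (pauliX ^ (x : ℕ) * pauliZ ^ (z : ℕ)) (C x z))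
    (φ : Bits W → ℂ) (s : Bits W) :
    ∑ x : Fin 2, ‖(hadamardOn Q *ᵥ
        ((∑ z : Fin 2, tensorAt a (pauliZ ^ (z : ℕ)) (C x z)) *ᵥ φ)) s‖ ^ 2 =
      (1 / 2) * (‖(hadamardOn Q *ᵥ (B *ᵥ φ)) s‖ ^ 2 +
        ‖(hadamardOn Q *ᵥ (B *ᵥ zAt a φ)) (flipAt a s)‖ ^ 2) := by
  have hZX : tensorAt a pauliZ 1 * tensorAt a pauliX 1 =
      -(tensorAt a pauliX 1 * tensorAt a pauliZ 1 : Matrix (Bits W) (Bits W) ℂ) := by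
    rw [tensorAt_mul, tensorAt_mul, pauliZ_mul_pauliX, tensorAt_neg]
  set Z : Matrix (Bits W) (Bits W) ℂ := tensorAt a pauliZ 1 with hZ
  set X : Matrix (Bits W) (Bits W) ℂ := tensorAt a pauliX 1 with hX
  set b : Fin 2 → Matrix (Bits W) (Bits W) ℂ :=
    fun x => ∑ z : Fin 2, tensorAt a (pauliZ ^ (z : ℕ)) (C x z) with hb
  have hcomm : ∀ x, Z * b x = b x * Z := by
    intro x
    simp only [hb, hZ, Fin.sum_univ_two, mul_add, add_mul, tensorAt_mul, one_mul, mul_one]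
    simp
  have hB : B = b 0 + X * b 1 := by
    rw [hC]
    simp only [hb, hX, Fin.sum_univ_two, mul_add, tensorAt_mul, one_mul]
    simp
  -- `Z` commutes with `b 0` and `b 1` and anticommutes with `X`.
  have hBZ : B * Z = Z * (b 0 - X * b 1) := by
    rw [hB, add_mul, mul_sub, hcomm 0, ← mul_assoc Z X, hZX, mul_assoc, ← hcomm 1]
    simp [mul_assoc]
  have e1 : (hadamardOn Q *ᵥ (B *ᵥ φ)) s = (hadamardOn Q *ᵥ (b 0 *ᵥ φ)) s +
      sgn (s a) * (hadamardOn Q *ᵥ (b 1 *ᵥ φ)) s := by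
    rw [hB, Matrix.add_mulVec, Matrix.mulVec_add, Pi.add_apply, ← Matrix.mulVec_mulVec, hX,
      tensorAt_pauliX_mulVec, hadamardOn_comp_flip ha]
  have e2 : (hadamardOn Q *ᵥ (B *ᵥ zAt a φ)) (flipAt a s) = (hadamardOn Q *ᵥ (b 0 *ᵥ φ)) s -
      sgn (s a) * (hadamardOn Q *ᵥ (b 1 *ᵥ φ)) s := by
    rw [← tensorAt_pauliZ_mulVec, Matrix.mulVec_mulVec φ B, ← hZ, hBZ, ← Matrix.mulVec_mulVec, hZ,
      tensorAt_pauliZ_mulVec, hadamardOn_zAt ha, Matrix.sub_mulVec, Matrix.mulVec_sub,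
      Pi.sub_apply, ← Matrix.mulVec_mulVec, hX, tensorAt_pauliX_mulVec, hadamardOn_comp_flip ha]
  rw [e1, e2, Fin.sum_univ_two]
  have h := parallelogram_law_with_norm ℝ ((hadamardOn Q *ᵥ (b 0 *ᵥ φ)) s)
    (sgn (s a) * (hadamardOn Q *ᵥ (b 1 *ᵥ φ)) s)
  rw [norm_mul (sgn _), norm_sgn, one_mul] at h
  linarith

end Flip

section OutWeight

variable {n p l e m : ℕ} (S : Channel (Wire n p l e m)) (w : ℕ)

/-- The identity for single Kraus operators, summed over `τ`. It describes the `X`-trivial attack by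
runs of `S` alone, so the new channel never has to be implemented. -/
theorem outWeight_xTrivial (j : Fin n)
    (C : S.ι → Fin 2 → Fin 2 → Matrix (Bits {q : Wire n p l e m // q ≠ .committed j})
      (Bits {q : Wire n p l e m // q ≠ .committed j}) ℂ)
    (hC : ∀ τ, S.op τ = ∑ x : Fin 2, ∑ z : Fin 2,
      tensorAt (.committed j) (pauliX ^ (x : ℕ) * pauliZ ^ (z : ℕ)) (C τ x z))
    (φ : Bits (Wire n p l e m) → ℂ) (s : Bits (Wire n p l e m)) :
    outWeight (S.xTrivial (.committed j) C hC) w φ s =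
      (1 / 2) * (outWeight S w φ s +
        outWeight S w (zAt (.committed j) φ) (flipAt (.committed j) s)) := by
  have ha : (.committed j : Wire n p l e m) ∈ measuredWires (n := n) (p := p) (l := l) (e := e)
      (m := m) w := Or.inl ⟨j, rfl⟩
  have h : outWeight (S.xTrivial (.committed j) C hC) w φ s =
      ∑ xτ : Fin 2 × S.ι, ‖(hadamardOn (measuredWires w) *ᵥ
        ((∑ z : Fin 2, tensorAt (.committed j) (pauliZ ^ (z : ℕ)) (C xτ.2 xτ.1 z)) *ᵥ φ)) s‖ ^ 2 :=
    rfl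
  rw [h, Fintype.sum_prod_type_right, outWeight, outWeight, ← Finset.sum_add_distrib,
    Finset.mul_sum]
  exact Finset.sum_congr rfl fun τ _ => xTrivial_hadamard ha (hC τ) φ s

/-- The parallelogram law: averaging over the relative sign of two branches removes their
interference, as a measurement that separates them would. -/
theorem outWeight_add_sub (φ ψ : Bits (Wire n p l e m) → ℂ) (s : Bits (Wire n p l e m)) :
    outWeight S w (φ + ψ) s + outWeight S w (φ - ψ) s =
      2 * (outWeight S w φ s + outWeight S w ψ s) := by
  simp only [outWeight]
  rw [← Finset.sum_add_distrib, ← Finset.sum_add_distrib, Finset.mul_sum]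
  refine Finset.sum_congr rfl fun τ _ => ?_
  have h := parallelogram_law_with_norm ℝ ((hadamardOn (measuredWires w) *ᵥ (S.op τ *ᵥ φ)) s)
    ((hadamardOn (measuredWires w) *ᵥ (S.op τ *ᵥ ψ)) s)
  simp only [Matrix.mulVec_add, Matrix.mulVec_sub, Pi.add_apply, Pi.sub_apply]
  linarith

theorem outWeight_const_mul {c : ℂ} (hc : ‖c‖ = 1) (φ : Bits (Wire n p l e m) → ℂ)
    (s : Bits (Wire n p l e m)) :
    outWeight S w (fun t => c * φ t) s = outWeight S w φ s := by
  refine Finset.sum_congr rfl fun τ _ => ?_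
  have : (S.op τ *ᵥ fun t => c * φ t) = fun t => c * (S.op τ *ᵥ φ) t := by
    funext t
    exact mulVec_const_mul _ _ _ _
  rw [this, mulVec_const_mul, norm_mul, hc, one_mul]

theorem outWeight_zero (s : Bits (Wire n p l e m)) : outWeight S w 0 s = 0 := by
  simp [outWeight]

end OutWeight

/-! ## Products of independent choices -/

section Independent

variable {n : ℕ} {α : Type} [Fintype α] [DecidableEq α]

theorem sum_prod_eq_prod_sum (g : Fin n → α → ℝ) : ∑ f : Fin n → α, ∏ i, g i (f i) =
    ∏ i, ∑ a, g i a := by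
  rw [Finset.prod_univ_sum, Fintype.piFinset_univ]

/-- Independent choices may be made again at position `j`. -/
theorem sum_resample (g : Fin n → α → ℝ) (j : Fin n) (hg : ∑ a, g j a = 1)
    (Y : (Fin n → α) → ℝ) :
    ∑ f : Fin n → α, (∏ i, g i (f i)) * Y f =
      ∑ f : Fin n → α, (∏ i, g i (f i)) * ∑ a, g j a * Y (Function.update f j a) := by
  -- Exchanging the entry at `j` with a fresh one preserves the product weight of the sequence
  -- together with its additional entry.
  let sw : Equiv.Perm ((Fin n → α) × α) :=
    Function.Involutive.toPerm (fun q => (Function.update q.1 j q.2, q.1 j)) (fun q => by simp)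
  have h1 : ∑ f : Fin n → α, (∏ i, g i (f i)) * Y f =
      ∑ q : (Fin n → α) × α, (∏ i, g i (q.1 i)) * (g j q.2 * Y q.1) := by
    rw [Fintype.sum_prod_type]
    refine Finset.sum_congr rfl fun f _ => ?_
    simp only
    rw [← Finset.mul_sum, ← Finset.sum_mul, hg, one_mul]
  rw [h1, ← Equiv.sum_comp sw, Fintype.sum_prod_type]
  refine Finset.sum_congr rfl fun f _ => ?_
  rw [Finset.mul_sum]
  refine Finset.sum_congr rfl fun a _ => ?_
  change (∏ i, g i (Function.update f j a i)) * (g j (f j) * Y (Function.update f j a)) = _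
  rw [← Finset.mul_prod_erase _ _ (Finset.mem_univ j),
    ← Finset.mul_prod_erase Finset.univ (fun i => g i (f i)) (Finset.mem_univ j),
    Function.update_self, Finset.prod_congr rfl fun i hi => by
      rw [Function.update_of_ne (Finset.ne_of_mem_erase hi)]]
  ring

/-- Distributions of bits that arise from fair coins, except at position `j`. -/
theorem sum_prod_coins (j : Fin n) (g : Fin n → Bool → ℝ) (v : Fin n → Bool → Bool)
    (hg : ∀ i ≠ j, ∀ b, g i b = (1 / 2) * ∑ r, if b = v i r then 1 else 0)
    (A : Bits (Fin n) → ℝ) :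
    ∑ m : Bits (Fin n), A m * ∏ i, g i (m i) = (1 / 2) ^ n * ∑ r : Bits (Fin n), ∑ c,
      g j c * A (Function.update (fun i => v i (r i)) j c) := by
  -- Position `j` gets a coin that is ignored, so that all positions are uniform and the
  -- normalisation is `(1 / 2) ^ n`.
  let θ : Fin n → Bool → Bool → ℝ := fun i b r =>
    if i = j then g j b else if b = v i r then 1 else 0
  have h1 : ∀ i b, g i b = (1 / 2) * ∑ r, θ i b r := by
    intro i b
    by_cases hi : i = j
    · subst hi; simp [θ]
    · simp only [θ, if_neg hi]; exact hg i hi b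
  have h2 : ∀ m : Bits (Fin n), ∏ i, g i (m i) =
      (1 / 2) ^ n * ∑ r : Bits (Fin n), ∏ i, θ i (m i) (r i) := by
    intro m
    rw [sum_prod_eq_prod_sum (fun i => θ i (m i)), Finset.prod_congr rfl fun i _ => h1 i (m i),
      Finset.prod_mul_distrib]
    simp
  simp only [h2]
  have h3 : ∀ m : Bits (Fin n), A m * ((1 / 2) ^ n * ∑ r : Bits (Fin n), ∏ i, θ i (m i) (r i)) =
      (1 / 2) ^ n * ∑ r : Bits (Fin n), A m * ∏ i, θ i (m i) (r i) := by
    intro m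
    rw [← Finset.mul_sum]
    ring
  simp only [h3]
  rw [← Finset.mul_sum, Finset.sum_comm]
  congr 1
  refine Finset.sum_congr rfl fun r _ => ?_
  have h4 : ∀ m : Bits (Fin n), A m * ∏ i, θ i (m i) (r i) =
      ∑ c, if Function.update (fun i => v i (r i)) j c = m then g j c * A m else 0 := by
    intro m
    by_cases hm : ∀ i, i ≠ j → m i = v i (r i)
    · have : ∏ i, θ i (m i) (r i) = g j (m j) := by
        rw [← Finset.mul_prod_erase _ _ (Finset.mem_univ j), Finset.prod_eq_one]
        · simp [θ]
        · intro i hi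
          have := Finset.ne_of_mem_erase hi
          simp [θ, this, hm i this]
      rw [this, Fintype.sum_eq_single (m j), if_pos, mul_comm]
      · funext i
        by_cases hi : i = j
        · subst hi; simp
        · simp [hi, hm i hi]
      · intro c hc
        rw [if_neg]
        intro h
        apply hc
        rw [← h]
        simp
    · push Not at hm
      obtain ⟨i, hi, hm⟩ := hm
      rw [Finset.prod_eq_zero (Finset.mem_univ i) (by simp [θ, hi, hm]), mul_zero]
      symm
      refine Finset.sum_eq_zero fun c _ => if_neg fun h => hm ?_
      rw [← h]
      simp [hi]
  simp only [h4]
  rw [Finset.sum_comm]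
  exact Finset.sum_congr rfl fun c _ => sum_ite_eq_self _ _

/-- An average is bounded by the value at some point of the support. -/
theorem exists_abs_sum_le {β : Type} [Fintype β] (g X : β → ℝ) (h0 : ∀ b, 0 ≤ g b)
    (h1 : ∑ b, g b = 1) : ∃ b, 0 < g b ∧ |∑ b, g b * X b| ≤ |X b| := by
  by_contra! h
  have h2 : ∀ b, g b * |X b| ≤ g b * |∑ b, g b * X b| := by
    intro b
    rcases (h0 b).eq_or_lt with hb | hb
    · rw [← hb, zero_mul, zero_mul]
    · exact mul_le_mul_of_nonneg_left (h b hb).le hb.le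
  have h3 : ∃ b, 0 < g b := by
    by_contra! h3
    have : ∑ b, g b ≤ 0 := Finset.sum_nonpos fun b _ => h3 b
    linarith
  obtain ⟨b, hb⟩ := h3
  have h4 : ∑ b, g b * |X b| < ∑ b, g b * |∑ b, g b * X b| :=
    Finset.sum_lt_sum (fun b _ => h2 b) ⟨b, Finset.mem_univ _, mul_lt_mul_of_pos_left (h b hb) hb⟩
  rw [← Finset.sum_mul, h1, one_mul] at h4
  have h5 : |∑ b, g b * X b| ≤ ∑ b, g b * |X b| := by
    refine (Finset.abs_sum_le_sum_abs _ _).trans_eq (Finset.sum_congr rfl fun b _ => ?_)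
    rw [abs_mul, abs_of_nonneg (h0 b)]
  linarith

end Independent

/-! ## The verifier's result -/

section Result

variable {P : Interface} {n : ℕ → ℕ} (F : ExtendedTCF P) (u : InjectionUnitary F.toNTCF)
  (V : Prover P n u.block) (κ : ℕ)

/-- In the Hadamard basis the stored bit is either the reported bit plus a term that does not depend
on it, or a fair coin. -/
theorem storeProb_not (k : Bits (Fin (P.lenK κ)))
    (t : Bits (Fin (P.lenT κ))) (y : Bits (Fin (P.lenY κ))) (b : Bool)
    (d : Bits (Fin (F.w κ))) (m : Bool) :
    storeProb F κ true k t y (!b) d m = storeProb F κ true k t y b d (!m) := by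
  rcases h1 : F.inv κ t false y with _ | x₀
  · simp [storeProb, h1]
  · rcases h2 : F.inv κ t true y with _ | x₁
    · simp [storeProb, h1, h2]
    · simp only [storeProb, h1, h2]
      cases b <;> cases m <;> simp

theorem storeProb_sum (h : Bool) (k : Bits (Fin (P.lenK κ)))
    (t : Bits (Fin (P.lenT κ))) (y : Bits (Fin (P.lenY κ))) (b : Bool)
    (d : Bits (Fin (F.w κ))) :
    storeProb F κ h k t y b d true + storeProb F κ h k t y b d false = 1 := by
  rw [storeProb_eq, storeProb_eq, Fintype.sum_bool, Fintype.sum_bool]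
  cases storeDet F κ h k t true y b d <;> cases storeDet F κ h k t false y b d <;> norm_num

/-- The qubits of the prover during the attack. -/
abbrev AttackWire : Type :=
  Wire (n κ) (u.block κ) (P.lenY κ) (V.e κ) (P.lenK κ)

/-- The state before the attack, restricted to the basis states in `Pr` before `U_J` is applied. -/
def attackState (k : Fin (n κ) → Bits (Fin (P.lenK κ)))
    (Pr : Bits (Wire (n κ) (P.lenX κ) (P.lenY κ) (V.e κ) (P.lenK κ)) → Prop) :
    Bits (AttackWire F u V κ) → ℂ :=
  prepState (u.lenX_le κ) (V.U₀ κ) (u.U κ) k Pr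

/-- The string reported for qubit `i`. -/
def reported (i : Fin (n κ)) (s : Bits (AttackWire F u V κ)) : Bits (Fin (F.w κ)) :=
  fun q => s (.preimage i (Fin.castLE (u.w_le κ) q))

theorem resultDist_eq (h : Fin (n κ) → Bool) (m : Bits (Fin (n κ))) :
    resultDist F u V κ h m = ∑ k, ∑ t, keyDist F κ h k t * ∑ y, ∑ s,
      outWeight (V.S κ) (F.w κ) (attackState F u V κ k fun s => Wire.com s = y) s *
        ∏ i, storeProb F κ (h i) (k i) (t i) (y i) (s (.committed i)) (reported F u V κ i s)
          (m i) := by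
  rw [resultDist]
  refine Finset.sum_congr rfl fun k _ => Finset.sum_congr rfl fun t _ => ?_
  congr 1
  refine Finset.sum_congr rfl fun y _ => ?_
  rw [Finset.sum_comm]
  refine Finset.sum_congr rfl fun s _ => ?_
  rw [outWeight, Finset.sum_mul]
  refine Finset.sum_congr rfl fun τ _ => ?_
  have : committedState V κ k y =
      restrictTo (fun s => Wire.com s = y) fun s => V.U₀ κ s (Wire.init k) := by
    funext s
    exact ite_congr_prop Iff.rfl _ _
  rw [finalState, this]
  rfl

/-- The verifier's results, for random bits `r`, where the result for qubit `j` is set to `c`. -/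
def results (h : Fin (n κ) → Bool) (j : Fin (n κ)) (k : Fin (n κ) → Bits (Fin (P.lenK κ)))
    (t : Fin (n κ) → Bits (Fin (P.lenT κ))) (r : Bits (Fin (n κ))) (c : Bool)
    (y : Fin (n κ) → Bits (Fin (P.lenY κ))) (s : Bits (AttackWire F u V κ)) : Bits (Fin (n κ)) :=
  Function.update (fun i => storeDet F κ (h i) (k i) (t i) (r i) (y i) (s (.committed i))
    (reported F u V κ i s)) j c

/-- Position `j` is overwritten by `c`, and the other positions do not read committed qubit `j`. -/
theorem results_flip (h : Fin (n κ) → Bool) (j : Fin (n κ))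
    (k : Fin (n κ) → Bits (Fin (P.lenK κ)))
    (t : Fin (n κ) → Bits (Fin (P.lenT κ))) (r : Bits (Fin (n κ))) (c : Bool)
    (y : Fin (n κ) → Bits (Fin (P.lenY κ))) (s : Bits (AttackWire F u V κ)) :
    results F u V κ h j k t r c y (flipAt (.committed j) s) =
      results F u V κ h j k t r c y s := by
  funext i
  by_cases hi : i = j
  · subst hi; simp [results]
  · have h1 : (.committed i : AttackWire F u V κ) ≠ .committed j := by simpa using hi
    have h2 : reported F u V κ i (flipAt (.committed j) s) = reported F u V κ i s := by
      funext q
      exact flipAt_of_ne (by simp) s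
    simp only [results, Function.update_of_ne hi, h2, flipAt_of_ne h1]

/-- The probability that the verifier stores `c` as the result for qubit `j`. -/
def storeAt (j : Fin (n κ)) (k : Fin (n κ) → Bits (Fin (P.lenK κ)))
    (t : Fin (n κ) → Bits (Fin (P.lenT κ))) (y : Fin (n κ) → Bits (Fin (P.lenY κ)))
    (s : Bits (AttackWire F u V κ)) (c : Bool) : ℝ :=
  storeProb F κ true (k j) (t j) (y j) (s (.committed j)) (reported F u V κ j s) c

theorem storeAt_flip (j : Fin (n κ)) (k : Fin (n κ) → Bits (Fin (P.lenK κ)))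
    (t : Fin (n κ) → Bits (Fin (P.lenT κ))) (y : Fin (n κ) → Bits (Fin (P.lenY κ)))
    (s : Bits (AttackWire F u V κ)) (c : Bool) :
    storeAt F u V κ j k t y (flipAt (.committed j) s) c = storeAt F u V κ j k t y s (!c) := by
  have h2 : reported F u V κ j (flipAt (.committed j) s) = reported F u V κ j s := by
    funext q
    exact flipAt_of_ne (by simp) s
  rw [storeAt, storeAt, flipAt_self, h2, storeProb_not]

theorem sum_results (h : Fin (n κ) → Bool) (j : Fin (n κ)) (hj : h j = true)
    (k : Fin (n κ) → Bits (Fin (P.lenK κ)))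
    (t : Fin (n κ) → Bits (Fin (P.lenT κ))) (y : Fin (n κ) → Bits (Fin (P.lenY κ)))
    (s : Bits (AttackWire F u V κ)) (A : Bits (Fin (n κ)) → ℝ) :
    ∑ m : Bits (Fin (n κ)), A m * ∏ i, storeProb F κ (h i) (k i) (t i) (y i) (s (.committed i))
        (reported F u V κ i s) (m i) =
      (1 / 2) ^ n κ * ∑ r : Bits (Fin (n κ)), ∑ c,
        storeAt F u V κ j k t y s c * A (results F u V κ h j k t r c y s) := by
  have := sum_prod_coins j (fun i b => storeProb F κ (h i) (k i) (t i) (y i) (s (.committed i))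
      (reported F u V κ i s) b)
    (fun i r => storeDet F κ (h i) (k i) (t i) r (y i) (s (.committed i)) (reported F u V κ i s))
    (fun i _ b => storeProb_eq F κ _ _ _ _ _ _ _) A
  rw [this, hj]
  rfl

/-- The part of the difference between an attack and its `X`-trivial version for which the
committed qubit `j` may be measured in the standard basis. -/
def diagPart (h : Fin (n κ) → Bool) (j : Fin (n κ)) (A : Bits (Fin (n κ)) → ℝ)
    (k : Fin (n κ) → Bits (Fin (P.lenK κ))) (t : Fin (n κ) → Bits (Fin (P.lenT κ)))
    (r : Bits (Fin (n κ))) : ℝ :=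
  ∑ y, ∑ s, (1 / 2) *
    (outWeight (V.S κ) (F.w κ) (attackState F u V κ k fun s => Wire.com s = y) s +
      outWeight (V.S κ) (F.w κ)
        (zAt (.committed j) (attackState F u V κ k fun s => Wire.com s = y)) s) *
    ∑ c, (storeAt F u V κ j k t y s c - storeAt F u V κ j k t y s (!c)) *
      A (results F u V κ h j k t r c y s)

/-- The part of the difference between an attack and its `X`-trivial version for which the
trapdoor of qubit `j` is not needed. -/
def crossPart (h : Fin (n κ) → Bool) (j : Fin (n κ)) (A : Bits (Fin (n κ)) → ℝ)
    (k : Fin (n κ) → Bits (Fin (P.lenK κ))) (t : Fin (n κ) → Bits (Fin (P.lenT κ)))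
    (r : Bits (Fin (n κ))) (c : Bool) : ℝ :=
  ∑ y, ∑ s,
    (outWeight (V.S κ) (F.w κ) (attackState F u V κ k fun s => Wire.com s = y) s -
      outWeight (V.S κ) (F.w κ)
        (zAt (.committed j) (attackState F u V κ k fun s => Wire.com s = y)) s) *
    A (results F u V κ h j k t r c y s)

theorem sum_resultDist_mul (h : Fin (n κ) → Bool) (j : Fin (n κ)) (hj : h j = true)
    (A : Bits (Fin (n κ)) → ℝ) :
    ∑ m, resultDist F u V κ h m * A m = ∑ k, ∑ t, keyDist F κ h k t *
      ((1 / 2) ^ n κ * ∑ y, ∑ s,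
        outWeight (V.S κ) (F.w κ) (attackState F u V κ k fun s => Wire.com s = y) s *
          ∑ r : Bits (Fin (n κ)), ∑ c,
            storeAt F u V κ j k t y s c * A (results F u V κ h j k t r c y s)) := by
  have h1 : ∀ m, resultDist F u V κ h m * A m = ∑ k, ∑ t, ∑ y, ∑ s, keyDist F κ h k t *
      (outWeight (V.S κ) (F.w κ) (attackState F u V κ k fun s => Wire.com s = y) s *
        (A m * ∏ i, storeProb F κ (h i) (k i) (t i) (y i) (s (.committed i))
          (reported F u V κ i s) (m i))) := by
    intro m
    rw [resultDist_eq]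
    simp only [Finset.sum_mul, Finset.mul_sum]
    refine Finset.sum_congr rfl fun k _ => Finset.sum_congr rfl fun t _ =>
      Finset.sum_congr rfl fun y _ => Finset.sum_congr rfl fun s _ => ?_
    ring
  simp only [h1]
  rw [Finset.sum_comm]
  refine Finset.sum_congr rfl fun k _ => ?_
  rw [Finset.sum_comm]
  refine Finset.sum_congr rfl fun t _ => ?_
  rw [Finset.sum_comm, Finset.mul_sum, Finset.mul_sum]
  refine Finset.sum_congr rfl fun y _ => ?_
  rw [Finset.sum_comm, Finset.mul_sum, Finset.mul_sum]
  refine Finset.sum_congr rfl fun s _ => ?_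
  rw [← Finset.mul_sum, ← Finset.mul_sum, sum_results F u V κ h j hj]
  ring

/-- With outcome weights `p` for the state, `q` for its image under `Z`, and storing probabilities
`a`, the contribution of `c` is `(p a_c - q a_{!c}) / 2`. It is split by `p a_c - q a_{!c} = (p +
q)/2 * (a_c - a_{!c}) + (p - q)/2 * (a_c + a_{!c})`, where the last factor is `1`. Only the first
summand still needs the trapdoor of qubit `j`. -/
theorem resultDist_sub (h : Fin (n κ) → Bool) (j : Fin (n κ)) (hj : h j = true)
    (S' : ∀ κ, Channel (AttackWire F u V κ))
    (hS' : ∀ φ s, outWeight (S' κ) (F.w κ) φ s =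
      (1 / 2) * (outWeight (V.S κ) (F.w κ) φ s +
        outWeight (V.S κ) (F.w κ) (zAt (.committed j) φ) (flipAt (.committed j) s)))
    (A : Bits (Fin (n κ)) → ℝ) :
    ∑ m, resultDist F u V κ h m * A m - ∑ m, resultDist F u (V.withAttack S') κ h m * A m =
      (1 / 2) * ∑ k, ∑ t, keyDist F κ h k t * ((1 / 2) ^ n κ * ∑ r : Bits (Fin (n κ)),
        (diagPart F u V κ h j A k t r + (1 / 2) * ∑ c, crossPart F u V κ h j A k t r c)) := by
  have h2 : ∑ m, resultDist F u (V.withAttack S') κ h m * A m = ∑ k, ∑ t, keyDist F κ h k t *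
      ((1 / 2) ^ n κ * ∑ y, ∑ s,
        outWeight (S' κ) (F.w κ) (attackState F u V κ k fun s => Wire.com s = y) s *
          ∑ r : Bits (Fin (n κ)), ∑ c,
            storeAt F u V κ j k t y s c * A (results F u V κ h j k t r c y s)) :=
    sum_resultDist_mul F u (V.withAttack S') κ h j hj A
  rw [sum_resultDist_mul F u V κ h j hj A, h2, ← Finset.sum_sub_distrib, Finset.mul_sum]
  refine Finset.sum_congr rfl fun k _ => ?_
  rw [← Finset.sum_sub_distrib, Finset.mul_sum]
  refine Finset.sum_congr rfl fun t _ => ?_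
  rw [← mul_sub, ← mul_sub, mul_left_comm (1 / 2 : ℝ) (keyDist _ _ _ _ _),
    mul_left_comm (1 / 2 : ℝ) ((1 / 2) ^ n κ)]
  congr 2
  have h3 : ∑ r : Bits (Fin (n κ)), (diagPart F u V κ h j A k t r +
      (1 / 2) * ∑ c, crossPart F u V κ h j A k t r c) = ∑ y, ∑ s, ∑ r : Bits (Fin (n κ)),
      ((1 / 2) *
        (outWeight (V.S κ) (F.w κ) (attackState F u V κ k fun s => Wire.com s = y) s +
          outWeight (V.S κ) (F.w κ)
            (zAt (.committed j) (attackState F u V κ k fun s => Wire.com s = y)) s) *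
        (∑ c, (storeAt F u V κ j k t y s c - storeAt F u V κ j k t y s (!c)) *
          A (results F u V κ h j k t r c y s)) + (1 / 2) * ∑ c,
        (outWeight (V.S κ) (F.w κ) (attackState F u V κ k fun s => Wire.com s = y) s -
          outWeight (V.S κ) (F.w κ)
            (zAt (.committed j) (attackState F u V κ k fun s => Wire.com s = y)) s) *
        A (results F u V κ h j k t r c y s)) := by
    refine Eq.trans ?_ ((Finset.sum_congr rfl fun y _ => Finset.sum_comm).trans
      Finset.sum_comm).symm
    refine Finset.sum_congr rfl fun r _ => ?_
    rw [Fintype.sum_bool, diagPart, crossPart, crossPart, mul_add, Finset.mul_sum, Finset.mul_sum,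
      ← Finset.sum_add_distrib, ← Finset.sum_add_distrib]
    refine Finset.sum_congr rfl fun y _ => ?_
    rw [Finset.mul_sum, Finset.mul_sum, ← Finset.sum_add_distrib, ← Finset.sum_add_distrib]
    refine Finset.sum_congr rfl fun s _ => ?_
    simp only [Fintype.sum_bool]
    ring
  rw [h3, ← Finset.sum_sub_distrib, Finset.mul_sum]
  refine Finset.sum_congr rfl fun y _ => ?_
  -- Reindexing by the flip moves it from the outcome weight to the stored result, where it
  -- exchanges the two values of bit `j`.
  have h4 : ∀ T : Bits (AttackWire F u V κ) → ℝ,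
      ∑ s, outWeight (S' κ) (F.w κ) (attackState F u V κ k fun s => Wire.com s = y) s * T s =
      ∑ s, (1 / 2) * (outWeight (V.S κ) (F.w κ)
          (attackState F u V κ k fun s => Wire.com s = y) s * T s +
        outWeight (V.S κ) (F.w κ)
          (zAt (.committed j) (attackState F u V κ k fun s => Wire.com s = y)) s *
          T (flipAt (.committed j) s)) := by
    intro T
    simp only [hS', mul_add, add_mul, Finset.sum_add_distrib]
    congr 1
    · exact Finset.sum_congr rfl fun s _ => by ring
    · rw [← Equiv.sum_comp (flipAt (.committed j))]
      refine Finset.sum_congr rfl fun s _ => ?_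
      rw [flipAt_flipAt]
      ring
  rw [h4, ← Finset.sum_sub_distrib, Finset.mul_sum]
  refine Finset.sum_congr rfl fun s _ => ?_
  simp only [results_flip, storeAt_flip, Finset.mul_sum (Finset.univ : Finset (Bits (Fin (n κ))))]
  rw [← Finset.sum_add_distrib, Finset.mul_sum, ← Finset.sum_sub_distrib]
  refine Finset.sum_congr rfl fun r _ => ?_
  have h5 : storeAt F u V κ j k t y s true = 1 - storeAt F u V κ j k t y s false :=
    eq_sub_of_add_eq (storeProb_sum F κ true _ _ _ _ _)
  simp only [Fintype.sum_bool, h5, Bool.not_true, Bool.not_false]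
  ring

end Result

/-! ## The keys -/

section Keys

variable {P : Interface}

theorem KeyedFamily.genProb_nonneg (G : KeyedFamily P) (κ : ℕ) (k : Bits (Fin (P.lenK κ)))
    (t : Bits (Fin (P.lenT κ))) : 0 ≤ G.genProb κ k t := by
  rw [KeyedFamily.genProb]
  positivity

theorem KeyedFamily.genProb_gen_pos (G : KeyedFamily P) (κ : ℕ) (ρ : Bits (Fin (G.coins κ))) :
    0 < G.genProb κ (G.gen κ ρ).1 (G.gen κ ρ).2 := by
  rw [KeyedFamily.genProb]
  have : 0 < (Finset.univ.filter fun r => G.gen κ r = ((G.gen κ ρ).1, (G.gen κ ρ).2)).card :=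
    Finset.card_pos.2 ⟨ρ, by simp⟩
  positivity

theorem KeyedFamily.sum_genProb_mul (G : KeyedFamily P) (κ : ℕ)
    (Z : Bits (Fin (P.lenK κ)) × Bits (Fin (P.lenT κ)) → ℝ) :
    ∑ a : Bits (Fin (P.lenK κ)) × Bits (Fin (P.lenT κ)), G.genProb κ a.1 a.2 * Z a =
      (∑ ρ, Z (G.gen κ ρ)) / 2 ^ G.coins κ := by
  have h1 : ∀ ρ, Z (G.gen κ ρ) = ∑ a, if G.gen κ ρ = a then Z a else 0 := fun ρ =>
    (sum_ite_eq_self _ _).symm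
  simp only [h1]
  rw [Finset.sum_comm, Finset.sum_div]
  refine Finset.sum_congr rfl fun a _ => ?_
  rw [KeyedFamily.genProb, ← Finset.sum_filter, Finset.sum_const, nsmul_eq_mul]
  ring

theorem KeyedFamily.sum_genProb (G : KeyedFamily P) (κ : ℕ) :
    ∑ a : Bits (Fin (P.lenK κ)) × Bits (Fin (P.lenT κ)), G.genProb κ a.1 a.2 = 1 := by
  have := G.sum_genProb_mul κ fun _ => 1
  simp only [mul_one] at this
  rw [this]
  simp

variable (F : ExtendedTCF P) (κ : ℕ) {n : ℕ} (h : Fin n → Bool)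

theorem keyDist_nonneg (k : Fin n → Bits (Fin (P.lenK κ))) (t : Fin n → Bits (Fin (P.lenT κ))) :
    0 ≤ keyDist F κ h k t := by
  refine Finset.prod_nonneg fun i _ => ?_
  split_ifs <;> exact KeyedFamily.genProb_nonneg _ _ _ _

/-- Any output of the generator at `j` stays in the support of the key distribution, so perfectness
covers every key on which a reduction is run. -/
theorem keyDist_update_pos {k : Fin n → Bits (Fin (P.lenK κ))} {t : Fin n → Bits (Fin (P.lenT κ))}
    (hkt : 0 < keyDist F κ h k t) (j : Fin n) (hj : h j = true) (ρ : Bits (Fin (F.coins κ))) :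
    0 < keyDist F κ h (Function.update k j (F.gen κ ρ).1)
      (Function.update t j (F.gen κ ρ).2) := by
  refine Finset.prod_pos fun i _ => ?_
  by_cases hi : i = j
  · subst hi
    rw [if_pos hj, Function.update_self, Function.update_self]
    exact F.toKeyedFamily.genProb_gen_pos κ ρ
  · rw [Function.update_of_ne hi, Function.update_of_ne hi]
    have h1 := (Finset.prod_ne_zero_iff.1 hkt.ne') i (Finset.mem_univ i)
    refine lt_of_le_of_ne ?_ h1.symm
    split_ifs <;> exact KeyedFamily.genProb_nonneg _ _ _ _

/-- The probability of a key and a trapdoor for one qubit. -/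
def keyProb (b : Bool) (a : Bits (Fin (P.lenK κ)) × Bits (Fin (P.lenT κ))) : ℝ :=
  if b then F.toKeyedFamily.genProb κ a.1 a.2 else F.inj.toKeyedFamily.genProb κ a.1 a.2

theorem sum_keyProb (b : Bool) : ∑ a, keyProb F κ b a = 1 := by
  cases b
  · exact F.inj.toKeyedFamily.sum_genProb κ
  · exact F.toKeyedFamily.sum_genProb κ

theorem sum_keyDist_eq (Y : (Fin n → Bits (Fin (P.lenK κ))) → (Fin n → Bits (Fin (P.lenT κ))) → ℝ) :
    ∑ k, ∑ t, keyDist F κ h k t * Y k t =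
      ∑ f : Fin n → Bits (Fin (P.lenK κ)) × Bits (Fin (P.lenT κ)),
        (∏ i, keyProb F κ (h i) (f i)) * Y (fun i => (f i).1) fun i => (f i).2 := by
  rw [← Fintype.sum_prod_type', ← Equiv.sum_comp
    (Equiv.arrowProdEquivProdArrow (Fin n) (fun _ => Bits (Fin (P.lenK κ)))
      fun _ => Bits (Fin (P.lenT κ)))]
  rfl

theorem sum_keyDist : ∑ k, ∑ t, keyDist F κ h k t = 1 := by
  have := sum_keyDist_eq F κ h fun _ _ => 1
  simp only [mul_one] at this
  rw [this, sum_prod_eq_prod_sum fun i => keyProb F κ (h i)]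
  exact Finset.prod_eq_one fun i _ => sum_keyProb F κ _

theorem sum_keyDist_resample (j : Fin n) (hj : h j = true)
    (Y : (Fin n → Bits (Fin (P.lenK κ))) → (Fin n → Bits (Fin (P.lenT κ))) → ℝ) :
    ∑ k, ∑ t, keyDist F κ h k t * Y k t = ∑ k, ∑ t, keyDist F κ h k t *
      ((∑ ρ, Y (Function.update k j (F.gen κ ρ).1) (Function.update t j (F.gen κ ρ).2)) /
        2 ^ F.coins κ) := by
  rw [sum_keyDist_eq, sum_keyDist_eq, sum_resample (fun i => keyProb F κ (h i)) j
    (sum_keyProb F κ _)]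
  refine Finset.sum_congr rfl fun f _ => ?_
  congr 1
  have h1 := F.toKeyedFamily.sum_genProb_mul κ fun a =>
    Y (fun i => (Function.update f j a i).1) fun i => (Function.update f j a i).2
  have h2 : ∀ a, (fun i => (Function.update f j a i).1) =
      Function.update (fun i => (f i).1) j a.1 := by
    intro a
    funext i
    by_cases hi : i = j
    · subst hi; simp
    · simp [hi]
  have h3 : ∀ a, (fun i => (Function.update f j a i).2) =
      Function.update (fun i => (f i).2) j a.2 := by
    intro a
    funext i
    by_cases hi : i = j
    · subst hi; simp
    · simp [hi]
  simp only [h2, h3] at h1 ⊢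
  rw [← h1]
  refine Finset.sum_congr rfl fun a _ => ?_
  rw [keyProb, hj, if_pos rfl]

end Keys

/-! ## States of perfect provers -/

section Perfect

variable {P : Interface} {n : ℕ → ℕ} (F : ExtendedTCF P) (u : InjectionUnitary F.toNTCF)
  (V : Prover P n u.block) (κ : ℕ)

/-- With keys `k`, the verifier accepts with certainty in a test round. -/
def Consistent (k : Fin (n κ) → Bits (Fin (P.lenK κ))) : Prop :=
  ∀ s, V.U₀ κ s (Wire.init k) ≠ 0 → ∀ i, Wire.pre s i ∈ P.X κ ∧
    P.chk κ (k i) (s (.committed i)) (Wire.pre s i) (Wire.com s i) = true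

/-- An average of acceptance probabilities that equals one has only ones at points of positive
weight; with total weight one, no basis state of nonzero amplitude can then be rejected. -/
theorem consistent_of_perfect (h : Fin (n κ) → Bool) (hperfect : testAcceptProb F V κ h = 1)
    (k : Fin (n κ) → Bits (Fin (P.lenK κ))) (t : Fin (n κ) → Bits (Fin (P.lenT κ)))
    (hkt : 0 < keyDist F κ h k t) : Consistent F u V κ k := by
  let Acc (k : Fin (n κ) → Bits (Fin (P.lenK κ)))
      (s : Bits (Wire (n κ) (P.lenX κ) (P.lenY κ) (V.e κ) (P.lenK κ))) : Prop :=
    ∀ i, Wire.pre s i ∈ P.X κ ∧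
      P.chk κ (k i) (s (.committed i)) (Wire.pre s i) (Wire.com s i) = true
  let acc (k : Fin (n κ) → Bits (Fin (P.lenK κ))) : ℝ :=
    ∑ s, if Acc k s then ‖V.U₀ κ s (Wire.init k)‖ ^ 2 else 0
  have hone : ∀ k : Fin (n κ) → Bits (Fin (P.lenK κ)),
      ∑ s, ‖V.U₀ κ s (Wire.init k)‖ ^ 2 = 1 := fun k =>
    unitary_sum_normSq (V.unitary κ) (Wire.init k)
  have hterm : ∀ k s, (if Acc k s then ‖V.U₀ κ s (Wire.init k)‖ ^ 2 else 0) ≤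
      ‖V.U₀ κ s (Wire.init k)‖ ^ 2 := by
    intro k s
    split_ifs
    · exact le_rfl
    · positivity
  have hle : ∀ k, acc k ≤ 1 := fun k => by
    rw [← hone k]
    exact Finset.sum_le_sum fun s _ => hterm k s
  have hacc : acc k = 1 := by
    by_contra hne
    have hlt : acc k < 1 := lt_of_le_of_ne (hle k) hne
    have h1 : testAcceptProb F V κ h = ∑ k, ∑ t, keyDist F κ h k t * acc k := by
      refine Finset.sum_congr rfl fun k _ => Finset.sum_congr rfl fun t _ => ?_
      congr 1
    have h2 : ∀ k t, keyDist F κ h k t * acc k ≤ keyDist F κ h k t := fun k t =>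
      mul_le_of_le_one_right (keyDist_nonneg F κ h k t) (hle k)
    have h3 : testAcceptProb F V κ h < ∑ k, ∑ t, keyDist F κ h k t := by
      rw [h1]
      refine Finset.sum_lt_sum (fun k _ => Finset.sum_le_sum fun t _ => h2 k t)
        ⟨k, Finset.mem_univ k, Finset.sum_lt_sum (fun t _ => h2 k t) ⟨t, Finset.mem_univ t, ?_⟩⟩
      exact mul_lt_of_lt_one_right hkt hlt
    rw [sum_keyDist, hperfect] at h3
    exact lt_irrefl _ h3
  intro s hs
  by_contra hn
  have : acc k < 1 := by
    rw [← hone k]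
    refine Finset.sum_lt_sum (fun s _ => hterm k s) ⟨s, Finset.mem_univ s, ?_⟩
    rw [if_neg hn]
    positivity
  exact this.ne hacc

theorem attackState_congr {k : Fin (n κ) → Bits (Fin (P.lenK κ))}
    {Pr Pr' : Bits (Wire (n κ) (P.lenX κ) (P.lenY κ) (V.e κ) (P.lenK κ)) → Prop}
    (h : ∀ s, V.U₀ κ s (Wire.init k) ≠ 0 → (Pr s ↔ Pr' s)) :
    attackState F u V κ k Pr = attackState F u V κ k Pr' := by
  rw [attackState, attackState, prepState, prepState]
  congr 2
  funext s
  rw [restrictTo, restrictTo]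
  by_cases hs : V.U₀ κ s (Wire.init k) = 0
  · simp only [hs, ite_self]
  · exact ite_congr_prop (h s hs) _ _

theorem attackState_false (k : Fin (n κ) → Bits (Fin (P.lenK κ))) :
    attackState F u V κ k (fun _ => False) = 0 := by
  have h : appendZeros (u.lenX_le κ) (restrictTo (fun _ => False)
      fun s => V.U₀ κ s (Wire.init k)) = 0 := by
    funext s
    simp [appendZeros, restrictTo]
  rw [attackState, prepState, h, Matrix.mulVec_zero]

theorem attackState_or {k : Fin (n κ) → Bits (Fin (P.lenK κ))}
    {Pr Pr' : Bits (Wire (n κ) (P.lenX κ) (P.lenY κ) (V.e κ) (P.lenK κ)) → Prop}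
    (h : ∀ s, ¬ (Pr s ∧ Pr' s)) :
    attackState F u V κ k (fun s => Pr s ∨ Pr' s) =
      attackState F u V κ k Pr + attackState F u V κ k Pr' := by
  rw [attackState, attackState, attackState, prepState, prepState, prepState, ← Matrix.mulVec_add]
  congr 1
  funext s
  rw [Pi.add_apply, appendZeros, appendZeros, appendZeros]
  split_ifs
  · rw [restrictTo, restrictTo, restrictTo]
    have := h (Wire.shrink (u.lenX_le κ) s)
    by_cases h1 : Pr (Wire.shrink (u.lenX_le κ) s) <;>
      by_cases h2 : Pr' (Wire.shrink (u.lenX_le κ) s) <;> simp_all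
  · rw [add_zero]

/-- On the support of a consistent state the preimage registers hold elements of the domain, on
which `U_J` is known to act as `J`, and all other wires are untouched. Facts about the state before
`U_J` can thus be read off after it. -/
theorem attackState_ne_zero {k : Fin (n κ) → Bits (Fin (P.lenK κ))} (hk : Consistent F u V κ k)
    {Pr : Bits (Wire (n κ) (P.lenX κ) (P.lenY κ) (V.e κ) (P.lenK κ)) → Prop}
    {s : Bits (AttackWire F u V κ)} (hs : attackState F u V κ k Pr s ≠ 0) :
    ∃ s', Pr s' ∧ V.U₀ κ s' (Wire.init k) ≠ 0 ∧
      ∀ i, s (.committed i) = s' (.committed i) ∧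
        reported F u V κ i s = F.J κ (Wire.pre s' i) := by
  obtain ⟨s₁, -, hs₁⟩ := Finset.exists_ne_zero_of_sum_ne_zero hs
  have h1 : onPreimages (u.U κ) s s₁ ≠ 0 := left_ne_zero_of_mul hs₁
  have h2 := right_ne_zero_of_mul hs₁
  rw [appendZeros] at h2
  split_ifs at h2 with h3
  · rw [restrictTo] at h2
    split_ifs at h2 with h4
    · refine ⟨_, h4, h2, fun i => ?_⟩
      rw [onPreimages] at h1
      split_ifs at h1 with h5
      · refine ⟨h5.1 i, ?_⟩
        have h6 := Finset.prod_ne_zero_iff.1 h1 i (Finset.mem_univ i)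
        -- The appended wires are zero in every contributing string, which is the form of input for
        -- which `U_spec` is stated.
        have h7 : Wire.pre s₁ i = pad (u.block κ) (Wire.pre (Wire.shrink (u.lenX_le κ) s₁) i) := by
          funext q
          rw [pad]
          split_ifs with hq
          · rfl
          · exact h3 i q (not_lt.1 hq)
        rw [h7, u.U_spec κ _ (hk _ h2 i).1] at h6
        split_ifs at h6 with h8
        · funext q
          have h9 := congrFun h8 (Fin.castLE (u.w_le κ) q)
          rw [pad, dif_pos (by simp)] at h9
          exact h9
        · exact absurd rfl h6
      · exact absurd rfl h1
    · exact absurd rfl h2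
  · exact absurd rfl h2

/-- Passing `CHK` means lying in the support of `f'`, and every point of this support is inverted to
both elements of the claw. The matching supplies the element that the prover does not hold. -/
theorem Consistent.claw {k : Fin (n κ) → Bits (Fin (P.lenK κ))} (hk : Consistent F u V κ k)
    {j : Fin (n κ)} {ρ : Bits (Fin (F.coins κ))} (hj : k j = (F.gen κ ρ).1)
    {s : Bits (Wire (n κ) (P.lenX κ) (P.lenY κ) (V.e κ) (P.lenK κ))}
    (hs : V.U₀ κ s (Wire.init k) ≠ 0) :
    ∃ x₀ x₁, (x₀, x₁) ∈ F.R κ (F.gen κ ρ).1 ∧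
      Wire.pre s j = (if s (.committed j) then x₁ else x₀) ∧
      F.inv κ (F.gen κ ρ).2 false (Wire.com s j) = some x₀ ∧
      F.inv κ (F.gen κ ρ).2 true (Wire.com s j) = some x₁ := by
  obtain ⟨hX, hchk⟩ := hk s hs j
  have hK := F.gen_mem κ ρ
  rw [hj, F.chk_f' κ _ hK _ _ hX] at hchk
  cases hb : s (.committed j)
  · obtain ⟨x₁, hx₁, -⟩ := F.matching_left κ _ hK _ hX
    rw [hb] at hchk
    have := F.inv_f' κ ρ _ _ hx₁ false _ (by simpa using hchk)
    exact ⟨_, x₁, hx₁, by simp, this⟩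
  · obtain ⟨x₀, hx₀, -⟩ := F.matching_right κ _ hK _ hX
    rw [hb] at hchk
    have := F.inv_f' κ ρ _ _ hx₀ true _ (by simpa using hchk)
    exact ⟨x₀, _, hx₀, by simp, this⟩

/-- Measuring the committed qubit `j` and the preimage register `j`. -/
theorem outWeight_measured {k : Fin (n κ) → Bits (Fin (P.lenK κ))} (hk : Consistent F u V κ k)
    {j : Fin (n κ)} {ρ : Bits (Fin (F.coins κ))} (hj : k j = (F.gen κ ρ).1)
    (y : Fin (n κ) → Bits (Fin (P.lenY κ))) (s : Bits (AttackWire F u V κ)) :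
    (1 / 2) * (outWeight (V.S κ) (F.w κ) (attackState F u V κ k fun s => Wire.com s = y) s +
      outWeight (V.S κ) (F.w κ)
        (zAt (.committed j) (attackState F u V κ k fun s => Wire.com s = y)) s) =
    ∑ b, ∑ x, outWeight (V.S κ) (F.w κ) (attackState F u V κ k fun s =>
      Wire.com s = y ∧ s (.committed j) = b ∧ Wire.pre s j = x) s := by
  -- The two branches of the committed qubit. `Z` changes only their relative sign, so the average
  -- over the state and its image under `Z` has no interference between them.
  let φ (b : Bool) := attackState F u V κ k fun s => Wire.com s = y ∧ s (.committed j) = b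
  have h1 : attackState F u V κ k (fun s => Wire.com s = y) = φ false + φ true := by
    rw [← attackState_or]
    · refine attackState_congr F u V κ fun s _ => ?_
      cases s (.committed j) <;> simp
    · rintro s ⟨h1, h2⟩
      rw [h1.2] at h2
      simp at h2
  have h2 : ∀ b, zAt (.committed j) (φ b) = fun s => sgn b * φ b s := by
    intro b
    funext s
    by_cases hs : φ b s = 0
    · simp [zAt, hs]
    · obtain ⟨s', h1, -, h2⟩ := attackState_ne_zero F u V κ hk hs
      rw [zAt, (h2 j).1, h1.2]
  have h3 : zAt (.committed j) (φ false + φ true) = φ false - φ true := by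
    have : zAt (.committed j) (φ false + φ true) =
        zAt (.committed j) (φ false) + zAt (.committed j) (φ true) := by
      funext s
      simp [zAt, mul_add]
    rw [this, h2, h2]
    funext s
    simp [sgn, sub_eq_add_neg]
  have h4 : ∀ b, ∑ x, outWeight (V.S κ) (F.w κ) (attackState F u V κ k fun s =>
      Wire.com s = y ∧ s (.committed j) = b ∧ Wire.pre s j = x) s =
      outWeight (V.S κ) (F.w κ) (φ b) s := by
    intro b
    -- Given the commitment string and the bit `b`, the content of the preimage register is forced
    -- to be the inverse. Measuring it changes nothing, and at most one `x` contributes to the sum.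
    have hinv : ∀ s, V.U₀ κ s (Wire.init k) ≠ 0 → Wire.com s = y → s (.committed j) = b →
        F.inv κ (F.gen κ ρ).2 b (y j) = some (Wire.pre s j) := by
      rintro s hs rfl rfl
      obtain ⟨x₀, x₁, -, h1, h2, h3⟩ := hk.claw F u V κ hj hs
      rw [h1]
      cases s (.committed j)
      · exact h2
      · exact h3
    rcases hx : F.inv κ (F.gen κ ρ).2 b (y j) with _ | x
    · have hzero : ∀ Pr, (∀ s, Pr s → Wire.com s = y ∧ s (.committed j) = b) →
          attackState F u V κ k Pr = 0 := by
        intro Pr hPr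
        rw [← attackState_false F u V κ k]
        refine attackState_congr F u V κ fun s hs => ⟨fun h => ?_, False.elim⟩
        have := hinv s hs (hPr s h).1 (hPr s h).2
        rw [hx] at this
        cases this
      rw [show φ b = 0 from hzero _ fun s h => h, outWeight_zero]
      refine Finset.sum_eq_zero fun x _ => ?_
      rw [hzero _ fun s h => ⟨h.1, h.2.1⟩, outWeight_zero]
    · rw [Fintype.sum_eq_single x]
      · congr 1
        refine attackState_congr F u V κ fun s hs => ⟨fun h => ⟨h.1, h.2.1⟩, fun h => ?_⟩
        have := hinv s hs h.1 h.2
        rw [hx] at this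
        exact ⟨h.1, h.2, (Option.some.inj this).symm⟩
      · intro x' hx'
        have : attackState F u V κ k (fun s =>
            Wire.com s = y ∧ s (.committed j) = b ∧ Wire.pre s j = x') = 0 := by
          rw [← attackState_false F u V κ k]
          refine attackState_congr F u V κ fun s hs => ⟨fun h => hx' ?_, False.elim⟩
          have h1 := hinv s hs h.1 h.2.1
          rw [hx, h.2.2] at h1
          exact (Option.some.inj h1).symm
        rw [this, outWeight_zero]
  rw [Fintype.sum_bool, h4, h4, h1, h3, outWeight_add_sub]
  ring

end Perfect

/-! ## Reductions -/

section Reduction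

variable {I O M Q : Type} [Fintype O] [DecidableEq O]

theorem Sim.comp {c c' : ℕ} {Φ : Bits I → Bits O → ℝ} {Ψ : Bits O → Bits Q → ℝ}
    [Fintype Q] [DecidableEq Q] (hΦ : Sim c Φ) (hΨ : Sim c' Ψ) :
    Sim (c + 3 * c') fun x q => ∑ o, Φ x o * Ψ o q := by
  have h1 := (hΦ.bind hΨ fun j => Sum.inr (Sum.inl j)).mapOut (Sum.inr : Q → O ⊕ Q)
  refine (congrArg (Sim (c + 3 * c')) ?_).mp h1
  funext x q
  rw [sum_cat]
  refine Finset.sum_congr rfl fun o _ => ?_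
  refine (Fintype.sum_eq_single q fun r hr => if_neg hr).trans ?_
  exact if_pos (cat_comp_inr o q)

theorem Sim.pre {c c' : ℕ} {f : Bits I → Bits O} {Ψ : Bits O → Bits Q → ℝ}
    [Fintype Q] [DecidableEq Q] (hf : Det c f) (hΨ : Sim c' Ψ) :
    Sim (c + 3 * c') fun x q => Ψ (f x) q := by
  refine (congrArg (Sim (c + 3 * c')) ?_).mp (Sim.comp hf hΨ)
  funext x q
  refine (Fintype.sum_eq_single (f x) fun o ho => ?_).trans ?_
  · rw [if_neg ho, zero_mul]
  · rw [if_pos rfl, one_mul]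

theorem sum_bits_unit {A : Type*} [AddCommMonoid A] (φ : Bits Unit → A) :
    ∑ v, φ v = ∑ b, φ (bit b) :=
  (Equiv.sum_comp (Equiv.funUnique Unit Bool).symm φ).symm

theorem QProc.prob_bit_true [Fintype I] [DecidableEq I] (A : QProc I Unit) (x : Bits I) :
    A.prob x {bit true} = 1 - A.prob x {bit false} := by
  have := A.sim.sum_eq_one x
  rw [sum_bits_unit, Fintype.sum_bool] at this
  linarith

theorem QProc.prob_bit_mem [Fintype I] [DecidableEq I] (A : QProc I Unit) (x : Bits I) (b : Bool) :
    0 ≤ A.prob x {bit b} ∧ A.prob x {bit b} ≤ 1 := by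
  have h0 := fun b => A.sim.nonneg x (bit b)
  have h1 := A.prob_bit_true x
  cases b
  · exact ⟨h0 _, by linarith [h0 true]⟩
  · exact ⟨h0 _, by linarith [h0 false]⟩

end Reduction

open Classical in
/-- Run the distinguisher `A` on a function `f` of the outcome `o` of an efficient experiment, and
output a function `g` of `o` and the bit returned by `A`. -/
theorem exists_reduction {I O M Q : ℕ → Type} [∀ κ, Fintype (I κ)] [∀ κ, DecidableEq (I κ)]
    [∀ κ, Fintype (O κ)] [∀ κ, DecidableEq (O κ)] [∀ κ, Fintype (M κ)] [∀ κ, DecidableEq (M κ)]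
    [∀ κ, Fintype (Q κ)] [∀ κ, DecidableEq (Q κ)]
    {Φ : ∀ κ, Bits (I κ) → Bits (O κ) → ℝ} {p : ℕ → ℕ} (hp : PolyBounded p)
    (hΦ : ∀ κ, Sim (p κ) (Φ κ)) {f : ∀ κ, Bits (O κ) → Bits (M κ)} {pf : ℕ → ℕ}
    (hpf : PolyBounded pf) (hf : ∀ κ, Det (pf κ) (f κ)) (A : ∀ κ, QProc (M κ) Unit) (hA : QPT A)
    {g : ∀ κ, Bits (O κ ⊕ Unit) → Bits (Q κ)} {pg : ℕ → ℕ} (hpg : PolyBounded pg)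
    (hg : ∀ κ, Det (pg κ) (g κ)) :
    ∃ B : ∀ κ, QProc (I κ) (Q κ), QPT B ∧ ∀ κ x E, (B κ).prob x E =
      ∑ o, Φ κ x o * ∑ a, (A κ).prob (f κ o) {bit a} *
        if g κ (cat o (bit a)) ∈ E then 1 else 0 := by
  have h : ∀ κ, ∃ B : QProc (I κ) (Q κ), B.size ≤ _ ∧ ∀ x q, B.prob x {q} = _ := fun κ =>
    (((hΦ κ).bind (Sim.pre (hf κ) (A κ).sim) fun j => Sum.inr (Sum.inl j)).post
      (hg κ)).exists_qproc
  choose B hB hB' using h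
  refine ⟨B, PolyBounded.mono ((PolyBounded.const 2).mul ((hp.add ((PolyBounded.const 3).mul
    (hpf.add ((PolyBounded.const 3).mul hA)))).add ((PolyBounded.const 3).mul hpg))) hB,
    fun κ x E => ?_⟩
  rw [QProc.prob_eq_sum]
  simp only [hB']
  have h1 : ∀ q : Bits (Q κ), ∀ W : Bits (O κ ⊕ Unit) → ℝ,
      (if q ∈ E then ∑ o, if g κ o = q then W o else 0 else 0) =
        ∑ o, if g κ o = q then (if g κ o ∈ E then W o else 0) else 0 := by
    intro q W
    by_cases hq : q ∈ E
    · rw [if_pos hq]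
      refine Finset.sum_congr rfl fun o _ => ?_
      by_cases ho : g κ o = q
      · rw [if_pos ho, if_pos ho, ho, if_pos hq]
      · rw [if_neg ho, if_neg ho]
    · rw [if_neg hq]
      symm
      refine Finset.sum_eq_zero fun o _ => ?_
      by_cases ho : g κ o = q
      · rw [if_pos ho, ho, if_neg hq]
      · rw [if_neg ho]
  simp only [h1]
  rw [Finset.sum_comm]
  have h2 : ∀ (o : Bits (O κ ⊕ Unit)) (v : ℝ), ∑ q, (if g κ o = q then v else 0) = v := fun o v =>
    sum_ite_eq_self (g κ o) fun _ => v
  simp only [h2]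
  rw [sum_cat]
  refine Finset.sum_congr rfl fun o _ => ?_
  rw [sum_bits_unit, Finset.mul_sum]
  refine Finset.sum_congr rfl fun a _ => ?_
  rw [cat_comp_inl, cat_comp_inr, mul_ite, mul_one, mul_zero, mul_ite, mul_zero]
  rfl

/-! ## Negligible functions -/

theorem Negligible.add {μ ν : ℕ → ℝ} (hμ : Negligible μ) (hν : Negligible ν) :
    Negligible fun κ => μ κ + ν κ :=
  ⟨fun κ => add_nonneg (hμ.1 κ) (hν.1 κ), hμ.2.add hν.2⟩

theorem Negligible.const_mul {μ : ℕ → ℝ} (hμ : Negligible μ) {c : ℝ} (hc : 0 ≤ c) :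
    Negligible fun κ => c * μ κ :=
  ⟨fun κ => mul_nonneg hc (hμ.1 κ), hμ.2.const_mul c⟩

/-! ### Efficient experiments for the two reductions -/

section Experiments

variable {P : Interface} {n : ℕ → ℕ} (F : ExtendedTCF P) (u : InjectionUnitary F.toNTCF)
  (V : Prover P n u.block) (hn : PolyBounded n) (hU₀ : EffUnitary V.U₀) (hS : EffChannel V.S)

include hS in
theorem attackWire_poly : PolyBounded fun κ => Fintype.card (AttackWire F u V κ) := by
  obtain ⟨a, c, hp, -⟩ := hS
  exact hp.mono fun κ => (Nat.le_add_right _ _).trans (Nat.le_add_right _ _)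

include hn hU₀ hS in
theorem exists_sim_attack {O : ℕ → Type} [∀ κ, Fintype (O κ)] [∀ κ, DecidableEq (O κ)]
    (hO : PolyBounded fun κ => Fintype.card (O κ))
    (src : ∀ κ, O κ → Wire (n κ) (P.lenX κ) (P.lenY κ) (V.e κ) (P.lenK κ))
    (k : ∀ κ, Fin (n κ) → Bits (Fin (P.lenK κ))) (j : ∀ κ, Fin (n κ)) :
    ∃ p, PolyBounded p ∧ ∀ κ, Sim (p κ)
      fun (x : Bits (Fin (P.lenK κ) ⊕ (Fin (F.w κ) ⊕ Unit)))
        (o : Bits (O κ ⊕ AttackWire F u V κ)) =>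
        outWeight (V.S κ) (F.w κ) (fun s =>
          phaseAt (u.w_le κ) (j κ) (x ∘ Sum.inr ∘ Sum.inl) (x (Sum.inr (Sum.inr ()))) s *
            attackState F u V κ (Function.update (k κ) (j κ) (x ∘ Sum.inl))
              (fun s' => s' ∘ src κ = o ∘ Sum.inl) s) (o ∘ Sum.inr) := by
  have hW := attackWire_poly F u V hS
  obtain ⟨cU, hcU, hcU'⟩ := hU₀
  obtain ⟨cJ, hcJ, hcJ'⟩ := u.U_eff
  obtain ⟨a, cS, hcS, hcS'⟩ := hS
  refine ⟨_, ((PolyBounded.const 2).mul hW).add (((PolyBounded.const 2).mul hO).add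
    (((PolyBounded.const 2).mul F.w_poly).add ((PolyBounded.const 2).add
      (hcU.add ((hn.mul hcJ).add hcS))))), fun κ => ?_⟩
  have h := sim_attack (u.lenX_le κ) (u.w_le κ) (V.S κ) (cU κ) (cJ κ) (cS κ) (hcS' κ) (src κ)
    (k κ) (j κ)
  rw [hcU' κ, hcJ' κ] at h
  refine h.mono ?_
  have := Nat.mul_le_mul_left (n κ)
    (Nat.le_add_left (cJ κ).length (Fintype.card (Fin (u.block κ))))
  generalize n κ * (cJ κ).length = z at this ⊢
  generalize n κ * (Fintype.card (Fin (u.block κ)) + (cJ κ).length) = z' at this ⊢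
  simp only [AttackWire]
  omega

-- Overwriting position `j` removes every use of its trapdoor; for all other qubits keys, trapdoors
-- and coins are hardwired constants.
include hn in
theorem results_det {O : ℕ → Type} [∀ κ, Fintype (O κ)] [∀ κ, DecidableEq (O κ)]
    (hO : PolyBounded fun κ => Fintype.card (O κ))
    (ySrc : ∀ κ, Fin (n κ) → Fin (P.lenY κ) → O κ) (sSrc : ∀ κ, AttackWire F u V κ → O κ)
    (h : ∀ κ, Fin (n κ) → Bool) (j : ∀ κ, Fin (n κ))
    (k : ∀ κ, Fin (n κ) → Bits (Fin (P.lenK κ))) (t : ∀ κ, Fin (n κ) → Bits (Fin (P.lenT κ)))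
    (r : ∀ κ, Bits (Fin (n κ))) (c : ℕ → Bool) :
    ∃ p, PolyBounded p ∧ ∀ κ, Det (p κ) fun o : Bits (O κ) =>
      results F u V κ (h κ) (j κ) (k κ) (t κ) (r κ) (c κ) (fun i q => o (ySrc κ i q))
        (o ∘ sSrc κ) := by
  have hst := PolyDet.ite
    ((storeDet_polyDet_true F).reindex (ι' := fun κ => Unit × Fin (n κ))
      fun κ a => (k κ a.2, t κ a.2, r κ a.2))
    ((storeDet_polyDet_false F).reindex (ι' := fun κ => Unit × Fin (n κ))
      fun κ a => (k κ a.2, t κ a.2, r κ a.2))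
    fun κ a => h κ a.2 = true
  have hpr := PolyDet.proj (ι := fun κ => Unit × Fin (n κ)) (O := ReportWire P F.w) hO
    fun κ a => Sum.elim (ySrc κ a.2) (Sum.elim (fun _ => sSrc κ (.committed a.2))
      fun q => sSrc κ (.preimage a.2 (Fin.castLE (u.w_le κ) q)))
  have hc := PolyDet.const (ι := fun κ => Unit × Fin (n κ)) (O := fun _ => Unit) hO
    fun κ _ => bit (c κ)
  have hall := hc.ite (hpr.comp hst) fun κ a => a.2 = j κ
  have htup := PolyDet.tuple (ι := fun _ => Unit) hO hn
    (f := fun κ _ o => results F u V κ (h κ) (j κ) (k κ) (t κ) (r κ) (c κ)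
      (fun i q => o (ySrc κ i q)) (o ∘ sSrc κ)) ((congrArg PolyDet ?_).mp hall)
  · obtain ⟨p, hp, hd⟩ := htup
    exact ⟨p, hp, fun κ => hd κ ()⟩
  funext κ a o
  by_cases hi : a.2 = j κ
  · simp only [if_pos hi, results]
    rw [hi, Function.update_self]
  · simp only [if_neg hi, results, Function.update_of_ne hi]
    split_ifs with hh
    · rw [hh]
      rfl
    · rw [Bool.eq_false_of_not_eq_true hh]
      rfl

/-- The wires measured before `U_J` is applied: commitment strings, a committed qubit, and a
preimage register. -/
abbrev MeasuredWire (P : Interface) (n : ℕ → ℕ) (κ : ℕ) : Type :=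
  (Fin (n κ) × Fin (P.lenY κ)) ⊕ (Unit ⊕ Fin (P.lenX κ))

theorem sum_bits_curry {α β A : Type*} [Fintype α] [DecidableEq α] [Fintype β] [DecidableEq β]
    [AddCommMonoid A] (φ : (α × β → Bool) → A) : ∑ z, φ z = ∑ y : α → β → Bool, φ fun q => y q.1 q.2 :=
  (Equiv.sum_comp (Equiv.curry α β Bool).symm φ).symm

-- The adversary against the adaptive hardcore bit. The bit and the preimage measured before `U_J`
-- are the first two components of its output, and `d` is the reported string. The answer `0` of the
-- distinguisher is taken as evidence that `c` is the bit the verifier would store, that is, `c`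
-- equals the reported bit plus `d · (J x₀ ⊕ J x₁)`; the answer `1` as evidence against it. This
-- explains the last component `c ⊕ b' ⊕ a`.
include hn hU₀ hS in
open Classical in
theorem exists_standard_experiment (h : ∀ κ, Fin (n κ) → Bool) (j : ∀ κ, Fin (n κ))
    (k : ∀ κ, Fin (n κ) → Bits (Fin (P.lenK κ))) (t : ∀ κ, Fin (n κ) → Bits (Fin (P.lenT κ)))
    (r : ∀ κ, Bits (Fin (n κ))) (c : ℕ → Bool) (A : ∀ κ, QProc (Fin (n κ)) Unit) (hA : QPT A) :
    ∃ B : ∀ κ, QProc (Fin (P.lenK κ)) (Unit ⊕ Fin (P.lenX κ) ⊕ Fin (F.w κ) ⊕ Unit), QPT B ∧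
      ∀ κ kj E, (B κ).prob kj E = ∑ y, ∑ b, ∑ x, ∑ s,
        outWeight (V.S κ) (F.w κ) (attackState F u V κ (Function.update (k κ) (j κ) kj) fun s =>
          Wire.com s = y ∧ s (.committed (j κ)) = b ∧ Wire.pre s (j κ) = x) s *
        ∑ a, (A κ).prob (results F u V κ (h κ) (j κ) (k κ) (t κ) (r κ) (c κ) y s) {bit a} *
          if cat (bit b) (cat x (cat (reported F u V κ (j κ) s)
            (bit (c κ ^^ (s (.committed (j κ)) ^^ a))))) ∈ E then 1 else 0 := by
  have hO : PolyBounded fun κ => Fintype.card (MeasuredWire P n κ) := by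
    simpa using (hn.mul P.lenY_poly).add ((PolyBounded.const 1).add P.lenX_poly)
  have hOW : PolyBounded fun κ => Fintype.card (MeasuredWire P n κ ⊕ AttackWire F u V κ) := by
    have := hO.add (attackWire_poly F u V hS)
    simpa only [Fintype.card_sum] using this
  have hOWU : PolyBounded fun κ =>
      Fintype.card ((MeasuredWire P n κ ⊕ AttackWire F u V κ) ⊕ Unit) := by
    have := hOW.add (PolyBounded.const 1)
    simpa only [Fintype.card_sum, Fintype.card_unit] using this
  have hK : PolyBounded fun κ => Fintype.card (Fin (P.lenK κ)) := by simpa using P.lenK_poly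
  obtain ⟨p, hp, hatt⟩ := exists_sim_attack F u V hn hU₀ hS hO
    (fun κ => Sum.elim (fun q => .commitment q.1 q.2) (Sum.elim (fun _ => .committed (j κ))
      fun q => .preimage (j κ) q)) k j
  obtain ⟨pf, hpf, hf⟩ := results_det F u V hn hOW
    (fun κ i q => Sum.inl (Sum.inl (i, q))) (fun κ => Sum.inr) h j k t r c
  have hpj := fun {W : ℕ → Type} [∀ κ, Fintype (W κ)] [∀ κ, DecidableEq (W κ)] (ρ : ∀ κ, W κ → (MeasuredWire P n κ ⊕ AttackWire F u V κ) ⊕ Unit) =>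
    PolyDet.proj (ι := fun _ => Unit) hOWU fun κ _ => ρ κ
  obtain ⟨pg, hpg, hg⟩ := (hpj (W := fun _ => Unit) fun κ _ => .inl (.inl (.inr (.inl ())))).cat
    ((hpj fun κ q => .inl (.inl (.inr (.inr q)))).cat
      ((hpj fun κ q => .inl (.inr (.preimage (j κ) (Fin.castLE (u.w_le κ) q)))).cat
        (PolyDet.bin (fun κ _ b a => c κ ^^ (b ^^ a))
          (hpj (W := fun _ => Unit) fun κ _ => .inl (.inr (.committed (j κ))))
          (hpj (W := fun _ => Unit) fun κ _ => .inr ()))))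
  -- The phase inputs `d` and `σ` of the general experiment are set to zero here, so that no phase
  -- is introduced.
  obtain ⟨B, hB, hB'⟩ := exists_reduction
    ((hK.add (.const 2)).add ((PolyBounded.const 3).mul hp))
    (fun κ => Sim.pre (Det.route (Sum.elim Sum.inl fun _ => Sum.inr false)) (hatt κ))
    hpf hf A hA hpg fun κ => hg κ ()
  refine ⟨B, hB, fun κ kj E => ?_⟩
  rw [hB', sum_cat, sum_cat, sum_bits_curry]
  refine Finset.sum_congr rfl fun y _ => ?_
  rw [sum_cat, sum_bits_unit]
  refine Finset.sum_congr rfl fun b _ => Finset.sum_congr rfl fun x _ =>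
    Finset.sum_congr rfl fun s _ => ?_
  refine congrArg₂ (· * ·) (congrFun (congrArg (outWeight (V.S κ) (F.w κ)) ?_) s) ?_
  swap
  · refine Finset.sum_congr rfl fun a _ => congrArg₂ (· * ·) ?_
      (ite_congr_prop (iff_of_eq (congrArg (· ∈ E) ?_)) _ _)
    · rfl
    · rfl
  funext s'
  have h1 : phaseAt (u.w_le κ) (j κ) (fun _ => false) false s' = 1 := by
    simp [phaseAt, sgn]
  refine (congrArg (· * _) h1).trans ((one_mul _).trans ?_)
  refine congrFun (congrArg (attackState F u V κ (Function.update (k κ) (j κ) kj)) ?_) s'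
  funext s
  refine propext ⟨fun h => ⟨?_, ?_, ?_⟩, ?_⟩
  · funext i q
    exact congrFun h (Sum.inl (i, q))
  · exact congrFun h (Sum.inr (Sum.inl ()))
  · funext q
    exact congrFun h (Sum.inr (Sum.inr q))
  · rintro ⟨rfl, rfl, rfl⟩
    funext q
    rcases q with q | q | q <;> rfl

-- The adversary against the hardcore property: it inserts `Z^d` on the preimage register and `Z^σ`,
-- for a fair coin `σ`, on the committed qubit. The coin is added to the guess in order to undo its
-- effect, and `γ` chooses whether the distinguisher's answer or its negation is used.
include hn hU₀ hS in
open Classical in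
theorem exists_phase_experiment (h : ∀ κ, Fin (n κ) → Bool) (j : ∀ κ, Fin (n κ))
    (k : ∀ κ, Fin (n κ) → Bits (Fin (P.lenK κ))) (t : ∀ κ, Fin (n κ) → Bits (Fin (P.lenT κ)))
    (r : ∀ κ, Bits (Fin (n κ))) (c : ℕ → Bool) (A : ∀ κ, QProc (Fin (n κ)) Unit) (hA : QPT A)
    (γ : Bool) :
    ∃ B : ∀ κ, QProc (Fin (P.lenK κ) ⊕ Fin (F.w κ)) Unit, QPT B ∧
      ∀ κ kj d E, (B κ).prob (cat kj d) E = ∑ σ, ∑ y, ∑ s, ((1 / 2) *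
        outWeight (V.S κ) (F.w κ) (fun s => phaseAt (u.w_le κ) (j κ) d σ s *
          attackState F u V κ (Function.update (k κ) (j κ) kj) (fun s => Wire.com s = y) s) s) *
        ∑ a, (A κ).prob (results F u V κ (h κ) (j κ) (k κ) (t κ) (r κ) (c κ) y s) {bit a} *
          if bit (γ ^^ (σ ^^ a)) ∈ E then 1 else 0 := by
  have hO : PolyBounded fun κ => Fintype.card (Fin (n κ) × Fin (P.lenY κ)) := by
    simpa using hn.mul P.lenY_poly
  have hOW : PolyBounded fun κ =>
      Fintype.card (Unit ⊕ ((Fin (n κ) × Fin (P.lenY κ)) ⊕ AttackWire F u V κ)) := by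
    have := (PolyBounded.const 1).add (hO.add (attackWire_poly F u V hS))
    simpa only [Fintype.card_sum, Fintype.card_unit] using this
  have hOWU : PolyBounded fun κ =>
      Fintype.card ((Unit ⊕ ((Fin (n κ) × Fin (P.lenY κ)) ⊕ AttackWire F u V κ)) ⊕ Unit) := by
    have := hOW.add (PolyBounded.const 1)
    simpa only [Fintype.card_sum, Fintype.card_unit] using this
  have hI : PolyBounded fun κ => Fintype.card (Fin (P.lenK κ) ⊕ Fin (F.w κ)) := by
    simpa using P.lenK_poly.add F.w_poly
  obtain ⟨p, hp, hatt⟩ := exists_sim_attack F u V hn hU₀ hS hO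
    (fun κ q => .commitment q.1 q.2) k j
  obtain ⟨pf, hpf, hf⟩ := results_det F u V hn hOW
    (fun κ i q => Sum.inr (Sum.inl (i, q))) (fun κ q => Sum.inr (Sum.inr q)) h j k t r c
  have hpj := fun {W : ℕ → Type} [∀ κ, Fintype (W κ)] [∀ κ, DecidableEq (W κ)] (ρ : ∀ κ, W κ →
      (Unit ⊕ ((Fin (n κ) × Fin (P.lenY κ)) ⊕ AttackWire F u V κ)) ⊕ Unit) =>
    PolyDet.proj (ι := fun _ => Unit) hOWU fun κ _ => ρ κ
  obtain ⟨pg, hpg, hg⟩ := PolyDet.bin (fun κ _ b a => γ ^^ (b ^^ a))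
    (hpj (W := fun _ => Unit) fun κ _ => .inl (.inl ()))
    (hpj (W := fun _ => Unit) fun κ _ => .inr ())
  obtain ⟨B, hB, hB'⟩ := exists_reduction
    (((hI.add (.const 2)).add (.const (3 * 2))).add ((PolyBounded.const 3).mul hp))
    (fun κ => (Sim.pre (Det.proj (Empty.elim : Empty → Fin (P.lenK κ) ⊕ Fin (F.w κ)))
      Sim.coin).bind (hatt κ) (Sum.elim (fun q => Sum.inl (Sum.inl q))
        (Sum.elim (fun q => Sum.inl (Sum.inr q)) fun _ => Sum.inr (Sum.inl ()))))
    hpf hf A hA hpg fun κ => hg κ ()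
  refine ⟨B, hB, fun κ kj d E => ?_⟩
  rw [hB', sum_cat, sum_bits_unit]
  refine Finset.sum_congr rfl fun σ _ => ?_
  rw [sum_cat, sum_bits_curry]
  refine Finset.sum_congr rfl fun y _ => Finset.sum_congr rfl fun s _ => ?_
  refine congrArg₂ (· * ·) (congrArg ((1 / 2 : ℝ) * ·) ?_) ?_
  swap
  · refine Finset.sum_congr rfl fun a _ => congrArg₂ (· * ·) ?_
      (ite_congr_prop (iff_of_eq (congrArg (· ∈ E) ?_)) _ _)
    · rfl
    · rfl
  refine congrFun (congrArg (outWeight (V.S κ) (F.w κ)) ?_) s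
  funext s'
  refine congrArg (phaseAt (u.w_le κ) (j κ) d σ s' * ·) ?_
  refine congrFun (congrArg (attackState F u V κ (Function.update (k κ) (j κ) kj)) ?_) s'
  funext s
  refine propext ⟨fun h => ?_, ?_⟩
  · funext i q
    exact congrFun h (i, q)
  · rintro rfl
    rfl

-- These weights are outcome probabilities of an experiment with `d = 0`, so normalisation is
-- inherited from the unitarity of its circuit.
include hn hU₀ hS in
theorem sum_outWeight_phase (j : ∀ κ, Fin (n κ)) (k : ∀ κ, Fin (n κ) → Bits (Fin (P.lenK κ)))
    (κ : ℕ) (kj : Bits (Fin (P.lenK κ))) (σ : Bool) :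
    ∑ y, ∑ s, outWeight (V.S κ) (F.w κ) (fun s => sgn (σ && s (.committed (j κ))) *
      attackState F u V κ (Function.update (k κ) (j κ) kj) (fun s => Wire.com s = y) s) s = 1 := by
  have hO : PolyBounded fun κ => Fintype.card (Fin (n κ) × Fin (P.lenY κ)) := by
    simpa using hn.mul P.lenY_poly
  obtain ⟨p, -, hatt⟩ := exists_sim_attack F u V hn hU₀ hS hO
    (fun κ q => .commitment q.1 q.2) k j
  rw [← (hatt κ).sum_eq_one (cat kj (cat (fun _ => false) (bit σ))), sum_cat, sum_bits_curry]
  refine Finset.sum_congr rfl fun y _ => Finset.sum_congr rfl fun s _ => ?_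
  refine congrFun (congrArg (outWeight (V.S κ) (F.w κ)) ?_) s
  funext s'
  refine congrArg₂ (· * ·) ?_ ?_
  · have h1 : phaseAt (u.w_le κ) (j κ) (fun _ => false) σ s' = sgn (σ && s' (.committed (j κ))) := by
      simp [phaseAt, sgn]
    exact h1.symm
  refine congrFun (congrArg (attackState F u V κ (Function.update (k κ) (j κ) kj)) ?_) s'
  funext s
  refine propext ⟨?_, fun h => ?_⟩
  · rintro rfl
    rfl
  · funext i q
    exact congrFun h (i, q)

end Experiments

/-! ### Claws and inner products -/

section Hardcore

variable {P : Interface}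

theorem outWeight_nonneg {n p l e m : ℕ} (S : Channel (Wire n p l e m)) (w : ℕ)
    (φ : Bits (Wire n p l e m) → ℂ) (s : Bits (Wire n p l e m)) : 0 ≤ outWeight S w φ s :=
  Finset.sum_nonneg fun _ _ => by positivity

/-- Additivity of the inner product modulo 2, from `b = a ⊕ (a ⊕ b)`. -/
theorem sgn_dotXor {w : ℕ} (d a b : Bits (Fin w)) :
    ∏ q, sgn (d q && b q) = (∏ q, sgn (d q && a q)) * sgn (dotXor d a b) := by
  have h1 : sgn (dotXor d a b) = ∏ q, sgn (d q && (a q ^^ b q)) := by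
    have h2 : ∀ q, sgn (d q && (a q ^^ b q)) =
        if d q = true ∧ (a q ^^ b q) = true then -1 else 1 := by
      intro q
      simp [sgn]
    simp only [h2]
    rw [Finset.prod_ite, Finset.prod_const, Finset.prod_const_one, mul_one, dotXor]
    rcases Nat.even_or_odd (Finset.univ.filter
      fun q => d q = true ∧ (a q ^^ b q) = true).card with h | h
    · rw [h.neg_one_pow, decide_eq_false (Nat.not_odd_iff_even.2 h)]
      rfl
    · rw [h.neg_one_pow, decide_eq_true h]
      rfl
  rw [h1, ← Finset.prod_mul_distrib]
  refine Finset.prod_congr rfl fun q _ => ?_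
  cases d q <;> cases a q <;> cases b q <;> simp [sgn]

/-- A claw is determined by one of its elements. -/
theorem NTCF.claw_unique (F : NTCF P) {κ : ℕ} {k : Bits (Fin (P.lenK κ))} (hk : k ∈ F.K κ)
    {x₀ x₁ x₀' x₁' : Bits (Fin (P.lenX κ))} (h : (x₀, x₁) ∈ F.R κ k) (h' : (x₀', x₁') ∈ F.R κ k)
    (b : Bool) (hb : (if b then x₁ else x₀) = if b then x₁' else x₀') : x₀ = x₀' ∧ x₁ = x₁' := by
  cases b
  · obtain rfl : x₀ = x₀' := by simpa using hb
    exact ⟨rfl, (F.matching_left κ k hk x₀ h.1).unique h h'⟩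
  · obtain rfl : x₁ = x₁' := by simpa using hb
    exact ⟨(F.matching_right κ k hk x₁ h.2.1).unique h h', rfl⟩

/-- By the perfect matching, `b` and the element with that index determine the claw, so the
existential quantifiers have a single possible witness. The function `φ` is the inner product or its
negation, which covers both sets of the hardcore property. -/
theorem NTCF.mem_claws_iff (F : NTCF P) {κ : ℕ} {k : Bits (Fin (P.lenK κ))} (hk : k ∈ F.K κ)
    {x₀ x₁ : Bits (Fin (P.lenX κ))} (h : (x₀, x₁) ∈ F.R κ k) (b : Bool) (d : Bits (Fin (F.w κ)))
    (e : Bool) (φ : Bits (Fin (F.w κ)) → Bits (Fin (P.lenX κ)) → Bits (Fin (P.lenX κ)) → Bool) :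
    cat (bit b) (cat (if b then x₁ else x₀) (cat d (bit e))) ∈
        {o : Bits (Unit ⊕ Fin (P.lenX κ) ⊕ Fin (F.w κ) ⊕ Unit) |
          ∃ b x₀ x₁ d, (x₀, x₁) ∈ F.R κ k ∧ d ∈ F.G κ k false x₀ ∧ d ∈ F.G κ k true x₁ ∧
            o = cat (bit b) (cat (if b then x₁ else x₀) (cat d (bit (φ d x₀ x₁))))} ↔
      (d ∈ F.G κ k false x₀ ∧ d ∈ F.G κ k true x₁) ∧ e = φ d x₀ x₁ := by
  have hbit : ∀ {a a' : Bool}, bit a = bit a' → a = a' := fun h => congrFun h ()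
  constructor
  · rintro ⟨b', x₀', x₁', d', h', h0, h1, ho⟩
    obtain ⟨e1, e2⟩ := cat_inj.1 ho
    obtain ⟨e5, e3⟩ := cat_inj.1 e2
    obtain ⟨rfl, e4⟩ := cat_inj.1 e3
    obtain rfl := hbit e1
    obtain ⟨rfl, rfl⟩ := F.claw_unique hk h h' b e5
    exact ⟨⟨h0, h1⟩, hbit e4⟩
  · rintro ⟨⟨h0, h1⟩, rfl⟩
    exact ⟨b, x₀, x₁, d, h, h0, h1, rfl⟩

end Hardcore

/-! ### The diagonal part: reduction to the adaptive hardcore bit -/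

section Parts

variable {P : Interface} {n : ℕ → ℕ} (F : ExtendedTCF P) (u : InjectionUnitary F.toNTCF)
  (V : Prover P n u.block)

theorem results_update (κ : ℕ) (h : Fin (n κ) → Bool) (j : Fin (n κ))
    (k : Fin (n κ) → Bits (Fin (P.lenK κ)))
    (t : Fin (n κ) → Bits (Fin (P.lenT κ))) (r : Bits (Fin (n κ))) (c : Bool)
    (y : Fin (n κ) → Bits (Fin (P.lenY κ))) (s : Bits (AttackWire F u V κ))
    (kj : Bits (Fin (P.lenK κ))) (tj : Bits (Fin (P.lenT κ))) :
    results F u V κ h j (Function.update k j kj) (Function.update t j tj) r c y s =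
      results F u V κ h j k t r c y s := by
  funext i
  by_cases hi : i = j
  · subst hi; simp [results]
  · simp only [results, Function.update_of_ne hi]

/-- The contribution of the value `c` to `diagPart`. -/
def diagTerm (κ : ℕ) (h : Fin (n κ) → Bool) (j : Fin (n κ)) (A : Bits (Fin (n κ)) → ℝ)
    (k : Fin (n κ) → Bits (Fin (P.lenK κ))) (t : Fin (n κ) → Bits (Fin (P.lenT κ)))
    (r : Bits (Fin (n κ))) (c : Bool) : ℝ :=
  ∑ y, ∑ s, (1 / 2) *
    (outWeight (V.S κ) (F.w κ) (attackState F u V κ k fun s => Wire.com s = y) s +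
      outWeight (V.S κ) (F.w κ)
        (zAt (.committed j) (attackState F u V κ k fun s => Wire.com s = y)) s) *
    ((storeAt F u V κ j k t y s c - storeAt F u V κ j k t y s (!c)) *
      (2 * A (results F u V κ h j k t r c y s) - 1))

/-- The difference of storing probabilities changes sign with `c`, so the constant in `2 A - 1`
cancels in the sum over `c`. With this constant each single term is a difference of two success
probabilities. -/
theorem diagPart_eq (κ : ℕ) (h : Fin (n κ) → Bool) (j : Fin (n κ)) (A : Bits (Fin (n κ)) → ℝ)
    (k : Fin (n κ) → Bits (Fin (P.lenK κ))) (t : Fin (n κ) → Bits (Fin (P.lenT κ)))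
    (r : Bits (Fin (n κ))) :
    diagPart F u V κ h j A k t r = (1 / 2) * ∑ c, diagTerm F u V κ h j A k t r c := by
  rw [Fintype.sum_bool, diagTerm, diagTerm, diagPart, ← Finset.sum_add_distrib, Finset.mul_sum]
  refine Finset.sum_congr rfl fun y _ => ?_
  rw [← Finset.sum_add_distrib, Finset.mul_sum]
  refine Finset.sum_congr rfl fun s _ => ?_
  rw [Fintype.sum_bool, Bool.not_true, Bool.not_false]
  ring

variable (hn : PolyBounded n) (hU₀ : EffUnitary V.U₀) (hS : EffChannel V.S)

-- If `d` is not in the good sets, the stored bit is a fair coin and both sides vanish. Otherwise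
-- the first factor is `±1` according to whether `c` is the bit the verifier stores, and the second
-- one is the difference of the probabilities of the answers `0` and `1`; the guess `c ⊕ b' ⊕ a` is
-- right exactly when the answer agrees with this sign.
open Classical in
theorem storeAt_sub_mul {κ : ℕ} {ρ : Bits (Fin (F.coins κ))} {j : Fin (n κ)}
    {k : Fin (n κ) → Bits (Fin (P.lenK κ))} {t : Fin (n κ) → Bits (Fin (P.lenT κ))}
    (hk : k j = (F.gen κ ρ).1) (ht : t j = (F.gen κ ρ).2)
    {y : Fin (n κ) → Bits (Fin (P.lenY κ))} {x₀ x₁ : Bits (Fin (P.lenX κ))}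
    (hR : (x₀, x₁) ∈ F.R κ (F.gen κ ρ).1)
    (h0 : F.inv κ (F.gen κ ρ).2 false (y j) = some x₀)
    (h1 : F.inv κ (F.gen κ ρ).2 true (y j) = some x₁)
    (s : Bits (AttackWire F u V κ)) (c : Bool) (p : Bool → ℝ) (hp : p true = 1 - p false) :
    (storeAt F u V κ j k t y s c - storeAt F u V κ j k t y s (!c)) * (2 * p false - 1) =
      (∑ a, p a * if (reported F u V κ j s ∈ F.G κ (F.gen κ ρ).1 false x₀ ∧
          reported F u V κ j s ∈ F.G κ (F.gen κ ρ).1 true x₁) ∧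
        (c ^^ (s (.committed j) ^^ a)) = dotXor (reported F u V κ j s) (F.J κ x₀) (F.J κ x₁)
        then 1 else 0) -
      ∑ a, p a * if (reported F u V κ j s ∈ F.G κ (F.gen κ ρ).1 false x₀ ∧
          reported F u V κ j s ∈ F.G κ (F.gen κ ρ).1 true x₁) ∧
        (c ^^ (s (.committed j) ^^ a)) = !dotXor (reported F u V κ j s) (F.J κ x₀) (F.J κ x₁)
        then 1 else 0 := by
  have hst : ∀ c, storeAt F u V κ j k t y s c =
      if reported F u V κ j s ∈ F.G κ (F.gen κ ρ).1 false x₀ ∧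
          reported F u V κ j s ∈ F.G κ (F.gen κ ρ).1 true x₁ then
        (if c = (s (.committed j) ^^ dotXor (reported F u V κ j s) (F.J κ x₀) (F.J κ x₁))
          then 1 else 0) else 1 / 2 := by
    intro c
    rw [storeAt, hk, ht, storeProb]
    simp only [h0, h1]
    refine ite_congr_prop ?_ _ _
    rw [F.checkG_spec κ ρ false x₀ hR.1, F.checkG_spec κ ρ true x₁ hR.2.1]
  rw [hst, hst]
  by_cases hG : reported F u V κ j s ∈ F.G κ (F.gen κ ρ).1 false x₀ ∧
          reported F u V κ j s ∈ F.G κ (F.gen κ ρ).1 true x₁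
  · simp only [hG, true_and, and_self, if_true, Fintype.sum_bool, hp]
    generalize dotXor (reported F u V κ j s) (F.J κ x₀) (F.J κ x₁) = e
    cases c <;> cases s (.committed j) <;> cases e <;> simp <;> ring
  · simp only [hG, false_and, if_false, mul_zero, Finset.sum_const_zero, sub_self, zero_mul]

-- The key average of the diagonal term is exactly the difference of probabilities that the adaptive
-- hardcore bit property bounds, for the experiment with measured bit and preimage.
include hn hU₀ hS in
theorem diagTerm_negligible (h : ∀ κ, Fin (n κ) → Bool) (j : ∀ κ, Fin (n κ))
    (k : ∀ κ, Fin (n κ) → Bits (Fin (P.lenK κ))) (t : ∀ κ, Fin (n κ) → Bits (Fin (P.lenT κ)))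
    (r : ∀ κ, Bits (Fin (n κ))) (c : ℕ → Bool) (A : ∀ κ, QProc (Fin (n κ)) Unit) (hA : QPT A)
    (hk : ∀ κ ρ, Consistent F u V κ (Function.update (k κ) (j κ) (F.gen κ ρ).1)) :
    ∃ μ, Negligible μ ∧ ∀ κ,
      |(∑ ρ, diagTerm F u V κ (h κ) (j κ) (fun m => (A κ).prob m {bit false})
        (Function.update (k κ) (j κ) (F.gen κ ρ).1) (Function.update (t κ) (j κ) (F.gen κ ρ).2)
        (r κ) (c κ)) / 2 ^ F.coins κ| ≤ μ κ := by
  classical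
  obtain ⟨B, hB, hB'⟩ := exists_standard_experiment F u V hn hU₀ hS h j k t r c A hA
  obtain ⟨μ, hμ, hle⟩ := F.adaptive_hardcore B hB
  refine ⟨μ, hμ, fun κ => ?_⟩
  refine le_of_eq_of_le ?_ (hle κ)
  congr 1
  rw [KeyedFamily.keyAvg, KeyedFamily.keyAvg, ← sub_div, ← Finset.sum_sub_distrib]
  congr 1
  refine Finset.sum_congr rfl fun ρ _ => ?_
  have hkj : Function.update (k κ) (j κ) (F.gen κ ρ).1 (j κ) = (F.gen κ ρ).1 :=
    Function.update_self _ _ _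
  have htj : Function.update (t κ) (j κ) (F.gen κ ρ).2 (j κ) = (F.gen κ ρ).2 :=
    Function.update_self _ _ _
  rw [hB', hB', diagTerm, ← Finset.sum_sub_distrib]
  refine Finset.sum_congr rfl fun y _ => ?_
  have hterm : ∀ s, (1 / 2) * (outWeight (V.S κ) (F.w κ)
        (attackState F u V κ (Function.update (k κ) (j κ) (F.gen κ ρ).1) fun s =>
          Wire.com s = y) s +
      outWeight (V.S κ) (F.w κ) (zAt (.committed (j κ))
        (attackState F u V κ (Function.update (k κ) (j κ) (F.gen κ ρ).1) fun s =>
          Wire.com s = y)) s) = _ := fun s => outWeight_measured F u V κ (hk κ ρ) hkj y s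
  simp only [hterm, results_update, Finset.sum_mul]
  rw [Finset.sum_comm, ← Finset.sum_sub_distrib]
  refine Finset.sum_congr rfl fun b _ => ?_
  rw [Finset.sum_comm, ← Finset.sum_sub_distrib]
  refine Finset.sum_congr rfl fun x _ => ?_
  rw [← Finset.sum_sub_distrib]
  refine Finset.sum_congr rfl fun s _ => ?_
  rw [← mul_sub]
  -- Branches without weight do not matter; in any other branch a basis state of its support
  -- supplies the claw.
  by_cases hz : attackState F u V κ (Function.update (k κ) (j κ) (F.gen κ ρ).1) (fun s =>
      Wire.com s = y ∧ s (.committed (j κ)) = b ∧ Wire.pre s (j κ) = x) = 0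
  · rw [hz, outWeight_zero, zero_mul, zero_mul]
  obtain ⟨s₁, hs₁⟩ := Function.ne_iff.1 hz
  obtain ⟨s₂, ⟨rfl, rfl, rfl⟩, hs₂, -⟩ := attackState_ne_zero F u V κ (hk κ ρ) hs₁
  obtain ⟨x₀, x₁, hR, hx, h0, h1⟩ := (hk κ ρ).claw F u V κ hkj hs₂
  congr 1
  rw [storeAt_sub_mul F u V hkj htj hR h0 h1 s (c κ)
    (fun a => (A κ).prob (results F u V κ (h κ) (j κ) (k κ) (t κ) (r κ) (c κ) (Wire.com s₂) s)
      {bit a}) (QProc.prob_bit_true _ _), hx]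
  congr 1
  · refine Finset.sum_congr rfl fun a _ => congrArg₂ (· * ·) rfl (ite_congr_prop ?_ _ _)
    exact (F.mem_claws_iff (F.gen_mem κ ρ) hR _ _ _
      fun d x₀ x₁ => dotXor d (F.J κ x₀) (F.J κ x₁)).symm
  · refine Finset.sum_congr rfl fun a _ => congrArg₂ (· * ·) rfl (ite_congr_prop ?_ _ _)
    exact (F.mem_claws_iff (F.gen_mem κ ρ) hR _ _ _
      fun d x₀ x₁ => !dotXor d (F.J κ x₀) (F.J κ x₁)).symm

end Parts

/-! ### Guessing with a random additional phase -/

section Coin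

variable {Y S : Type*} [Fintype Y] [Fintype S] (w : Bool → Y → S → ℝ) (p : Y → S → Bool → ℝ)
  (hw1 : ∀ τ, ∑ y, ∑ s, w τ y s = 1)

-- `w τ` stands for the outcome weights with `Z^τ` on the committed qubit. If `Z^d` acts like `Z^β`,
-- the effective phase is `σ ⊕ β`, and the guess `γ ⊕ σ ⊕ a` equals `β` exactly when `a = γ ⊕ σ ⊕
-- β`. The coin makes the phase uniform, so the success probability does not depend on `β`.
include hw1 in
theorem coin_guess (hp : ∀ y s, p y s true = 1 - p y s false) (γ β : Bool) :
    ∑ σ, ∑ y, ∑ s, (1 / 2 * w (σ ^^ β) y s) * p y s (γ ^^ (σ ^^ β)) =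
      1 / 2 + (if γ then -1 else 1) / 2 *
        (∑ y, ∑ s, w false y s * p y s false - ∑ y, ∑ s, w true y s * p y s false) := by
  have hf : ∀ τ, ∑ y, ∑ s, (1 / 2 * w τ y s) * p y s false =
      (1 / 2) * ∑ y, ∑ s, w τ y s * p y s false := by
    intro τ
    simp only [Finset.mul_sum, mul_assoc]
  have ht : ∀ τ, ∑ y, ∑ s, (1 / 2 * w τ y s) * p y s true =
      (1 / 2) * (1 - ∑ y, ∑ s, w τ y s * p y s false) := by
    intro τ
    rw [← hw1 τ]
    simp only [← Finset.sum_sub_distrib, Finset.mul_sum]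
    refine Finset.sum_congr rfl fun y _ => Finset.sum_congr rfl fun s _ => ?_
    rw [hp]
    ring
  rw [Fintype.sum_bool]
  cases γ <;> cases β <;>
    simp only [Bool.xor_false, Bool.xor_true, Bool.not_true, Bool.not_false,
      hf, ht, if_true, Bool.false_eq_true, if_false] <;>
    ring

-- For keys where both values of the inner product occur, success is certain; there it is enough
-- that the success formula of the other keys never exceeds one.
include hw1 in
theorem coin_guess_le_one (hw0 : ∀ τ y s, 0 ≤ w τ y s) (hp : ∀ y s, 0 ≤ p y s false ∧ p y s false ≤ 1)
    (γ : Bool) : 1 / 2 + (if γ then -1 else 1) / 2 *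
      (∑ y, ∑ s, w false y s * p y s false - ∑ y, ∑ s, w true y s * p y s false) ≤ 1 := by
  have hv0 : ∀ τ, 0 ≤ ∑ y, ∑ s, w τ y s * p y s false := fun τ =>
    Finset.sum_nonneg fun y _ => Finset.sum_nonneg fun s _ => mul_nonneg (hw0 τ y s) (hp y s).1
  have hv1 : ∀ τ, ∑ y, ∑ s, w τ y s * p y s false ≤ 1 := by
    intro τ
    rw [← hw1 τ]
    exact Finset.sum_le_sum fun y _ => Finset.sum_le_sum fun s _ =>
      mul_le_of_le_one_right (hw0 τ y s) (hp y s).2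
  have h1 := hv0 false
  have h2 := hv0 true
  have h3 := hv1 false
  have h4 := hv1 true
  cases γ <;> simp only [if_true, Bool.false_eq_true, if_false] <;> linarith

end Coin

/-! ### The cross part: reduction to the hardcore property -/

section CrossPart

variable {P : Interface} {n : ℕ → ℕ} (F : ExtendedTCF P) (u : InjectionUnitary F.toNTCF)
  (V : Prover P n u.block) (hn : PolyBounded n) (hU₀ : EffUnitary V.U₀) (hS : EffChannel V.S)

/-- The state has norm one, so some basis state has nonzero amplitude and yields a claw. Hence the
set of values of the inner product is not empty. -/
theorem Consistent.exists_claw {κ : ℕ} {k : Fin (n κ) → Bits (Fin (P.lenK κ))}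
    (hk : Consistent F u V κ k) {j : Fin (n κ)} {ρ : Bits (Fin (F.coins κ))}
    (hj : k j = (F.gen κ ρ).1) : ∃ x₀ x₁, (x₀, x₁) ∈ F.R κ (F.gen κ ρ).1 := by
  have h1 := unitary_sum_normSq (V.unitary κ) (Wire.init k)
  obtain ⟨s, -, hs⟩ := Finset.exists_ne_zero_of_sum_ne_zero (h1.trans_ne one_ne_zero)
  obtain ⟨x₀, x₁, hR, -⟩ := hk.claw F u V κ hj (s := s) fun h => hs (by simp [h])
  exact ⟨x₀, x₁, hR⟩

/-- If `d · (J x₀ ⊕ J x₁)` has the value `β` for all claws, the operator `Z ^ d` on a preimage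
register acts like `Z ^ β` on the committed qubit. -/
theorem outWeight_phase {κ : ℕ} {k : Fin (n κ) → Bits (Fin (P.lenK κ))}
    (hk : Consistent F u V κ k) {j : Fin (n κ)} {ρ : Bits (Fin (F.coins κ))}
    (hj : k j = (F.gen κ ρ).1) {d : Bits (Fin (F.w κ))} {β : Bool}
    (hβ : ∀ x₀ x₁, (x₀, x₁) ∈ F.R κ (F.gen κ ρ).1 → dotXor d (F.J κ x₀) (F.J κ x₁) = β)
    (σ : Bool) (y : Fin (n κ) → Bits (Fin (P.lenY κ))) (s : Bits (AttackWire F u V κ)) :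
    outWeight (V.S κ) (F.w κ) (fun s => phaseAt (u.w_le κ) j d σ s *
        attackState F u V κ k (fun s => Wire.com s = y) s) s =
      outWeight (V.S κ) (F.w κ) (fun s => sgn ((σ ^^ β) && s (.committed j)) *
        attackState F u V κ k (fun s => Wire.com s = y) s) s := by
  let φ := attackState F u V κ k fun s => Wire.com s = y
  by_cases hz : φ = 0
  · have hz' : ∀ s, attackState F u V κ k (fun s => Wire.com s = y) s = 0 := congrFun hz
    simp only [hz', mul_zero]
  obtain ⟨s₁, hs₁⟩ := Function.ne_iff.1 hz
  obtain ⟨s₂, hy, hs₂, -⟩ := attackState_ne_zero F u V κ hk hs₁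
  obtain ⟨x₀, x₁, hR, -, h0, h1⟩ := hk.claw F u V κ hj hs₂
  rw [hy] at h0 h1
  -- The commitment string fixes the claw, so `(-1)^(d · J x₀)` is the same on the entire support: a
  -- global sign, without effect on the outcome weights.
  have hnorm : ‖∏ q, sgn (d q && F.J κ x₀ q)‖ = 1 := by
    rw [norm_prod]
    exact Finset.prod_eq_one fun q _ => norm_sgn _
  rw [← outWeight_const_mul (V.S κ) (F.w κ) hnorm (fun s => sgn ((σ ^^ β) && s (.committed j)) *
        attackState F u V κ k (fun s => Wire.com s = y) s)]
  refine congrFun (congrArg (outWeight (V.S κ) (F.w κ)) ?_) s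
  funext s'
  by_cases hs' : attackState F u V κ k (fun s => Wire.com s = y) s' = 0
  · rw [hs', mul_zero, mul_zero, mul_zero]
  obtain ⟨s₃, hy', hs₃, h3⟩ := attackState_ne_zero F u V κ hk hs'
  obtain ⟨x₀', x₁', -, hx, h0', h1'⟩ := hk.claw F u V κ hj hs₃
  rw [hy', h0] at h0'
  rw [hy', h1] at h1'
  obtain rfl := Option.some.inj h0'
  obtain rfl := Option.some.inj h1'
  rw [← mul_assoc]
  congr 1
  have h4 : ∀ q, s' (.preimage j (Fin.castLE (u.w_le κ) q)) =
      F.J κ (if s' (.committed j) then x₁ else x₀) q := by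
    intro q
    rw [(h3 j).1, ← hx, ← (h3 j).2]
    rfl
  rw [phaseAt]
  simp only [h4]
  cases s' (.committed j)
  · simp [sgn]
  · simp only [if_true, Bool.and_true]
    rw [sgn_dotXor d (F.J κ x₀) (F.J κ x₁), hβ _ _ hR, sgn_xor]
    ring

theorem crossPart_update (κ : ℕ) (h : Fin (n κ) → Bool) (j : Fin (n κ))
    (A : Bits (Fin (n κ)) → ℝ) (k : Fin (n κ) → Bits (Fin (P.lenK κ)))
    (t : Fin (n κ) → Bits (Fin (P.lenT κ))) (r : Bits (Fin (n κ))) (c : Bool)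
    (kj : Bits (Fin (P.lenK κ))) (tj : Bits (Fin (P.lenT κ))) :
    crossPart F u V κ h j A (Function.update k j kj) (Function.update t j tj) r c =
      (∑ y, ∑ s, outWeight (V.S κ) (F.w κ) (fun s => sgn (false && s (.committed j)) *
          attackState F u V κ (Function.update k j kj) (fun s => Wire.com s = y) s) s *
        A (results F u V κ h j k t r c y s)) -
      ∑ y, ∑ s, outWeight (V.S κ) (F.w κ) (fun s => sgn (true && s (.committed j)) *
          attackState F u V κ (Function.update k j kj) (fun s => Wire.com s = y) s) s *
        A (results F u V κ h j k t r c y s) := by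
  rw [crossPart, ← Finset.sum_sub_distrib]
  refine Finset.sum_congr rfl fun y _ => ?_
  rw [← Finset.sum_sub_distrib]
  refine Finset.sum_congr rfl fun s _ => ?_
  rw [results_update, ← sub_mul]
  refine congrArg₂ (· * ·) (congrArg₂ (· - ·) (congrFun (congrArg (outWeight (V.S κ) (F.w κ)) ?_) s)
    rfl) rfl
  funext s'
  rw [Bool.false_and]
  exact (one_mul _).symm

-- Keys for which both values occur can only raise the success probability, so the experiment gives
-- an upper bound for the signed average only. The negated guess bounds the opposite sign.
include hn hU₀ hS in
theorem crossPart_negligible (h : ∀ κ, Fin (n κ) → Bool) (j : ∀ κ, Fin (n κ))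
    (k : ∀ κ, Fin (n κ) → Bits (Fin (P.lenK κ))) (t : ∀ κ, Fin (n κ) → Bits (Fin (P.lenT κ)))
    (r : ∀ κ, Bits (Fin (n κ))) (c : ℕ → Bool) (A : ∀ κ, QProc (Fin (n κ)) Unit) (hA : QPT A)
    (hk : ∀ κ ρ, Consistent F u V κ (Function.update (k κ) (j κ) (F.gen κ ρ).1)) :
    ∃ μ, Negligible μ ∧ ∀ κ,
      |(∑ ρ, crossPart F u V κ (h κ) (j κ) (fun m => (A κ).prob m {bit false})
        (Function.update (k κ) (j κ) (F.gen κ ρ).1) (Function.update (t κ) (j κ) (F.gen κ ρ).2)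
        (r κ) (c κ)) / 2 ^ F.coins κ| ≤ μ κ := by
  classical
  have hone : ∀ γ : Bool, ∃ μ, Negligible μ ∧ ∀ κ,
      (if γ then -1 else 1) *
        ((∑ ρ, crossPart F u V κ (h κ) (j κ) (fun m => (A κ).prob m {bit false})
          (Function.update (k κ) (j κ) (F.gen κ ρ).1)
          (Function.update (t κ) (j κ) (F.gen κ ρ).2) (r κ) (c κ)) / 2 ^ F.coins κ) ≤ μ κ := by
    intro γ
    obtain ⟨B, hB, hB'⟩ := exists_phase_experiment F u V hn hU₀ hS h j k t r c A hA γ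
    obtain ⟨μ, d, hμ, hle⟩ := F.hardcore B hB
    refine ⟨_, hμ.const_mul zero_le_two, fun κ => ?_⟩
    have hpt : ∀ ρ, 1 / 2 + (if γ then -1 else 1) / 2 *
        crossPart F u V κ (h κ) (j κ) (fun m => (A κ).prob m {bit false})
          (Function.update (k κ) (j κ) (F.gen κ ρ).1)
          (Function.update (t κ) (j κ) (F.gen κ ρ).2) (r κ) (c κ) ≤
        (B κ).prob (cat (F.gen κ ρ).1 (d κ)) {o | ∃ x₀ x₁, (x₀, x₁) ∈ F.R κ (F.gen κ ρ).1 ∧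
            o = bit (dotXor (d κ) (F.J κ x₀) (F.J κ x₁))} := by
      intro ρ
      have hkj : Function.update (k κ) (j κ) (F.gen κ ρ).1 (j κ) = (F.gen κ ρ).1 :=
        Function.update_self _ _ _
      rw [crossPart_update]
      have hw1 := sum_outWeight_phase F u V hn hU₀ hS j k κ (F.gen κ ρ).1
      -- Either the inner product is constant on the claws of this key and the success formula is
      -- exact, or every output bit is a value of it.
      by_cases hβ : ∃ β, ∀ x₀ x₁, (x₀, x₁) ∈ F.R κ (F.gen κ ρ).1 →
          dotXor (d κ) (F.J κ x₀) (F.J κ x₁) = β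
      · obtain ⟨β, hβ⟩ := hβ
        obtain ⟨x₀, x₁, hR⟩ := (hk κ ρ).exists_claw F u V hkj
        have hmem : ∀ e, bit e ∈ {o | ∃ x₀ x₁, (x₀, x₁) ∈ F.R κ (F.gen κ ρ).1 ∧
            o = bit (dotXor (d κ) (F.J κ x₀) (F.J κ x₁))} ↔ e = β := by
          intro e
          constructor
          · rintro ⟨x₀, x₁, hR, he⟩
            rw [hβ _ _ hR] at he
            exact congrFun he ()
          · rintro rfl
            exact ⟨x₀, x₁, hR, by rw [hβ _ _ hR]⟩
        rw [hB']
        refine le_of_eq ((coin_guess _ (fun y s a => (A κ).prob (results F u V κ (h κ) (j κ) (k κ)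
          (t κ) (r κ) (c κ) y s) {bit a}) hw1 (fun y s => QProc.prob_bit_true _ _)
          γ β).symm.trans ?_)
        refine Finset.sum_congr rfl fun σ _ => Finset.sum_congr rfl fun y _ =>
          Finset.sum_congr rfl fun s _ => ?_
        rw [outWeight_phase F u V (hk κ ρ) hkj hβ]
        refine congrArg₂ (· * ·) rfl ?_
        simp only [hmem]
        symm
        refine (Fintype.sum_eq_single (γ ^^ (σ ^^ β)) fun a ha => ?_).trans ?_
        · rw [if_neg, mul_zero]
          rintro rfl
          apply ha
          cases γ <;> cases σ <;> cases a <;> rfl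
        · rw [if_pos, mul_one]
          cases γ <;> cases σ <;> cases β <;> rfl
      · have hmem : ∀ o : Bits Unit, o ∈ {o | ∃ x₀ x₁, (x₀, x₁) ∈ F.R κ (F.gen κ ρ).1 ∧
            o = bit (dotXor (d κ) (F.J κ x₀) (F.J κ x₁))} := by
          intro o
          have hb : ∀ a e : Bool, ¬e = !a → a = e := by decide
          by_contra he
          -- If the bit `o` were not attained, the inner product would be constantly its negation.
          refine hβ ⟨!o (), fun x₀ x₁ hR => ?_⟩
          by_contra hne
          refine he ⟨x₀, x₁, hR, ?_⟩
          funext i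
          exact hb _ _ hne
        refine (coin_guess_le_one _ (fun y s a => (A κ).prob (results F u V κ (h κ) (j κ) (k κ)
          (t κ) (r κ) (c κ) y s) {bit a}) hw1 (fun τ y s => outWeight_nonneg _ _ _ _)
          (fun y s => QProc.prob_bit_mem _ _ _) γ).trans_eq ?_
        rw [QProc.prob_eq_sum, ← (B κ).sim.sum_eq_one (cat (F.gen κ ρ).1 (d κ))]
        exact Finset.sum_congr rfl fun o _ => (if_pos (hmem o)).symm
    have havg : 1 / 2 + (if γ then -1 else 1) / 2 *
        ((∑ ρ, crossPart F u V κ (h κ) (j κ) (fun m => (A κ).prob m {bit false})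
          (Function.update (k κ) (j κ) (F.gen κ ρ).1)
          (Function.update (t κ) (j κ) (F.gen κ ρ).2) (r κ) (c κ)) / 2 ^ F.coins κ) ≤
        F.toKeyedFamily.keyAvg κ (fun k => (B κ).prob (cat k (d κ))
          {o | ∃ x₀ x₁, (x₀, x₁) ∈ F.R κ k ∧
            o = bit (dotXor (d κ) (F.J κ x₀) (F.J κ x₁))}) := by
      have := Finset.sum_le_sum fun (ρ : Bits (Fin (F.coins κ))) (_ : ρ ∈ Finset.univ) => hpt ρ
      rw [Finset.sum_add_distrib, Finset.sum_const, ← Finset.mul_sum] at this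
      have h2 : (0 : ℝ) < 2 ^ F.coins κ := by positivity
      rw [KeyedFamily.keyAvg, le_div_iff₀ h2]
      refine le_of_eq_of_le ?_ this
      rw [add_mul, mul_assoc, div_mul_cancel₀ _ h2.ne']
      simp [mul_comm]
    have h3 := (le_abs_self _).trans (hle κ)
    linarith
  -- The strings `d` provided for the two signs may differ; only the resulting bounds are combined.
  obtain ⟨μ, hμ, h0⟩ := hone false
  obtain ⟨ν, hν, h1⟩ := hone true
  refine ⟨_, hμ.add hν, fun κ => abs_le.2 ⟨?_, ?_⟩⟩
  · have := h1 κ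
    have := hμ.1 κ
    simp only [if_true] at *
    linarith
  · have := h0 κ
    have := hν.1 κ
    simp only [Bool.false_eq_true, if_false] at *
    linarith

end CrossPart

/-- Everything but the key and the trapdoor of qubit `j` may be fixed to the worst case. -/
theorem exists_fixed_choice {P : Interface} (F : ExtendedTCF P) (κ : ℕ) {n : ℕ} (h : Fin n → Bool)
    (j : Fin n) (hj : h j = true)
    (Y : (Fin n → Bits (Fin (P.lenK κ))) → (Fin n → Bits (Fin (P.lenT κ))) → Bits (Fin n) →
      Bool → ℝ) :
    ∃ k t r c, 0 < keyDist F κ h k t ∧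
      |∑ k, ∑ t, keyDist F κ h k t * ((1 / 2) ^ n * ∑ r, (1 / 2) * ∑ c, Y k t r c)| ≤
        |(∑ ρ, Y (Function.update k j (F.gen κ ρ).1) (Function.update t j (F.gen κ ρ).2) r c) /
          2 ^ F.coins κ| := by
  let g (ω : (Fin n → Bits (Fin (P.lenK κ))) × (Fin n → Bits (Fin (P.lenT κ))) × Bits (Fin n) ×
      Bool) : ℝ := keyDist F κ h ω.1 ω.2.1 * ((1 / 2) ^ n * (1 / 2))
  let X (ω : (Fin n → Bits (Fin (P.lenK κ))) × (Fin n → Bits (Fin (P.lenT κ))) × Bits (Fin n) ×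
      Bool) : ℝ := (∑ ρ, Y (Function.update ω.1 j (F.gen κ ρ).1)
        (Function.update ω.2.1 j (F.gen κ ρ).2) ω.2.2.1 ω.2.2.2) / 2 ^ F.coins κ
  have h0 : ∀ ω, 0 ≤ g ω := fun ω => mul_nonneg (keyDist_nonneg F κ h _ _) (by positivity)
  have h1 : ∑ ω, g ω = 1 := by
    simp only [g, Fintype.sum_prod_type, ← Finset.sum_mul, Finset.sum_const, Finset.card_univ,
      nsmul_eq_mul, ← Finset.mul_sum, sum_keyDist]
    rw [show Fintype.card (Bits (Fin n) × Bool) = 2 ^ n * 2 by simp]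
    push_cast
    have h2 : (2 : ℝ) ^ n * (1 / 2) ^ n = 1 := by rw [← mul_pow]; norm_num
    linear_combination h2
  obtain ⟨⟨k, t, r, c⟩, hpos, hle⟩ := exists_abs_sum_le g X h0 h1
  refine ⟨k, t, r, c, ?_, ?_⟩
  · by_contra hn
    have : keyDist F κ h k t = 0 := le_antisymm (not_lt.1 hn) (keyDist_nonneg F κ h k t)
    simp [g, this] at hpos
  · refine le_of_eq_of_le (congrArg _ ?_) hle
    rw [sum_keyDist_resample F κ h j hj]
    simp only [g, X, Fintype.sum_prod_type]
    refine Finset.sum_congr rfl fun k _ => Finset.sum_congr rfl fun t _ => ?_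
    rw [← Finset.mul_sum, Finset.sum_comm, mul_div_assoc, Finset.sum_div, Finset.mul_sum,
      Finset.mul_sum]
    refine Finset.sum_congr rfl fun r _ => ?_
    rw [← Finset.mul_sum, Finset.sum_comm, mul_div_assoc, Finset.sum_div, Finset.mul_sum,
      Finset.mul_sum, Finset.mul_sum]
    refine Finset.sum_congr rfl fun c _ => ?_
    ring

end MeasurementProtocol
end

open MeasurementProtocol
/-- Replacing the Hadamard round attack of a perfect prover by its `X`-trivial version at a committed
qubit `j` with `h j = 1` changes the verifier's distribution of results only to a computationally
indistinguishable one. -/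
theorem mainTheorem4
    (P : Interface) (F : ExtendedTCF P) (u : InjectionUnitary F.toNTCF)
    (n : ℕ → ℕ) (hn : PolyBounded n)
    (V : Prover P n u.block) (hU₀ : EffUnitary V.U₀) (hS : EffChannel V.S)
    (h : ∀ κ, Fin (n κ) → Bool)
    (hperfect : ∀ κ, testAcceptProb F V κ (h κ) = 1)
    (j : ∀ κ, Fin (n κ)) (hj : ∀ κ, h κ (j κ) = true)
    (C : ∀ κ, (V.S κ).ι → Fin 2 → Fin 2 →
      Matrix (Bits {q : Wire (n κ) (u.block κ) (P.lenY κ) (V.e κ) (P.lenK κ) //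
          q ≠ .committed (j κ)})
        (Bits {q : Wire (n κ) (u.block κ) (P.lenY κ) (V.e κ) (P.lenK κ) //
          q ≠ .committed (j κ)}) ℂ)
    (hC : ∀ κ τ, (V.S κ).op τ = ∑ x : Fin 2, ∑ z : Fin 2,
      tensorAt (.committed (j κ)) (pauliX ^ (x : ℕ) * pauliZ ^ (z : ℕ)) (C κ τ x z)) :
    CompIndist
      (fun κ => resultDist F u V κ (h κ))
      (fun κ => resultDist F u
        (V.withAttack fun κ => (V.S κ).xTrivial (.committed (j κ)) (C κ) (hC κ)) κ (h κ)) := by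
  intro A hA
  -- One common choice is made for the sum of both parts, since the worst case concerns its absolute
  -- value; the parts are separated only afterwards.
  have hchoice := fun κ => exists_fixed_choice F κ (h κ) (j κ) (hj κ) fun k t r c =>
    diagTerm F u V κ (h κ) (j κ) (fun m => (A κ).prob m {bit false}) k t r c +
      crossPart F u V κ (h κ) (j κ) (fun m => (A κ).prob m {bit false}) k t r c
  choose k t r c hpos hle using hchoice
  -- The choice has positive probability, which survives replacing the key of qubit `j`; so the
  -- prover is perfect on every key that occurs in the reductions.
  have hk : ∀ κ ρ, Consistent F u V κ (Function.update (k κ) (j κ) (F.gen κ ρ).1) := fun κ ρ =>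
    consistent_of_perfect F u V κ (h κ) (hperfect κ) _ _
      (keyDist_update_pos F κ (h κ) (hpos κ) (j κ) (hj κ) ρ)
  obtain ⟨μ, hμ, hdiag⟩ := diagTerm_negligible F u V hn hU₀ hS h j k t r c A hA hk
  obtain ⟨ν, hν, hcross⟩ := crossPart_negligible F u V hn hU₀ hS h j k t r c A hA hk
  refine ⟨_, (hμ.add hν).const_mul (c := 1 / 2) (by norm_num), fun κ => ?_⟩
  rw [resultDist_sub F u V κ (h κ) (j κ) (hj κ) _
    (fun φ s => outWeight_xTrivial (V.S κ) (F.w κ) (j κ) (C κ) (hC κ) φ s), abs_mul,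
    abs_of_nonneg (by norm_num : (0 : ℝ) ≤ 1 / 2)]
  refine mul_le_mul_of_nonneg_left ?_ (by norm_num)
  have h1 := hle κ
  simp only [Finset.sum_add_distrib, mul_add, ← diagPart_eq] at h1
  simp only [Finset.sum_add_distrib, mul_add]
  refine h1.trans ?_
  rw [add_div]
  exact (abs_add_le _ _).trans (add_le_add (hdiag κ) (hcross κ))
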